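/- All smoothness is of class $C^1$. Let $M$ be a homotopy 3-disc, i.e. a compact, simply connected (Hausdorff) smooth 3-manifold with boundary whose boundary $\partial M$ is diffeomorphic to the standard sphere $S^2$. Let $D\subset M$ be a splitting disc, i.e. a smoothly embedded closed 2-disc, transverse to $\partial M$, with $\operatorname{int} D\subset \operatorname{int} M$ and $\partial D\subset\partial M$. Then there is a pair of closed subsets $U\neq V$ of $M$ such that (1) $U\cup V=M$ and $U\cap V=D$; (2) each of $U$ and $V$ is a 3-dimensional submanifold of $M$ bounded by a 2-sphere: with the subspace topology it carries the structure of a smooth 3-manifold with corners for which the inclusion into $M$ is an immersion, and the boundary of this manifold with corners is homeomorphic to $S^2$. The pair is unique up to order: if $U'\neq V'$ are closed subsets of $M$, each a topological 3-manifold with (possibly empty) boundary in the subspace topology, such that $U'\cup V'=M$ and $U'\cap V'=D$, then $\{U',V'\}=\{U,V\}$. -/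

import Mathlib

open Set Metric Manifold

noncomputable section

/-- Euclidean `n`-space. -/
abbrev Euc (n : ℕ) : Type := EuclideanSpace ℝ (Fin n)

/-- The model with corners `[0,∞)³ ⊆ ℝ³` of three-dimensional manifolds with corners. -/
abbrev cornerModel3 : ModelWithCorners ℝ (Euc 3) (EuclideanQuadrant 3) :=
  modelWithCornersEuclideanQuadrant 3

/-- The standard unit two-sphere in `ℝ³`. -/
abbrev StdSphere2 : Type := sphere (0 : Euc 3) 1

instance : Fact (Module.finrank ℝ (Euc 3) = 2 + 1) := ⟨by simp⟩

section

variable (M : Type*) [TopologicalSpace M] [ChartedSpace (EuclideanHalfSpace 3) M]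

/-- A homotopy 3-disc, for a three-dimensional manifold `M` with boundary and a `C¹` atlas:
`M` is compact and simply connected, and its boundary is a 2-sphere, that is, the image of the
standard 2-sphere under a `C¹` embedding. -/
structure IsHomotopyDisc3 : Prop where
  compact : CompactSpace M
  simplyConnected : SimplyConnectedSpace M
  boundary_sphere : ∃ g : StdSphere2 → M,
    Manifold.IsSmoothEmbedding (𝓡 2) (𝓡∂ 3) 1 g ∧ range g = (𝓡∂ 3).boundary M

variable {M}

/-- The tangent space at `x ∈ ∂M` to the boundary `∂M`, as a subspace of the tangent space of `M`.
The tangent space of `M` at `x` is read in the preferred chart at `x`, which takes values in the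
half-space `{y | 0 ≤ y 0}`, so the vectors tangent to the boundary are those with `v 0 = 0`. -/
def boundaryTangentSpace (x : M) : Submodule ℝ (TangentSpace (𝓡∂ 3) x) :=
  LinearMap.ker ((EuclideanSpace.proj (0 : Fin 3) : Euc 3 →L[ℝ] ℝ) : Euc 3 →ₗ[ℝ] ℝ)

/-- `D` is a splitting disc in `M`: a 2-disc (the image of the closed unit disc of the plane under
a map that is `C¹` up to the boundary circle, injective and of injective derivative) whose
interior lies in the interior of `M`, whose boundary circle lies in the boundary of `M`, and which
is transverse to the boundary of `M` along its boundary circle. -/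
def IsSplittingDisc (D : Set M) : Prop :=
  ∃ f : Euc 2 → M,
    ContMDiffOn (𝓡 2) (𝓡∂ 3) 1 f (closedBall 0 1) ∧
    InjOn f (closedBall 0 1) ∧
    (∀ p ∈ closedBall (0 : Euc 2) 1,
      Function.Injective (mfderivWithin (𝓡 2) (𝓡∂ 3) f (closedBall 0 1) p)) ∧
    f '' closedBall 0 1 = D ∧
    f '' ball 0 1 ⊆ (𝓡∂ 3).interior M ∧
    f '' sphere 0 1 ⊆ (𝓡∂ 3).boundary M ∧
    ∀ p ∈ sphere (0 : Euc 2) 1,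
      LinearMap.range (mfderivWithin (𝓡 2) (𝓡∂ 3) f (closedBall 0 1) p).toLinearMap ⊔
        boundaryTangentSpace (f p) = ⊤

/-- `U` is a closed three-dimensional topological submanifold of `M`: with the subspace topology,
it is a topological 3-manifold with (possibly empty) boundary. -/
def IsTopSubmanifold3 (U : Set M) : Prop :=
  IsClosed U ∧ Nonempty (ChartedSpace (EuclideanHalfSpace 3) U)

/-- `U` is a closed three-dimensional `C¹` submanifold (with corners) of `M`, bounded by a
2-sphere: the subspace `U` carries the structure of a `C¹` 3-manifold with corners for which the
inclusion into `M` is a `C¹` immersion, and the boundary of this manifold with corners (all points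
which are not interior points) is homeomorphic to the 2-sphere. -/
def IsSubmanifold3BoundedBySphere (U : Set M) : Prop :=
  IsClosed U ∧
  ∃ _ : ChartedSpace (EuclideanQuadrant 3) U,
    IsManifold cornerModel3 1 U ∧
    ContMDiff cornerModel3 (𝓡∂ 3) 1 (Subtype.val : U → M) ∧
    (∀ x : U, Function.Injective
      (mfderiv cornerModel3 (𝓡∂ 3) (Subtype.val : U → M) x)) ∧
    Nonempty (cornerModel3.boundary U ≃ₜ StdSphere2)

end

end

/-! Near each of its points the disc `D` is flat: `C¹` coordinates of `M` turn `D` into a coordinate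
plane and, at points of the boundary circle, `∂M` into a second coordinate plane
(`IsSplittingDisc.exists_isStraightening`). At the boundary circle the disc is first extended a
little beyond itself by reflection, and transversality makes the two planes independent. Hence `D`
has two local sides.

The local choices of a side form a double cover of `M`. Since `M` is simply connected the cover is
trivial, so `M \ D` is a disjoint union of open sets `A` and `B`, each accumulating at all of `D`;
connectedness of `D` and of `M` makes `A` and `B` connected (`LocallyTwoSided.exists_separation`).
The two pieces are `A ∪ D` and `B ∪ D`. The straightened coordinates, reflected if necessary, are
charts of these pieces in the quadrant, with boundary `D ∪ (A ∩ ∂M)`, respectively `D ∪ (B ∩ ∂M)`.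

To see that these boundaries are spheres, one needs `A ∩ ∂M` together with `∂D` to be a disc. This
is the Jordan–Schoenflies theorem for the regular `C¹` curve `∂D` on the sphere `∂M`
(`IsC1JordanCurve.exists_discs`). The curve has a bicollar, and collapsing everything off the
bicollar to the two poles gives a map from the sphere to itself that is injective except over the
poles. By Brown's argument the fibre over a pole has arbitrarily small open neighbourhoods
homeomorphic to the plane, so it can be squeezed to a point by a limit of homeomorphisms; this turns
the collapse into a homeomorphism over a hemisphere (`exists_parametrization_of_collapse`). Two
discs with a common boundary circle then form a sphere. That the two discs of `∂M` lie on different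
sides of `D` follows because both `A` and `B` meet `∂M`.

For uniqueness, the complements of `U'` and `V'` are disjoint open sets covering `M \ D`, so each of
the connected sets `A`, `B` lies in one of them (`eq_of_decomposition`). The only other possibility
is that one of the two sets is `D` itself, and a disc is not a 3-manifold, since a 2-sphere does not
embed in the plane. -/

/-! ### Separation of a simply connected space by a locally two-sided closed set -/

section Separation

open Topology Filter Bundle

/-- A `ℤˣ`-valued Čech cocycle on a simply connected, locally path connected space is a
coboundary. -/
theorem exists_coboundary_of_sign_cocycle {X : Type*} [TopologicalSpace X]
    [SimplyConnectedSpace X] [LocallyPathConnectedSpace X] {ι : Type*} (W : ι → Set X)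
    (hW : ∀ i, IsOpen (W i)) (hcov : ∀ x, ∃ i, x ∈ W i) (ε : ι → ι → X → ℤˣ)
    (hself : ∀ i, ∀ x ∈ W i, ε i i x = 1)
    (hcont : ∀ i j, ContinuousOn (ε i j) (W i ∩ W j))
    (hcomp : ∀ i j k x, x ∈ W i → x ∈ W j → x ∈ W k → ε i j x * ε j k x = ε i k x) :
    ∃ η : ι → X → ℤˣ, (∀ i, ContinuousOn (η i) (W i)) ∧
      ∀ i j x, x ∈ W i → x ∈ W j → η j x = η i x * ε i j x := by
  choose ix hix using hcov
  -- The cocycle glues the products `W i × ℤˣ` to a double covering of `X`.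
  let Z : FiberBundleCore ι X ℤˣ :=
    { baseSet := W
      isOpen_baseSet := hW
      indexAt := ix
      mem_baseSet_at := hix
      coordChange := fun i j x v => v * ε i j x
      coordChange_self := fun i x hx v => by simp [hself i x hx]
      continuousOn_coordChange := fun i j => by
        refine continuousOn_snd.mul ((hcont i j).comp continuousOn_fst ?_)
        intro p hp; exact hp.1
      coordChange_comp := fun i j k x hx v => by
        rw [mul_assoc, hcomp i j k x hx.1.1 hx.1.2 hx.2] }
  have hcovm : IsCoveringMap Z.proj := FiberBundle.isCoveringMap
  obtain ⟨x₀⟩ : Nonempty X := inferInstance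
  -- Simple connectivity lifts the identity to a global section of the covering; read in the
  -- trivialization over `W i`, this section is `η i`.
  obtain ⟨σ, ⟨-, hσ⟩, -⟩ := hcovm.existsUnique_continuousMap_lifts (ContinuousMap.id X) x₀
    (⟨x₀, (1 : ℤˣ)⟩ : Z.TotalSpace) rfl
  have hσ' : ∀ x, (σ x).proj = x := fun x => congrFun hσ x
  refine ⟨fun i x => (Z.localTriv i (σ x)).2, fun i => ?_, fun i j x hi hj => ?_⟩
  · refine continuous_snd.comp_continuousOn
      ((Z.localTriv i).continuousOn.comp σ.continuous.continuousOn ?_)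
    intro x hx
    rw [FiberBundleCore.mem_localTriv_source, hσ' x]
    exact hx
  · simp only [FiberBundleCore.localTriv_apply]
    have := Z.coordChange_comp (ix x) i j x ⟨⟨hix x, hi⟩, hj⟩ (σ x).snd
    rw [hσ' x]
    exact this.symm

/-- `D` is locally two-sided: every point of `D` has arbitrarily small neighbourhoods which `D`
splits into two connected open pieces, both of which accumulate at every point of `D`. -/
def LocallyTwoSided {X : Type*} [TopologicalSpace X] (D : Set X) : Prop :=
  ∀ p ∈ D, ∀ O ∈ 𝓝 p, ∃ W P N : Set X, IsOpen W ∧ p ∈ W ∧ W ⊆ O ∧ P ∪ N = W \ D ∧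
    Disjoint P N ∧ IsOpen P ∧ IsOpen N ∧ IsPreconnected P ∧ IsPreconnected N ∧
    W ∩ D ⊆ closure P ∧ W ∩ D ⊆ closure N

variable {X : Type*} [TopologicalSpace X]

theorem IsPreconnected.subset_left_of_disjoint_of_mem {s u v : Set X} (hs : IsPreconnected s)
    (hu : IsOpen u) (hv : IsOpen v) (huv : Disjoint u v) (h : s ⊆ u ∪ v) :
    s ⊆ u ∨ s ⊆ v := by
  rcases s.eq_empty_or_nonempty with rfl | ⟨x, hx⟩
  · exact Or.inl (empty_subset _)
  · rcases h hx with h1 | h1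
    · exact Or.inl (hs.subset_left_of_subset_union hu hv huv h ⟨x, hx, h1⟩)
    · exact Or.inr (hs.subset_right_of_subset_union hu hv huv h ⟨x, hx, h1⟩)

/-- Two connected local pieces at `x` lie on opposite sides of a pair of open sets accumulating
at `x`. -/
theorem opposite_sides {P N A B W D : Set X} {x : X} (hP : IsPreconnected P)
    (hN : IsPreconnected N) (hA : IsOpen A) (hB : IsOpen B) (hAB : Disjoint A B)
    (hW : W ∈ 𝓝 x) (hPN : P ∪ N = W \ D) (hsub : W \ D ⊆ A ∪ B) (hAD : Disjoint A D)
    (hBD : Disjoint B D) (hxA : x ∈ closure A) (hxB : x ∈ closure B) :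
    (P ⊆ A ∧ N ⊆ B) ∨ (P ⊆ B ∧ N ⊆ A) := by
  have hP' := hP.subset_left_of_disjoint_of_mem hA hB hAB
    ((subset_union_left.trans hPN.subset).trans hsub)
  have hN' := hN.subset_left_of_disjoint_of_mem hA hB hAB
    ((subset_union_right.trans hPN.subset).trans hsub)
  -- If both pieces lay in `A`, all of `W \ D` would, and `B` could not accumulate at `x`.
  have key : ∀ {A B : Set X}, Disjoint A B → Disjoint B D → x ∈ closure B → P ⊆ A → N ⊆ A →
      False := by
    intro A B hAB hBD hxB h1 h2
    obtain ⟨y, hyW, hyB⟩ := mem_closure_iff_nhds.1 hxB W hW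
    have : y ∈ P ∪ N := hPN ▸ ⟨hyW, fun h => hBD.le_bot ⟨hyB, h⟩⟩
    exact hAB.le_bot ⟨union_subset h1 h2 this, hyB⟩
  rcases hP' with h1 | h1 <;> rcases hN' with h2 | h2
  · exact (key hAB hBD hxB h1 h2).elim
  · exact Or.inl ⟨h1, h2⟩
  · exact Or.inr ⟨h1, h2⟩
  · exact (key hAB.symm hAD hxA h1 h2).elim

/-- Two connected local pieces at `x`, one on each side, describe both sides near `x`. -/
theorem inter_eq_of_opposite_sides {X : Type*} {P N A B W D : Set X} (hPN : P ∪ N = W \ D)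
    (hAB : Disjoint A B) (hAD : Disjoint A D) (hBD : Disjoint B D) (hPA : P ⊆ A) (hNB : N ⊆ B) :
    W ∩ A = P ∧ W ∩ B = N := by
  have hP : P ⊆ W := (subset_union_left.trans hPN.subset).trans sdiff_subset
  have hN : N ⊆ W := (subset_union_right.trans hPN.subset).trans sdiff_subset
  refine ⟨Subset.antisymm ?_ (subset_inter hP hPA), Subset.antisymm ?_ (subset_inter hN hNB)⟩
  · rintro y ⟨hyW, hyA⟩
    have : y ∈ P ∪ N := hPN ▸ ⟨hyW, fun h => hAD.le_bot ⟨hyA, h⟩⟩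
    exact this.resolve_right fun h => hAB.le_bot ⟨hyA, hNB h⟩
  · rintro y ⟨hyW, hyB⟩
    have : y ∈ P ∪ N := hPN ▸ ⟨hyW, fun h => hBD.le_bot ⟨hyB, h⟩⟩
    exact this.resolve_left fun h => hAB.le_bot ⟨hPA h, hyB⟩

/-- Each local picture assigns signs to its two sides. On overlaps two such sign functions differ by
a factor that does not change across `D`, so these factors form a locally constant cocycle on all of
`X`. Writing it as a coboundary corrects the local signs to one global sign on `Dᶜ`, which still
jumps at every point of `D`. -/
theorem LocallyTwoSided.exists_two_coloring [SimplyConnectedSpace X]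
    [LocallyPathConnectedSpace X] {D : Set X} (hD : IsClosed D) (h : LocallyTwoSided D) :
    ∃ A B : Set X, IsOpen A ∧ IsOpen B ∧ Disjoint A B ∧ A ∪ B = Dᶜ ∧ D ⊆ closure A ∧
      D ⊆ closure B := by
  classical
  have h0 : ∀ p : D, _ := fun p => h p p.2 univ univ_mem
  choose W P N hWo hpW _ hPN hdisj hPo hNo _ _ hPcl hNcl using h0
  -- The index `none` stands for the open set `Dᶜ` with constant sign `1`; the global colouring will
  -- be `η none`.
  let W' : Option D → Set X := fun o => o.elim Dᶜ W
  let s : Option D → X → ℤˣ := fun o x => o.elim 1 fun p => if x ∈ P p then 1 else -1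
  have hW'o : ∀ o, IsOpen (W' o) := by rintro (_ | p); exacts [hD.isOpen_compl, hWo p]
  have hPD : ∀ p, Disjoint (P p) D := fun p =>
    disjoint_left.2 fun x hx => ((hPN p).subset (Or.inl hx)).2
  have hND : ∀ p, Disjoint (N p) D := fun p =>
    disjoint_left.2 fun x hx => ((hPN p).subset (Or.inr hx)).2
  have hsP : ∀ p : D, ∀ x ∈ P p, s (some p) x = 1 := fun p x hx => if_pos hx
  have hsN : ∀ p : D, ∀ x ∈ N p, s (some p) x = -1 := fun p x hx =>
    if_neg fun hx' => (hdisj p).le_bot ⟨hx', hx⟩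
  have hne : ∀ x, (𝓝[Dᶜ] x).NeBot := by
    intro x
    rw [← mem_closure_iff_nhdsWithin_neBot]
    by_cases hx : x ∈ D
    · exact closure_mono (fun y hy hy' => (hPD ⟨x, hx⟩).le_bot ⟨hy, hy'⟩)
        (hPcl ⟨x, hx⟩ ⟨hpW ⟨x, hx⟩, hx⟩)
    · exact subset_closure hx
  -- the sign functions are locally constant off `D`
  have hloc : ∀ o, ∀ x ∈ W' o, x ∉ D → ∀ᶠ y in 𝓝 x, s o y = s o x := by
    rintro (_ | p) x hx hxD
    · exact Eventually.of_forall fun _ => rfl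
    · have : x ∈ P p ∪ N p := hPN p ▸ ⟨hx, hxD⟩
      rcases this with hx' | hx'
      · filter_upwards [(hPo p).mem_nhds hx'] with y hy
        rw [hsP p y hy, hsP p x hx']
      · filter_upwards [(hNo p).mem_nhds hx'] with y hy
        rw [hsN p y hy, hsN p x hx']
  have hex : ∀ i j x, x ∈ W' i → x ∈ W' j → ∃ e : ℤˣ, ∀ᶠ y in 𝓝[Dᶜ] x, s j y = e * s i y := by
    intro i j x hi hj
    by_cases hx : x ∈ D
    · rcases i with _ | p
      · exact (hi hx).elim
      rcases j with _ | q
      · exact (hj hx).elim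
      -- In a smaller two-sided neighbourhood inside `W p ∩ W q`, the pieces `P'` and `N'` lie on
      -- opposite sides of `D` with respect to both `p` and `q`. So both signs flip on passing from
      -- `P'` to `N'`, and their ratio is the same on the two pieces.
      obtain ⟨V, P', N', hVo, hxV, hVW, hPN', _, _, _, hP'c, hN'c, _, _⟩ :=
        h x hx (W p ∩ W q) (((hWo p).inter (hWo q)).mem_nhds ⟨hi, hj⟩)
      have aux : ∀ r : D, V ⊆ W r → ∃ e : ℤˣ, (∀ y ∈ P', s (some r) y = e) ∧
          ∀ y ∈ N', s (some r) y = -e := by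
        intro r hr
        have hxr : x ∈ W r ∩ D := ⟨hr hxV, hx⟩
        rcases opposite_sides hP'c hN'c (hPo r) (hNo r) (hdisj r) (hVo.mem_nhds hxV) hPN'
          (by rw [hPN r]; exact sdiff_subset_sdiff_left hr) (hPD r) (hND r) (hPcl r hxr)
          (hNcl r hxr) with ⟨h1, h2⟩ | ⟨h1, h2⟩
        · exact ⟨1, fun y hy => hsP r y (h1 hy), fun y hy => hsN r y (h2 hy)⟩
        · exact ⟨-1, fun y hy => hsN r y (h1 hy), fun y hy => by rw [hsP r y (h2 hy), neg_neg]⟩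
      obtain ⟨e, he, he'⟩ := aux p (hVW.trans inter_subset_left)
      obtain ⟨e', hf, hf'⟩ := aux q (hVW.trans inter_subset_right)
      refine ⟨e' * e, ?_⟩
      filter_upwards [nhdsWithin_le_nhds (hVo.mem_nhds hxV), self_mem_nhdsWithin] with y hy hyD
      have : y ∈ P' ∪ N' := hPN' ▸ ⟨hy, hyD⟩
      rcases this with hy' | hy'
      · rw [he y hy', hf y hy', mul_assoc, Int.units_mul_self, mul_one]
      · rw [he' y hy', hf' y hy', mul_assoc, mul_neg, Int.units_mul_self, mul_neg, mul_one]
    · refine ⟨s j x * s i x, ?_⟩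
      filter_upwards [nhdsWithin_le_nhds (hloc i x hi hx), nhdsWithin_le_nhds (hloc j x hj hx)]
        with y h1 h2
      rw [h1, h2, mul_assoc, Int.units_mul_self, mul_one]
  -- The cocycle is the limiting ratio of the signs at `x`, taken along `Dᶜ`; it is well defined
  -- also on `D` because `Dᶜ` is dense.
  choose! ε hε using hex
  have huniq : ∀ i j x (e : ℤˣ), x ∈ W' i → x ∈ W' j → (∀ᶠ y in 𝓝[Dᶜ] x, s j y = e * s i y) →
      ε i j x = e := by
    intro i j x e hi hj he
    have := hne x
    obtain ⟨y, h1, h2⟩ := ((hε i j x hi hj).and he).exists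
    exact mul_right_cancel (h1.symm.trans h2)
  obtain ⟨η, hη, hηε⟩ := exists_coboundary_of_sign_cocycle W' hW'o
    (fun x => by
      by_cases hx : x ∈ D
      · exact ⟨some ⟨x, hx⟩, hpW _⟩
      · exact ⟨none, hx⟩) ε
    (fun i x hi => huniq i i x 1 hi hi (Eventually.of_forall fun y => (one_mul _).symm))
    (fun i j => by
      rintro x ⟨hi, hj⟩
      refine ContinuousAt.continuousWithinAt
        ((continuousAt_const (y := ε i j x)).congr ?_)
      have h2 : ∀ᶠ z in 𝓝 x, ∀ᶠ y in 𝓝[Dᶜ] z, s j y = ε i j x * s i y := by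
        have h3 := hε i j x hi hj
        rw [eventually_nhdsWithin_iff] at h3
        filter_upwards [eventually_eventually_nhds.2 h3] with z hz
        rwa [eventually_nhdsWithin_iff]
      filter_upwards [h2, (hW'o i).mem_nhds hi, (hW'o j).mem_nhds hj] with z hz hzi hzj
      exact (huniq i j z _ hzi hzj hz).symm)
    (fun i j k x hi hj hk => by
      refine (huniq i k x _ hi hk ?_).symm
      filter_upwards [hε i j x hi hj, hε j k x hj hk] with y h1 h2
      rw [h2, h1, ← mul_assoc, mul_comm (ε i j x)])
  have hopen : ∀ u : ℤˣ, IsOpen (Dᶜ ∩ η none ⁻¹' {u}) := fun u =>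
    (hη none).isOpen_inter_preimage hD.isOpen_compl (isOpen_discrete _)
  -- near a point of `D` the colouring agrees with the local sides up to a sign
  have hnear : ∀ p : D, ∀ᶠ y in 𝓝[Dᶜ] (p : X), η none y = η (some p) p * s (some p) y := by
    intro p
    have hc : ∀ᶠ y in 𝓝 (p : X), η (some p) y = η (some p) p :=
      ((hη (some p)).continuousAt ((hWo p).mem_nhds (hpW p))).eventually_mem
        ((isOpen_discrete {η (some p) (p : X)}).mem_nhds rfl)
    filter_upwards [nhdsWithin_le_nhds hc, nhdsWithin_le_nhds ((hWo p).mem_nhds (hpW p)),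
      self_mem_nhdsWithin] with y h1 h2 h3
    rw [hηε (some p) none y h2 h3, h1]
    congr 1
    refine huniq _ _ y _ h2 h3 ?_
    filter_upwards [nhdsWithin_le_nhds (hloc (some p) y h2 h3)] with z hz
    rw [hz, Int.units_mul_self]
    rfl
  have hcl : ∀ u : ℤˣ, D ⊆ closure (Dᶜ ∩ η none ⁻¹' {u}) := by
    intro u x hx
    have hn := hnear ⟨x, hx⟩
    rw [eventually_nhdsWithin_iff] at hn
    rw [mem_closure_iff_nhds]
    intro O hO
    have hO' := inter_mem hO hn
    -- Near `x` the colour is `η (some x) x` on the positive side and its negative on the other, so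
    -- the side of colour `u` is decided by this product.
    rcases Int.units_eq_one_or (u * η (some ⟨x, hx⟩) x) with h1 | h1
    · obtain ⟨y, hy, hyP⟩ := mem_closure_iff_nhds.1
        (hPcl ⟨x, hx⟩ ⟨hpW ⟨x, hx⟩, hx⟩) _ hO'
      have hyD : y ∈ Dᶜ := fun hh => (hPD _).le_bot ⟨hyP, hh⟩
      refine ⟨y, hy.1, hyD, ?_⟩
      have := hy.2 hyD
      rw [hsP _ y hyP, mul_one] at this
      rw [mem_preimage, mem_singleton_iff, this]
      rw [mul_eq_one_iff_eq_inv, Int.units_inv_eq_self] at h1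
      exact h1.symm
    · obtain ⟨y, hy, hyP⟩ := mem_closure_iff_nhds.1
        (hNcl ⟨x, hx⟩ ⟨hpW ⟨x, hx⟩, hx⟩) _ hO'
      have hyD : y ∈ Dᶜ := fun hh => (hND _).le_bot ⟨hyP, hh⟩
      refine ⟨y, hy.1, hyD, ?_⟩
      have := hy.2 hyD
      rw [hsN _ y hyP] at this
      rw [mem_preimage, mem_singleton_iff, this, mul_neg, mul_one, neg_eq_iff_eq_neg]
      have h2 : u * (η (some ⟨x, hx⟩) x * η (some ⟨x, hx⟩) x) = -η (some ⟨x, hx⟩) x := by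
        rw [← mul_assoc, h1, neg_one_mul]
      rw [Int.units_mul_self, mul_one] at h2
      rw [h2, neg_neg]
  refine ⟨_, _, hopen 1, hopen (-1), ?_, ?_, hcl 1, hcl (-1)⟩
  · rw [disjoint_left]
    rintro x ⟨-, h1⟩ ⟨-, h2⟩
    rw [mem_preimage, mem_singleton_iff] at h1 h2
    rw [h1] at h2
    exact absurd h2 (by decide)
  · ext x
    constructor
    · rintro (h | h) <;> exact h.1
    · intro hx
      rcases Int.units_eq_one_or (η none x) with h1 | h1
      · exact Or.inl ⟨hx, h1⟩
      · exact Or.inr ⟨hx, h1⟩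

/-- A side of a connected locally two-sided set is connected. -/
theorem LocallyTwoSided.isConnected_side [PreconnectedSpace X] {D A B : Set X}
    (h : LocallyTwoSided D) (hconn : IsConnected D) (hA : IsOpen A) (hB : IsOpen B)
    (hAB : Disjoint A B) (hU : A ∪ B = Dᶜ) (hDA : D ⊆ closure A) (hDB : D ⊆ closure B) :
    IsConnected A := by
  have hAD : Disjoint A D := disjoint_left.2 fun x hx => hU.subset (Or.inl hx)
  have hBD : Disjoint B D := disjoint_left.2 fun x hx => hU.subset (Or.inr hx)
  obtain ⟨d, hd⟩ := hconn.nonempty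
  refine ⟨closure_nonempty_iff.1 ⟨d, hDA hd⟩, ?_⟩
  have hloc : ∀ x ∈ D, ∃ W, IsOpen W ∧ x ∈ W ∧ IsPreconnected (W ∩ A) := by
    intro x hx
    obtain ⟨W, P, N, hWo, hxW, -, hPN, -, -, -, hP, hN, -, -⟩ := h x hx univ univ_mem
    rcases opposite_sides hP hN hA hB hAB (hWo.mem_nhds hxW) hPN
      (by rw [hU]; exact fun y hy => hy.2) hAD hBD (hDA hx) (hDB hx) with ⟨h1, h2⟩ | ⟨h1, h2⟩
    · exact ⟨W, hWo, hxW, by rwa [(inter_eq_of_opposite_sides hPN hAB hAD hBD h1 h2).1]⟩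
    · rw [union_comm] at hPN
      exact ⟨W, hWo, hxW, by rwa [(inter_eq_of_opposite_sides hPN hAB hAD hBD h2 h1).1]⟩
  choose! W hWo hxW hWA using hloc
  by_contra hnot
  have : ∃ u v : Set X, IsOpen u ∧ IsOpen v ∧ Disjoint u v ∧ u ∪ v = A ∧ u.Nonempty ∧
      v.Nonempty := by
    rw [isPreconnected_iff_subset_of_disjoint] at hnot
    push Not at hnot
    obtain ⟨u, v, hu, hv, hsub, hemp, h1, h2⟩ := hnot
    refine ⟨A ∩ u, A ∩ v, hA.inter hu, hA.inter hv, ?_, ?_, ?_, ?_⟩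
    · rw [disjoint_iff_inter_eq_empty, ← hemp]; ext x; simp; tauto
    · rw [← inter_union_distrib_left, inter_eq_left.2 hsub]
    · obtain ⟨x, hx, hx'⟩ := not_subset.1 h2
      exact ⟨x, hx, (hsub hx).resolve_right hx'⟩
    · obtain ⟨x, hx, hx'⟩ := not_subset.1 h1
      exact ⟨x, hx, (hsub hx).resolve_left hx'⟩
  obtain ⟨u, v, hu, hv, huv, huvA, hune, hvne⟩ := this
  -- each point of `D` touches exactly one of `u`, `v`
  have hcases : ∀ x ∈ D, W x ∩ A ⊆ u ∨ W x ∩ A ⊆ v := fun x hx =>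
    (hWA x hx).subset_left_of_disjoint_of_mem hu hv huv (by rw [huvA]; exact inter_subset_right)
  -- If only `u` touches `D`, then `v` is closed in the whole space, its complement being covered by
  -- `u`, `B` and the sets `W x`; this contradicts connectedness of the space.
  have key : ∀ u v : Set X, IsOpen u → IsOpen v → Disjoint u v → u ∪ v = A → v.Nonempty →
      (∀ x ∈ D, W x ∩ A ⊆ u) → False := by
    intro u v hu hv huv huvA hvne hall
    have hvclosed : IsClosed v := by
      rw [← isOpen_compl_iff]
      have : vᶜ = u ∪ B ∪ ⋃ x ∈ D, W x := by
        ext y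
        constructor
        · intro hy
          by_cases hyD : y ∈ D
          · exact Or.inr (mem_biUnion hyD (hxW y hyD))
          · have : y ∈ A ∪ B := hU ▸ hyD
            rcases this with h1 | h1
            · rw [← huvA] at h1
              exact Or.inl (Or.inl (h1.resolve_right hy))
            · exact Or.inl (Or.inr h1)
        · rintro ((hy | hy) | hy) hyv
          · exact huv.le_bot ⟨hy, hyv⟩
          · exact hAB.le_bot ⟨huvA ▸ Or.inr hyv, hy⟩
          · obtain ⟨x, hx, hyx⟩ := mem_iUnion₂.1 hy
            exact huv.le_bot ⟨hall x hx ⟨hyx, huvA ▸ Or.inr hyv⟩, hyv⟩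
      rw [this]
      exact (hu.union hB).union (isOpen_biUnion fun x hx => hWo x hx)
    have := IsClopen.eq_univ ⟨hvclosed, hv⟩ hvne
    exact hAD.le_bot ⟨huvA ▸ Or.inr (this ▸ mem_univ d), hd⟩
  by_cases h1 : ∀ x ∈ D, W x ∩ A ⊆ u
  · exact key u v hu hv huv huvA hvne h1
  by_cases h2 : ∀ x ∈ D, W x ∩ A ⊆ v
  · exact key v u hv hu huv.symm (by rw [union_comm, huvA]) hune h2
  push Not at h1 h2
  obtain ⟨a, ha, ha'⟩ := h1
  obtain ⟨b, hb, hb'⟩ := h2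
  have hav := (hcases a ha).resolve_left ha'
  have hbu := (hcases b hb).resolve_right hb'
  -- The points of `D` touched by `u` and those touched by `v` are covered by two open sets.
  -- Connectedness of `D` gives a point in both, near which `A` would meet `u ∩ v`.
  obtain ⟨y, hyD, hy1, hy2⟩ := hconn.isPreconnected
    (⋃ x ∈ {x ∈ D | W x ∩ A ⊆ u}, W x) (⋃ x ∈ {x ∈ D | W x ∩ A ⊆ v}, W x)
    (isOpen_biUnion fun x hx => hWo x hx.1) (isOpen_biUnion fun x hx => hWo x hx.1)
    (fun x hx => (hcases x hx).imp (fun h => mem_biUnion ⟨hx, h⟩ (hxW x hx))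
      (fun h => mem_biUnion ⟨hx, h⟩ (hxW x hx)))
    ⟨b, hb, mem_biUnion ⟨hb, hbu⟩ (hxW b hb)⟩ ⟨a, ha, mem_biUnion ⟨ha, hav⟩ (hxW a ha)⟩
  obtain ⟨x, ⟨hx, hxu⟩, hyx⟩ := mem_iUnion₂.1 hy1
  obtain ⟨x', ⟨hx', hxv⟩, hyx'⟩ := mem_iUnion₂.1 hy2
  obtain ⟨z, hz, hzA⟩ := mem_closure_iff.1 (hDA hyD) _ ((hWo x hx).inter (hWo x' hx'))
      ⟨hyx, hyx'⟩
  exact huv.le_bot ⟨hxu ⟨hz.1, hzA⟩, hxv ⟨hz.2, hzA⟩⟩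

/-- A connected closed locally two-sided subset of a simply connected space has exactly two
complementary components, and it is the common frontier of both. -/
theorem LocallyTwoSided.exists_separation [SimplyConnectedSpace X]
    [LocallyPathConnectedSpace X] {D : Set X} (h : LocallyTwoSided D) (hD : IsClosed D)
    (hconn : IsConnected D) :
    ∃ A B : Set X, IsOpen A ∧ IsOpen B ∧ IsConnected A ∧ IsConnected B ∧ Disjoint A B ∧
      A ∪ B = Dᶜ ∧ D ⊆ closure A ∧ D ⊆ closure B := by
  obtain ⟨A, B, hA, hB, hAB, hU, hDA, hDB⟩ := h.exists_two_coloring hD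
  exact ⟨A, B, hA, hB, h.isConnected_side hconn hA hB hAB hU hDA hDB,
    h.isConnected_side hconn hB hA hAB.symm (by rw [union_comm, hU]) hDB hDA, hAB, hU, hDA, hDB⟩

end Separation

/-! ### The two-sphere does not embed in the plane -/

section SpherePlane

open Topology Filter

/-- Spherical coordinates on the unit sphere of `ℝ³`. -/
noncomputable def sphericalPoint (p : ℝ × ℝ) : Euc 3 :=
  !₂[Real.sin p.1 * Real.cos p.2, Real.sin p.1 * Real.sin p.2, Real.cos p.1]

theorem continuous_sphericalPoint : Continuous sphericalPoint := by
  unfold sphericalPoint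
  refine (PiLp.continuous_toLp 2 _).comp (continuous_pi fun i => ?_)
  fin_cases i <;> simp <;> fun_prop

theorem sphericalPoint_mem (p : ℝ × ℝ) : sphericalPoint p ∈ sphere (0 : Euc 3) 1 := by
  rw [mem_sphere_zero_iff_norm, EuclideanSpace.norm_eq, Real.sqrt_eq_one]
  simp only [sphericalPoint, Fin.sum_univ_three, Real.norm_eq_abs, sq_abs]
  simp only [Matrix.cons_val_zero, Matrix.cons_val_one, Matrix.cons_val]
  nlinarith [Real.sin_sq_add_cos_sq p.1, Real.sin_sq_add_cos_sq p.2]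

/-- There is no continuous injective map from the two-sphere to the plane. -/
theorem not_injOn_sphere_of_continuousOn {f : Euc 3 → ℂ}
    (hf : ContinuousOn f (sphere 0 1)) : ¬ InjOn f (sphere 0 1) := by
  intro hinj
  have hneg : ∀ p, -sphericalPoint p ∈ sphere (0 : Euc 3) 1 := fun p => by
    simpa using sphericalPoint_mem p
  have hshift : ∀ p : ℝ × ℝ, sphericalPoint (p.1 + Real.pi, p.2) = -sphericalPoint p := by
    intro p
    ext i
    fin_cases i <;> simp [sphericalPoint]
  have hrefl : ∀ p : ℝ × ℝ, sphericalPoint (-p.1, p.2 + Real.pi) = sphericalPoint p := by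
    intro p
    ext i
    fin_cases i <;> simp [sphericalPoint]
  have hpole : ∀ θ, sphericalPoint (0, θ) = sphericalPoint (0, 0) := by
    intro θ
    ext i
    fin_cases i <;> simp [sphericalPoint]
  -- The Borsuk–Ulam argument: the odd function `f x - f (-x)` has no zero when `f` is injective, so
  -- its direction is a circle-valued map, with a continuous argument on the simply connected plane
  -- of spherical coordinates.
  let G : ℝ × ℝ → ℂ := fun p => f (sphericalPoint p) - f (-sphericalPoint p)
  have hG : Continuous G :=
    (hf.comp_continuous continuous_sphericalPoint sphericalPoint_mem).sub
      (hf.comp_continuous continuous_sphericalPoint.neg hneg)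
  have hG0 : ∀ p, G p ≠ 0 := by
    intro p h0
    have h1 := hinj (sphericalPoint_mem p) (hneg p) (sub_eq_zero.1 h0)
    have h2 := sphericalPoint_mem p
    have h3 : sphericalPoint p = 0 := by
      ext i
      have := congrArg (fun v : Euc 3 => v i) h1
      simp only [PiLp.neg_apply] at this
      simp only [PiLp.zero_apply]
      linarith
    simp [h3] at h2
  have hGc : ∀ p, G p / ‖G p‖ ∈ Submonoid.unitSphere ℂ := by
    intro p
    refine mem_sphere_zero_iff_norm.2 ?_
    simp [div_self (norm_ne_zero_iff.2 (hG0 p))]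
  have hGn : Continuous fun p => G p / (‖G p‖ : ℂ) := hG.div (by fun_prop) fun p => by
    simpa using hG0 p
  let g : C(ℝ × ℝ, Circle) :=
    { toFun := fun p => ⟨G p / ‖G p‖, hGc p⟩
      continuous_toFun := hGn.subtype_mk hGc }
  have hgshift : ∀ p : ℝ × ℝ, g (p.1 + Real.pi, p.2) = g p * Circle.exp Real.pi := by
    intro p
    ext
    have : G (p.1 + Real.pi, p.2) = -G p := by simp [G, hshift p]
    change G (p.1 + Real.pi, p.2) / ‖G (p.1 + Real.pi, p.2)‖ = G p / ‖G p‖ * Circle.exp Real.pi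
    rw [this]
    simp [neg_div]
  have hgeq : ∀ p q : ℝ × ℝ, sphericalPoint p = sphericalPoint q → g p = g q := by
    intro p q h
    ext
    change G p / ‖G p‖ = G q / ‖G q‖
    simp only [G, h]
  obtain ⟨L, ⟨-, hL⟩, -⟩ := Circle.isCoveringMap_exp.existsUnique_continuousMap_lifts g
    (0, 0) (Complex.arg (g (0, 0))) (by simp)
  have hL' : ∀ p, Circle.exp (L p) = g p := congrFun hL
  have huniq : ∀ L₁ L₂ : ℝ × ℝ → ℝ, Continuous L₁ → Continuous L₂ →
      (∀ p, Circle.exp (L₁ p) = Circle.exp (L₂ p)) → L₁ (0, 0) = L₂ (0, 0) →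
      ∀ p, L₁ p = L₂ p := by
    intro L₁ L₂ h1 h2 h3 h4
    exact congrFun (Circle.isCoveringMap_exp.eq_of_comp_eq h1 h2 (funext h3) (0, 0) h4)
  set c := L (Real.pi, 0) - L (0, 0) with hc
  have hexpc : Circle.exp c = Circle.exp Real.pi := by
    rw [hc, Circle.exp_sub, hL', hL']
    have := hgshift (0, 0)
    simp only [zero_add] at this
    rw [this, mul_comm, mul_div_cancel_right]
  have h1 : ∀ p : ℝ × ℝ, L (p.1 + Real.pi, p.2) = L p + c := by
    refine huniq _ _ (by fun_prop) (by fun_prop) (fun p => ?_) (by simp [hc])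
    rw [hL', hgshift, Circle.exp_add, hL', hexpc]
  have h2 : ∀ p : ℝ × ℝ, L (0, p.2) = L (0, 0) := by
    refine huniq _ _ (by fun_prop) (by fun_prop) (fun p => ?_) rfl
    rw [hL', hL']
    exact hgeq _ _ (hpole _)
  have h3 : ∀ p : ℝ × ℝ, L (-p.1, p.2 + Real.pi) = L p := by
    refine huniq _ _ (by fun_prop) (by fun_prop) (fun p => ?_) ?_
    · rw [hL', hL']
      exact hgeq _ _ (hrefl _)
    · simpa using h2 (0, Real.pi)
  -- Oddness makes `L` grow by a constant `c`, an odd multiple of `π`, under the shift by `π` of the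
  -- first coordinate. The chain `L (0, 0) = L (0, π) = L (-π, π) + c = L (π, 0) + c = L (0, 0) + 2
  -- * c` forces `c = 0`.
  have e1 := h3 (Real.pi, 0)
  have e2 := h1 (-Real.pi, Real.pi)
  have e3 := h2 (0, Real.pi)
  simp only [neg_add_cancel, zero_add] at e1 e2 e3
  have hc0 : c = 0 := by linarith
  rw [hc0, Circle.exp_zero] at hexpc
  have := congrArg (fun z : Circle => (z : ℂ)) hexpc
  norm_num at this

/-- A nonempty three-dimensional manifold with boundary does not embed in the plane. -/
theorem not_injective_of_chartedSpace_halfSpace {Y : Type*} [TopologicalSpace Y] [Nonempty Y]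
    [ChartedSpace (EuclideanHalfSpace 3) Y] {φ : Y → Euc 2} (hφ : Continuous φ) :
    ¬ Function.Injective φ := by
  intro hinj
  obtain ⟨y⟩ := ‹Nonempty Y›
  set e := chartAt (EuclideanHalfSpace 3) y
  have hy : e y ∈ e.target := e.map_source (mem_chart_source _ y)
  obtain ⟨O, hO, hOe⟩ := isOpen_induced_iff.1 e.open_target
  have hyO : (e y).1 ∈ O := by
    have : e y ∈ Subtype.val ⁻¹' O := by rw [hOe]; exact hy
    exact this
  obtain ⟨r, hr, hrO⟩ := Metric.isOpen_iff.1 hO _ hyO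
  -- Moving the centre inward by `r / 3` makes room for a sphere of radius `r / 3` inside both the
  -- half-space and the ball of radius `r`, even when `y` is a boundary point.
  set q : Euc 3 := (e y).1 + EuclideanSpace.single 0 (r / 3) with hq
  have hmem : ∀ u ∈ sphere (0 : Euc 3) 1, 0 ≤ (q + (r / 3) • u) 0 ∧ q + (r / 3) • u ∈ O := by
    intro u hu
    rw [mem_sphere_zero_iff_norm] at hu
    constructor
    · have h1 : |u 0| ≤ 1 := by
        have := PiLp.norm_apply_le u 0
        rwa [hu] at this
      have h2 := (e y).2
      have h3 := (abs_le.1 h1).1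
      simp only [hq, PiLp.add_apply, PiLp.smul_apply, smul_eq_mul]
      simp
      nlinarith
    · apply hrO
      rw [mem_ball, dist_eq_norm, hq]
      calc ‖(e y).1 + EuclideanSpace.single 0 (r / 3) + (r / 3) • u - (e y).1‖
          = ‖EuclideanSpace.single (0 : Fin 3) (r / 3) + (r / 3) • u‖ := by congr 1; abel
        _ ≤ ‖EuclideanSpace.single (0 : Fin 3) (r / 3)‖ + ‖(r / 3) • u‖ := norm_add_le _ _
        _ = r / 3 + r / 3 := by
            rw [norm_smul, hu]
            simp [abs_of_pos hr]
        _ < r := by linarith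
  let h : sphere (0 : Euc 3) 1 → EuclideanHalfSpace 3 := fun u =>
    ⟨q + (r / 3) • (u : Euc 3), (hmem u u.2).1⟩
  have hh : Continuous h := by
    refine Continuous.subtype_mk ?_ _
    fun_prop
  have hht : ∀ u, h u ∈ e.target := by
    intro u
    rw [← hOe]
    exact (hmem u u.2).2
  have hhinj : Function.Injective h := by
    intro u v huv
    have h1 := congrArg Subtype.val huv
    have h2 : (r / 3) • (u : Euc 3) = (r / 3) • (v : Euc 3) := add_left_cancel h1
    exact Subtype.ext (smul_right_injective _ (by positivity : r / 3 ≠ 0) h2)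
  let ψ : sphere (0 : Euc 3) 1 → ℂ := fun u =>
    Complex.orthonormalBasisOneI.repr.symm (φ (e.symm (h u)))
  have hψ : Continuous ψ := by
    refine (LinearIsometryEquiv.continuous _).comp (hφ.comp ?_)
    exact e.symm.continuousOn.comp_continuous hh hht
  have hψinj : Function.Injective ψ := by
    intro u v huv
    have h1 := hinj ((LinearIsometryEquiv.injective _) huv)
    have h2 := e.symm.injOn (hht u) (hht v) h1
    exact hhinj h2
  classical
  let f : Euc 3 → ℂ := fun x => if hx : x ∈ sphere (0 : Euc 3) 1 then ψ ⟨x, hx⟩ else 0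
  have hfr : (sphere (0 : Euc 3) 1).domRestrict f = ψ := by
    funext u
    exact dif_pos u.2
  refine not_injOn_sphere_of_continuousOn (f := f) ?_ ?_
  · rw [continuousOn_iff_continuous_domRestrict, hfr]
    exact hψ
  · rw [injOn_iff_injective, hfr]
    exact hψinj

end SpherePlane

/-! ### Brown's collapsing argument -/

section Brown

open Topology Filter

section Radial

variable {V : Type*} [NormedAddCommGroup V] [NormedSpace ℝ V]

/-- Space can be squeezed radially into a ball, keeping a smaller concentric ball fixed. -/
theorem exists_squeeze (b : V) {r : ℝ} (hr : 0 < r) :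
    ∃ k k' : V → V, Continuous k ∧ ContinuousOn k' (ball b r) ∧ (∀ x, k' (k x) = x) ∧
      (∀ y ∈ ball b r, k (k' y) = y) ∧ (∀ x, k x ∈ ball b r) ∧
      (∀ x ∈ ball b (r / 2), k x = x) ∧ ∀ x ∈ ball b (r / 2), k' x = x := by
  -- The profile `t ↦ m t * t` is the identity up to `r / 2` and `r - r ^ 2 / (4 * t)` beyond, so it
  -- increases to `r`. Its inverse `u ↦ n u * u` is `r ^ 2 / (4 * (r - u))` beyond `r / 2`.
  let m : ℝ → ℝ := fun t => r / max t (r / 2) - r ^ 2 / (4 * max t (r / 2) ^ 2)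
  let n : ℝ → ℝ := fun u => r ^ 2 / (4 * max u (r / 2) * (r - max u (r / 2)))
  have hr2 : ∀ t, 0 < max t (r / 2) := fun t => lt_max_of_lt_right (by positivity)
  have hm1 : ∀ t, t ≤ r / 2 → m t = 1 := by
    intro t ht
    simp only [m, max_eq_right ht]
    field_simp
    norm_num
  have hn1 : ∀ t, t ≤ r / 2 → n t = 1 := by
    intro t ht
    simp only [n, max_eq_right ht]
    field_simp
    norm_num
  have hm2 : ∀ t, r / 2 ≤ t → m t * t = r - r ^ 2 / (4 * t) := by
    intro t ht
    have ht0 : 0 < t := by linarith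
    simp only [m, max_eq_left ht]
    field_simp
  have hn2 : ∀ u, r / 2 ≤ u → u < r → n u * u = r ^ 2 / (4 * (r - u)) := by
    intro u hu hur
    have hu0 : 0 < u := by linarith
    have : 0 < r - u := by linarith
    simp only [n, max_eq_left hu]
    field_simp
  have hm0 : ∀ t, 0 < m t := by
    intro t
    have h2 := hr2 t
    have h3 : r / 2 ≤ max t (r / 2) := le_max_right _ _
    simp only [m]
    rw [sub_pos, div_lt_div_iff₀ (by positivity) h2]
    nlinarith [mul_pos hr h2]
  have hn0 : ∀ u, u < r → 0 < n u := by
    intro u hu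
    have h2 := hr2 u
    have h3 : max u (r / 2) < r := max_lt hu (by linarith)
    have : 0 < r - max u (r / 2) := by linarith
    simp only [n]
    positivity
  let k : V → V := fun x => b + m ‖x - b‖ • (x - b)
  let k' : V → V := fun x => b + n ‖x - b‖ • (x - b)
  have hkn : ∀ x, ‖k x - b‖ = m ‖x - b‖ * ‖x - b‖ := by
    intro x
    simp only [k, add_sub_cancel_left, norm_smul, Real.norm_eq_abs, abs_of_pos (hm0 _)]
  have hkn' : ∀ x ∈ ball b r, ‖k' x - b‖ = n ‖x - b‖ * ‖x - b‖ := by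
    intro x hx
    rw [mem_ball, dist_eq_norm] at hx
    simp only [k', add_sub_cancel_left, norm_smul, Real.norm_eq_abs, abs_of_pos (hn0 _ hx)]
  have hsmall : ∀ x ∈ ball b (r / 2), k x = x := by
    intro x hx
    rw [mem_ball, dist_eq_norm] at hx
    simp [k, hm1 _ hx.le]
  have hsmall' : ∀ x ∈ ball b (r / 2), k' x = x := by
    intro x hx
    rw [mem_ball, dist_eq_norm] at hx
    simp [k', hn1 _ hx.le]
  refine ⟨k, k', ?_, ?_, ?_, ?_, ?_, hsmall, hsmall'⟩
  · have : Continuous m := by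
      refine Continuous.sub (Continuous.div (by fun_prop) (by fun_prop) fun t => (hr2 t).ne')
        (Continuous.div (by fun_prop) (by fun_prop) fun t => ?_)
      have := hr2 t
      positivity
    fun_prop
  · have : ContinuousOn n (Iio r) := by
      refine ContinuousOn.div (by fun_prop) (by fun_prop) fun t ht => ?_
      have h2 := hr2 t
      have h3 : max t (r / 2) < r := max_lt ht (by linarith)
      have : 0 < r - max t (r / 2) := by linarith
      positivity
    refine continuousOn_const.add (ContinuousOn.smul (this.comp (by fun_prop) ?_) (by fun_prop))
    intro x hx
    rwa [mem_ball, dist_eq_norm] at hx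
  · intro x
    rcases lt_or_ge ‖x - b‖ (r / 2) with h | h
    · have hx : x ∈ ball b (r / 2) := by rwa [mem_ball, dist_eq_norm]
      rw [hsmall x hx, hsmall' x hx]
    · have h0 : 0 < ‖x - b‖ := by linarith
      have h1 := hm2 _ h
      have h2 : r / 2 ≤ m ‖x - b‖ * ‖x - b‖ := by
        rw [h1, le_sub_comm, div_le_iff₀ (by positivity)]
        nlinarith
      have h3 : m ‖x - b‖ * ‖x - b‖ < r := by
        rw [h1]
        have : 0 < r ^ 2 / (4 * ‖x - b‖) := by positivity
        linarith
      have h4 := hn2 _ h2 h3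
      have h5 : n (m ‖x - b‖ * ‖x - b‖) * m ‖x - b‖ = 1 := by
        have : n (m ‖x - b‖ * ‖x - b‖) * m ‖x - b‖ * ‖x - b‖ = 1 * ‖x - b‖ := by
          rw [mul_assoc, h4, h1, sub_sub_cancel]
          field_simp
        exact mul_right_cancel₀ h0.ne' this
      simp only [k']
      rw [hkn]
      simp only [k, add_sub_cancel_left, smul_smul, h5, one_smul, add_sub_cancel]
  · intro x hx
    have hxr : ‖x - b‖ < r := by rwa [mem_ball, dist_eq_norm] at hx
    rcases lt_or_ge ‖x - b‖ (r / 2) with h | h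
    · have hx : x ∈ ball b (r / 2) := by rwa [mem_ball, dist_eq_norm]
      rw [hsmall' x hx, hsmall x hx]
    · have h0 : 0 < ‖x - b‖ := by linarith
      have h0' : 0 < r - ‖x - b‖ := by linarith
      have h1 := hn2 _ h hxr
      have h2 : r / 2 ≤ n ‖x - b‖ * ‖x - b‖ := by
        rw [h1, le_div_iff₀ (by positivity)]
        nlinarith
      have h4 := hm2 _ h2
      have h5 : m (n ‖x - b‖ * ‖x - b‖) * n ‖x - b‖ = 1 := by
        have : m (n ‖x - b‖ * ‖x - b‖) * n ‖x - b‖ * ‖x - b‖ = 1 * ‖x - b‖ := by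
          rw [mul_assoc, h4, h1]
          field_simp
          ring
        exact mul_right_cancel₀ h0.ne' this
      simp only [k]
      rw [hkn' x hx]
      simp only [k', add_sub_cancel_left, smul_smul, h5, one_smul, add_sub_cancel]
  · intro x
    rw [mem_ball, dist_eq_norm, hkn]
    rcases lt_or_ge ‖x - b‖ (r / 2) with h | h
    · rw [hm1 _ h.le]; linarith
    · rw [hm2 _ h]
      have h0 : 0 < ‖x - b‖ := by linarith
      have : 0 < r ^ 2 / (4 * ‖x - b‖) := by positivity
      linarith

/-- A ball can be shrunk into an arbitrarily small one by a bijection of compact support. -/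
theorem exists_radial_shrink {R δ : ℝ} (hR : 0 < R) (hδ : 0 < δ) :
    ∃ h : V → V, Continuous h ∧ Function.Bijective h ∧
      (∀ x, x ∉ closedBall (0 : V) (R + 1) → h x = x) ∧ ∀ x ∈ ball (0 : V) R, h x ∈ ball 0 δ := by
  have hR1 : 0 < R + 1 := by linarith
  -- The scaling factor is `(‖x‖ / (R + 1)) ^ p` inside the ball of radius `R + 1` and `1` outside;
  -- a large `p` makes it smaller than `δ / R` on the ball of radius `R`.
  obtain ⟨p, hp⟩ := exists_pow_lt_of_lt_one (y := R / (R + 1)) (div_pos hδ hR)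
    ((div_lt_one hR1).2 (by linarith))
  let q : ℝ → ℝ := fun t => (min 1 (t / (R + 1))) ^ p
  have hq : Continuous q := by fun_prop
  have hq0 : ∀ t, 0 < t → 0 < q t := fun t ht => pow_pos (lt_min one_pos (by positivity)) p
  have hqmono : ∀ t u, 0 ≤ t → t ≤ u → q t ≤ q u := fun t u h0 h =>
    pow_le_pow_left₀ (le_min zero_le_one (by positivity)) (by gcongr) p
  have hqnonneg : ∀ t, 0 ≤ t → 0 ≤ q t := fun t ht => pow_nonneg (le_min zero_le_one (by positivity)) p
  have hq1 : ∀ t, R + 1 ≤ t → q t = 1 := by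
    intro t ht
    have : 1 ≤ t / (R + 1) := (one_le_div hR1).2 ht
    simp [q, min_eq_left this]
  let h : V → V := fun x => q ‖x‖ • x
  have hn : ∀ x, ‖h x‖ = q ‖x‖ * ‖x‖ := fun x => by
    simp only [h, norm_smul, Real.norm_eq_abs, abs_of_nonneg (hqnonneg _ (norm_nonneg x))]
  have hmono : ∀ t u, 0 ≤ t → t < u → q t * t < q u * u := by
    intro t u ht htu
    have h1 := hqmono t u ht htu.le
    have h2 := hq0 u (ht.trans_lt htu)
    calc q t * t ≤ q u * t := by gcongr
      _ < q u * u := by gcongr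
  refine ⟨h, by fun_prop, ⟨?_, ?_⟩, ?_, ?_⟩
  · intro x y hxy
    have hnorm : ‖x‖ = ‖y‖ := by
      have h1 : q ‖x‖ * ‖x‖ = q ‖y‖ * ‖y‖ := by rw [← hn, ← hn, hxy]
      rcases lt_trichotomy ‖x‖ ‖y‖ with h2 | h2 | h2
      · exact absurd h1 (hmono _ _ (norm_nonneg _) h2).ne
      · exact h2
      · exact absurd h1 (hmono _ _ (norm_nonneg _) h2).ne'
    rcases eq_or_ne x 0 with rfl | hx
    · rw [norm_zero] at hnorm
      exact (norm_eq_zero.1 hnorm.symm).symm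
    · have h1 : q ‖x‖ • x = q ‖x‖ • y := by
        have : h y = q ‖x‖ • y := by simp only [h, hnorm]
        rw [← this, ← hxy]
      exact smul_right_injective _ (hq0 _ (norm_pos_iff.2 hx)).ne' h1
  · intro y
    rcases eq_or_ne y 0 with rfl | hy
    · exact ⟨0, by simp [h]⟩
    have hyn := norm_pos_iff.2 hy
    have hivt := intermediate_value_Icc (f := fun t => q t * t) (a := 0) (b := max ‖y‖ (R + 1))
      (by positivity) (by fun_prop)
    obtain ⟨t, ht, hty⟩ := hivt (show ‖y‖ ∈ Icc _ _ by
      refine ⟨by simp, ?_⟩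
      simp only [hq1 _ (le_max_right _ _), one_mul]
      exact le_max_left _ _)
    have ht0 : 0 ≤ t := ht.1
    refine ⟨(t / ‖y‖) • y, ?_⟩
    have h1 : ‖(t / ‖y‖) • y‖ = t := by
      rw [norm_smul, Real.norm_eq_abs, abs_of_nonneg (by positivity)]
      field_simp
    simp only [h, h1, smul_smul]
    have : q t * (t / ‖y‖) = 1 := by
      rw [← mul_div_assoc, div_eq_one_iff_eq hyn.ne']
      exact hty
    rw [this, one_smul]
  · intro x hx
    rw [mem_closedBall_zero_iff, not_le] at hx
    simp only [h, hq1 _ hx.le, one_smul]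
  · intro x hx
    rw [mem_ball_zero_iff] at hx ⊢
    rw [hn]
    have h1 : q ‖x‖ ≤ (R / (R + 1)) ^ p := by
      refine pow_le_pow_left₀ (le_min zero_le_one (by positivity)) ?_ p
      refine (min_le_right _ _).trans ?_
      gcongr
    calc q ‖x‖ * ‖x‖ ≤ (R / (R + 1)) ^ p * R := by gcongr
      _ < δ / R * R := by gcongr
      _ = δ := by field_simp

end Radial

/-- A continuous bijection which is the identity off a compact set is a homeomorphism. -/
noncomputable def homeomorphOfEqOffCompact {V : Type*} [TopologicalSpace V] [T2Space V]
    [WeaklyLocallyCompactSpace V] (h : V → V) (hc : Continuous h) (hb : Function.Bijective h)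
    (K : Set V) (hK : IsCompact K) (hid : ∀ x, x ∉ K → h x = x) : V ≃ₜ V :=
  (Equiv.ofBijective h hb).toHomeomorphOfContinuousClosed hc (by
    have : IsProperMap h := by
      rw [isProperMap_iff_tendsto_cocompact]
      refine ⟨hc, ?_⟩
      refine Tendsto.congr' ?_ tendsto_id
      filter_upwards [hK.compl_mem_cocompact] with x hx
      exact (hid x hx).symm
    exact this.isClosedMap)

/-- A section of a closed map is continuous at points with one preimage. -/
theorem IsClosedMap.continuousAt_section {X Y : Type*} [TopologicalSpace X] [TopologicalSpace Y]
    {f : X → Y} (hf : IsClosedMap f) {s : Y → X} (hs : ∀ y, f (s y) = y) {y : Y}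
    (hy : ∀ x, f x = y → x = s y) : ContinuousAt s y := by
  intro O hO
  obtain ⟨U, hUO, hU, hsU⟩ := mem_nhds_iff.1 hO
  have h1 : (f '' Uᶜ)ᶜ ∈ 𝓝 y := by
    refine (hf _ hU.isClosed_compl).isOpen_compl.mem_nhds ?_
    rintro ⟨x, hx, hxy⟩
    exact hx (hy x hxy ▸ hsU)
  change ∀ᶠ z in 𝓝 y, s z ∈ O
  filter_upwards [h1] with z hz
  by_contra hcon
  exact hz ⟨s z, fun h => hcon (hUO h), hs z⟩

open Classical in
/-- The map which is the identity on the fibre `f ⁻¹' {b}`, and is `f` followed by `κ` and by a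
section `s` of `f` elsewhere. -/
noncomputable def conjMap {V W : Type*} (f : V → W) (s : W → V) (κ : W → W) (b : W) (x : V) : V :=
  if f x = b then x else s (κ (f x))

section Conj

variable {V W : Type*} {f : V → W} {s : W → V} {κ : W → W} {b : W} {x : V}

theorem conjMap_of_eq (h : f x = b) : conjMap f s κ b x = x := if_pos h

theorem conjMap_of_ne (h : f x ≠ b) : conjMap f s κ b x = s (κ (f x)) := if_neg h

variable [TopologicalSpace V] [TopologicalSpace W]

/-- Near the fibre over `b` the map is the identity: on the fibre by definition, and off it because
`κ` does nothing and `s` undoes `f`. So continuity holds although `s` need not be continuous at `b`.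
-/
theorem continuousAt_conjMap_of_eq (hf : Continuous f) (h : f x = b)
    (hs : ∀ᶠ y in 𝓝 b, y ≠ b → ∀ z, f z = y → s y = z) (hκ : ∀ᶠ y in 𝓝 b, κ y = y) :
    ContinuousAt (conjMap f s κ b) x := by
  refine continuousAt_id.congr ?_
  subst h
  filter_upwards [hf.continuousAt hs, hf.continuousAt hκ] with z h1 h2
  simp only [mem_preimage, mem_ofPred_eq] at h1 h2
  by_cases hz : f z = f x
  · rw [conjMap_of_eq hz, id]
  · rw [conjMap_of_ne hz, h2, h1 hz z rfl, id]

theorem continuousAt_conjMap_of_ne [T1Space W] (hf : Continuous f) (h : f x ≠ b)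
    (hκ : ContinuousAt κ (f x)) (hs : ContinuousAt s (κ (f x))) :
    ContinuousAt (conjMap f s κ b) x := by
  have h1 : ContinuousAt (fun z => s (κ (f z))) x :=
    ContinuousAt.comp (f := fun z => κ (f z)) hs (ContinuousAt.comp hκ hf.continuousAt)
  refine h1.congr ?_
  filter_upwards [hf.continuousAt (isOpen_ne.mem_nhds h)] with z hz
  exact (conjMap_of_ne hz).symm

end Conj

open Classical in
/-- The conjugate of `h` by an injection `τ` with left inverse `τ'`, extended by the identity. -/
noncomputable def conjOnRange {V W : Type*} (τ : V → W) (τ' : W → V) (h : V → V) (x : W) : W :=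
  if x ∈ range τ then τ (h (τ' x)) else x

/-- A proper surjection of `V` onto itself which is injective off the fibres over `a` and `b`. -/
structure TwoFiberCollapse {V : Type*} [TopologicalSpace V] (f : V → V) (a b : V) : Prop where
  proper : IsProperMap f
  surjective : Function.Surjective f
  ne : a ≠ b
  inj : ∀ x y, f x = f y → f x ≠ a → f x ≠ b → x = y

namespace TwoFiberCollapse

/-- Since `f` is closed, the image of the complement of `W` is a closed set missing `a`. -/
theorem exists_fiber_subset {V : Type*} [PseudoMetricSpace V] {f : V → V} {a b : V}
    (hf : TwoFiberCollapse f a b) {W : Set V} (hW : IsOpen W)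
    (h : f ⁻¹' {a} ⊆ W) : ∃ r > 0, f ⁻¹' ball a r ⊆ W := by
  have h1 : (f '' Wᶜ)ᶜ ∈ 𝓝 a := by
    refine (hf.proper.isClosedMap _ hW.isClosed_compl).isOpen_compl.mem_nhds ?_
    rintro ⟨x, hx, hxy⟩
    exact hx (h hxy)
  obtain ⟨r, hr, hrW⟩ := Metric.mem_nhds_iff.1 h1
  refine ⟨r, hr, fun x hx => ?_⟩
  by_contra hcon
  exact hrW hx ⟨x, hcon, rfl⟩

variable {V : Type*} [NormedAddCommGroup V] [NormedSpace ℝ V] {f : V → V} {a b : V}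

/-- The fibre over `a` has arbitrarily small neighbourhoods homeomorphic to the whole space. -/
theorem exists_cell (hf : TwoFiberCollapse f a b) {W : Set V} (hW : IsOpen W)
    (hAW : f ⁻¹' {a} ⊆ W) :
    ∃ τ τ' : V → V, Continuous τ ∧ IsOpen (range τ) ∧ ContinuousOn τ' (range τ) ∧
      (∀ x, τ' (τ x) = x) ∧ range τ ⊆ W ∧ f ⁻¹' {a} ⊆ range τ := by
  have hfc := hf.proper.continuous
  obtain ⟨s, hs⟩ := hf.surjective.hasRightInverse
  have hsf : ∀ x, f x ≠ a → f x ≠ b → s (f x) = x := fun x h1 h2 =>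
    hf.inj _ _ (hs _) (by rwa [hs]) (by rwa [hs])
  have hsc : ∀ y, y ≠ a → y ≠ b → ContinuousAt s y := fun y h1 h2 =>
    hf.proper.isClosedMap.continuousAt_section hs fun x hx =>
      hf.inj _ _ (by rw [hx, hs]) (by rwa [hx]) (by rwa [hx])
  have hr : 0 < dist a b := dist_pos.2 hf.ne
  set r := dist a b
  have ha : a ∉ ball b r := by simp [r]
  obtain ⟨k, k', hk, hk', hk'k, hkk', hkb, hksm, hksm'⟩ := exists_squeeze b hr
  have hb2 : ball b (r / 2) ∈ 𝓝 b := ball_mem_nhds _ (by positivity)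
  have hkbb : k b = b := hksm b (mem_of_mem_nhds hb2)
  have hkb' : k' b = b := hksm' b (mem_of_mem_nhds hb2)
  have hkinj : Function.Injective k := Function.LeftInverse.injective hk'k
  have hkna : ∀ x, k x ≠ a := fun x h => ha (h ▸ hkb x)
  -- Formally `σ = f⁻¹ ∘ k ∘ f`. As `k` fixes a neighbourhood of `b`, the map `σ` can be the
  -- identity on the bad fibre over `b`; as `k` pushes everything into a ball missing `a`, the
  -- inverse of `f` is never needed at `a`. Thus `σ` maps the whole space into `O` and is injective
  -- except over one point; `t` is its inverse there.
  set σ := conjMap f s k b with hσ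
  set t := conjMap f s k' b with ht
  set O := f ⁻¹' ball b r with hO
  have hOo : IsOpen O := isOpen_ball.preimage hfc
  have hsnear : ∀ᶠ y in 𝓝 b, y ≠ b → ∀ z, f z = y → s y = z := by
    filter_upwards [ball_mem_nhds b hr] with y hy hyb z hz
    subst hz
    exact hsf z (fun h => ha (h ▸ hy)) hyb
  have hfσ : ∀ x, f (σ x) = k (f x) := by
    intro x
    by_cases h : f x = b
    · rw [hσ, conjMap_of_eq h, h, hkbb]
    · rw [hσ, conjMap_of_ne h, hs]
  have hkfb : ∀ {y}, y ≠ b → k y ≠ b := fun h h' => h (hkinj (h'.trans hkbb.symm))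
  have hσc : Continuous σ := by
    rw [continuous_iff_continuousAt]
    intro x
    by_cases h : f x = b
    · exact continuousAt_conjMap_of_eq hfc h hsnear (eventually_of_mem hb2 hksm)
    · exact continuousAt_conjMap_of_ne hfc h hk.continuousAt (hsc _ (hkna _) (hkfb h))
  have hσO : ∀ x, σ x ∈ O := fun x => by
    rw [hO, mem_preimage, hfσ]
    exact hkb _
  -- The single point to which `σ` collapses the fibre of `f` over `a`.
  set c := s (k a) with hc
  have hfc' : f c = k a := hs _
  have hcb : f c ≠ b := by rw [hfc']; exact hkfb hf.ne
  have hσa : ∀ x, σ x = c ↔ f x = a := by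
    intro x
    constructor
    · intro h
      apply hkinj
      rw [← hfσ, h, hfc']
    · intro h
      rw [hσ, conjMap_of_ne (by rw [h]; exact hf.ne), h]
  have hk'b : ∀ y ∈ ball b r, y ≠ b → k' y ≠ b := by
    intro y hy h h'
    rw [← hkk' y hy, h', hkbb] at h
    exact h rfl
  have hOa : ∀ y ∈ O, f y ≠ a := fun y hy h => ha (h ▸ hy)
  have hk'a : ∀ y ∈ O, y ≠ c → f y ≠ b → k' (f y) ≠ a := by
    intro y hy hyc hb h
    apply hyc
    refine hf.inj _ _ ?_ (hOa y hy) hb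
    rw [hfc', ← h, hkk' _ hy]
  have htc : ∀ y ∈ O, y ≠ c → ContinuousAt t y := by
    intro y hy hyc
    by_cases h : f y = b
    · exact continuousAt_conjMap_of_eq hfc h hsnear (eventually_of_mem hb2 hksm')
    · exact continuousAt_conjMap_of_ne hfc h (hk'.continuousAt (isOpen_ball.mem_nhds hy))
        (hsc _ (hk'a y hy hyc h) (hk'b _ hy h))
  have htσ : ∀ x, f x ≠ a → t (σ x) = x := by
    intro x hx
    by_cases h : f x = b
    · rw [hσ, conjMap_of_eq h, ht, conjMap_of_eq h]
    · rw [ht, conjMap_of_ne (by rw [hfσ]; exact hkfb h), hfσ, hk'k, hsf x hx h]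
  have hσt : ∀ y ∈ O, y ≠ c → σ (t y) = y := by
    intro y hy hyc
    by_cases h : f y = b
    · rw [ht, conjMap_of_eq h, hσ, conjMap_of_eq h]
    · rw [ht, conjMap_of_ne h, hσ, conjMap_of_ne (by rw [hs]; exact hk'b _ hy h), hs,
        hkk' _ hy, hsf y (hOa y hy) h]
  obtain ⟨r₀, hr₀, hr₀W⟩ := hf.exists_fiber_subset hW hAW
  have hcO : c ∈ O := by
    rw [hO, mem_preimage, hfc']
    exact hkb _
  -- On `σ x` the function `k' ∘ f` returns `f x`. So if `σ x` is close enough to `c`, then `f x` is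
  -- within `r₀` of `a`, and `x` lies in `W`.
  have hO₂ : O ∩ (fun y => k' (f y)) ⁻¹' ball a r₀ ∈ 𝓝 c := by
    have h1 : ContinuousOn (fun y => k' (f y)) O := hk'.comp hfc.continuousOn fun y hy => hy
    refine (h1.isOpen_inter_preimage hOo isOpen_ball).mem_nhds ⟨hcO, ?_⟩
    rw [mem_preimage, hfc', hk'k]
    exact mem_ball_self hr₀
  obtain ⟨ρ, hρ, hρO⟩ := Metric.mem_nhds_iff.1 hO₂
  obtain ⟨l, l', hl, hl', hl'l, hll', hlc, hlsm, hlsm'⟩ := exists_squeeze c hρ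
  have hc2 : ball c (ρ / 2) ∈ 𝓝 c := ball_mem_nhds _ (by positivity)
  have hlcc : l c = c := hlsm c (mem_of_mem_nhds hc2)
  have hlcc' : l' c = c := hlsm' c (mem_of_mem_nhds hc2)
  have hlinj : Function.Injective l := Function.LeftInverse.injective hl'l
  have hlne : ∀ {y}, y ≠ c → l y ≠ c := fun h h' => h (hlinj (h'.trans hlcc.symm))
  have hl'ne : ∀ y ∈ ball c ρ, y ≠ c → l' y ≠ c := by
    intro y hy h h'
    rw [← hll' y hy, h', hlcc] at h
    exact h rfl
  have hlO : ∀ y, l y ∈ O := fun y => (hρO (hlc y)).1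
  -- The same trick once more: `τ = σ⁻¹ ∘ l ∘ σ`, with `l` squeezing space towards `c` and fixing
  -- points near `c`. Now only one fibre of `σ` is bad, and `τ` is the identity on it, so `τ` is an
  -- embedding of the whole space onto a small neighbourhood of that fibre.
  set τ := conjMap σ t l c with hτ
  set τ' := conjMap σ t l' c with hτ'
  have htnear : ∀ᶠ y in 𝓝 c, y ≠ c → ∀ z, σ z = y → t y = z := by
    refine Eventually.of_forall fun y hyc z hz => ?_
    subst hz
    exact htσ z fun h => hyc ((hσa z).2 h)
  have hστ : ∀ x, σ (τ x) = l (σ x) := by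
    intro x
    by_cases h : σ x = c
    · rw [hτ, conjMap_of_eq h, h, hlcc]
    · rw [hτ, conjMap_of_ne h, hσt _ (hlO _) (hlne h)]
  have hrange : range τ = σ ⁻¹' (ball c ρ ∩ l' ⁻¹' O) := by
    ext x
    constructor
    · rintro ⟨z, rfl⟩
      rw [mem_preimage, hστ]
      refine ⟨hlc _, ?_⟩
      rw [mem_preimage, hl'l]
      exact hσO z
    · rintro ⟨hx1, hx2⟩
      refine ⟨τ' x, ?_⟩
      by_cases h : σ x = c
      · rw [hτ', conjMap_of_eq h, hτ, conjMap_of_eq h]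
      · have hne := hl'ne _ hx1 h
        have h2 : σ (τ' x) = l' (σ x) := by rw [hτ', conjMap_of_ne h, hσt _ hx2 hne]
        rw [hτ, conjMap_of_ne (by rwa [h2]), h2, hll' _ hx1, htσ]
        exact fun hh => h ((hσa x).2 hh)
  refine ⟨τ, τ', ?_, ?_, ?_, ?_, ?_, ?_⟩
  · rw [continuous_iff_continuousAt]
    intro x
    by_cases h : σ x = c
    · exact continuousAt_conjMap_of_eq hσc h htnear (eventually_of_mem hc2 hlsm)
    · exact continuousAt_conjMap_of_ne hσc h hl.continuousAt (htc _ (hlO _) (hlne h))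
  · rw [hrange]
    exact (hl'.isOpen_inter_preimage isOpen_ball hOo).preimage hσc
  · intro x hx
    rw [hrange] at hx
    refine ContinuousAt.continuousWithinAt ?_
    by_cases h : σ x = c
    · exact continuousAt_conjMap_of_eq hσc h htnear (eventually_of_mem hc2 hlsm')
    · exact continuousAt_conjMap_of_ne hσc h (hl'.continuousAt (isOpen_ball.mem_nhds hx.1))
        (htc _ hx.2 (hl'ne _ hx.1 h))
  · intro x
    by_cases h : σ x = c
    · rw [hτ, conjMap_of_eq h, hτ', conjMap_of_eq h]
    · rw [hτ', conjMap_of_ne (by rw [hστ]; exact hlne h), hστ, hl'l, htσ]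
      exact fun hh => h ((hσa x).2 hh)
  · intro x hx
    rw [hrange] at hx
    apply hr₀W
    have := (hρO hx.1).2
    rwa [mem_preimage, hfσ, hk'k] at this
  · intro x hx
    rw [hrange]
    have h := (hσa x).2 hx
    rw [mem_preimage, h]
    refine ⟨mem_ball_self hρ, ?_⟩
    rw [mem_preimage, hlcc']
    exact hcO


variable [ProperSpace V]

/-- A homeomorphism can be changed near the fibre over `a` so as to make the image of a smaller
neighbourhood small. -/
theorem exists_shrink_step (hf : TwoFiberCollapse f a b) (g : V ≃ₜ V) {W : Set V}
    (hW : IsOpen W) (hAW : f ⁻¹' {a} ⊆ W) {ε : ℝ} (hε : 0 < ε) :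
    ∃ (g' : V ≃ₜ V) (W' : Set V), IsOpen W' ∧ f ⁻¹' {a} ⊆ W' ∧ W' ⊆ W ∧
      (∀ x, x ∉ W → g' x = g x) ∧ (∀ x ∈ W, g' x ∈ g '' W) ∧
      ∀ x ∈ W', ∀ y ∈ W', dist (g' x) (g' y) ≤ ε := by
  obtain ⟨τ, τ', hτ, hτo, hτ', hττ, hτW, hAτ⟩ := hf.exists_cell hW hAW
  have hinj : Function.Injective τ := Function.LeftInverse.injective hττ
  have hτemb : IsOpenEmbedding τ := by
    refine ⟨⟨⟨?_⟩, hinj⟩, hτo⟩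
    refine le_antisymm hτ.le_induced fun U hU => ?_
    refine ⟨range τ ∩ τ' ⁻¹' U, hτ'.isOpen_inter_preimage hτo hU, ?_⟩
    ext x
    simp [hττ]
  have hAc : IsCompact (f ⁻¹' {a}) := hf.proper.isCompact_preimage isCompact_singleton
  have hAc' : IsCompact (τ' '' (f ⁻¹' {a})) := hAc.image_of_continuousOn (hτ'.mono hAτ)
  obtain ⟨R₀, hR₀⟩ := hAc'.isBounded.subset_ball (0 : V)
  obtain ⟨R, hR, hRR⟩ : ∃ R : ℝ, 0 < R ∧ R₀ ≤ R := ⟨max R₀ 1, by positivity, le_max_left _ _⟩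
  -- In the coordinates `τ` the fibre lies in a ball of radius `R`; shrinking that ball into the
  -- ball of radius `δ`, before applying `g`, makes its image have diameter at most `ε`.
  have hcont : ContinuousAt (fun x => g (τ x)) 0 := (g.continuous.comp hτ).continuousAt
  obtain ⟨δ, hδ, hδε⟩ := Metric.continuousAt_iff.1 hcont (ε / 2) (by positivity)
  obtain ⟨h, hhc, hhb, hhid, hhs⟩ := exists_radial_shrink (V := V) hR hδ
  -- The shrinking map is supported in a compact subset of the cell, so it extends by the identity.
  set H := conjOnRange τ τ' h with hHdef
  have hHτ : ∀ x, H (τ x) = τ (h x) := fun x => by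
    rw [hHdef, conjOnRange, if_pos (mem_range_self x), hττ]
  have hHid : ∀ x, x ∉ range τ → H x = x := fun x hx => if_neg hx
  set K := τ '' closedBall 0 (R + 1) with hK
  have hKc : IsCompact K := (isCompact_closedBall 0 (R + 1)).image hτ
  have hHK : ∀ x, x ∉ K → H x = x := by
    intro x hx
    by_cases hxr : x ∈ range τ
    · obtain ⟨z, rfl⟩ := hxr
      rw [hHτ, hhid z fun hz => hx ⟨z, hz, rfl⟩]
    · exact hHid x hxr
  have hHc : Continuous H := by
    rw [continuous_iff_continuousAt]
    intro x
    by_cases hx : x ∈ range τ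
    · obtain ⟨z, rfl⟩ := hx
      rw [← hτemb.continuousAt_iff]
      refine ((hτ.comp hhc).continuousAt).congr (Eventually.of_forall fun y => ?_)
      exact (hHτ y).symm
    · refine continuousAt_id.congr ?_
      filter_upwards [hKc.isClosed.isOpen_compl.mem_nhds
        (fun h => hx (image_subset_range _ _ h))] with y hy
      exact (hHK y hy).symm
  have hHb : Function.Bijective H := by
    constructor
    · intro x y hxy
      by_cases hx : x ∈ range τ <;> by_cases hy : y ∈ range τ
      · obtain ⟨x, rfl⟩ := hx
        obtain ⟨y, rfl⟩ := hy
        rw [hHτ, hHτ] at hxy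
        rw [hhb.1 (hinj hxy)]
      · obtain ⟨x, rfl⟩ := hx
        rw [hHτ, hHid y hy] at hxy
        exact (hy ⟨_, hxy⟩).elim
      · obtain ⟨y, rfl⟩ := hy
        rw [hHτ, hHid x hx] at hxy
        exact (hx ⟨_, hxy.symm⟩).elim
      · rwa [hHid x hx, hHid y hy] at hxy
    · intro y
      by_cases hy : y ∈ range τ
      · obtain ⟨y, rfl⟩ := hy
        obtain ⟨x, rfl⟩ := hhb.2 y
        exact ⟨τ x, hHτ x⟩
      · exact ⟨y, hHid y hy⟩
  refine ⟨(homeomorphOfEqOffCompact H hHc hHb K hKc hHK).trans g, τ '' ball 0 R,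
    hτemb.isOpenMap _ isOpen_ball, ?_, (image_subset_range _ _).trans hτW, ?_, ?_, ?_⟩
  · intro x hx
    obtain ⟨z, rfl⟩ := hAτ hx
    exact ⟨z, ball_subset_ball hRR (hR₀ ⟨τ z, hx, hττ z⟩), rfl⟩
  · intro x hx
    change g (H x) = g x
    rw [hHid x fun h => hx (hτW h)]
  · intro x hx
    refine ⟨H x, ?_, rfl⟩
    by_cases hxr : x ∈ range τ
    · obtain ⟨z, rfl⟩ := hxr
      rw [hHτ]
      exact hτW (mem_range_self _)
    · rwa [hHid x hxr]
  · rintro _ ⟨x, hx, rfl⟩ _ ⟨y, hy, rfl⟩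
    change dist (g (H (τ x))) (g (H (τ y))) ≤ ε
    rw [hHτ, hHτ]
    have h1 := hδε (hhs x hx)
    have h2 := hδε (hhs y hy)
    have := dist_triangle_right (g (τ (h x))) (g (τ (h y))) (g (τ 0))
    linarith

/-- The fibre over `a` can be shrunk to a point by a map supported in a given neighbourhood. -/
theorem exists_collapse (hf : TwoFiberCollapse f a b) {W : Set V} (hW : IsOpen W)
    (hAW : f ⁻¹' {a} ⊆ W) :
    ∃ H : V → V, Continuous H ∧ Function.Surjective H ∧ (∀ x, x ∉ W → H x = x) ∧
      (∀ x y, f x = a → f y = a → H x = H y) ∧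
      ∀ x y, H x = H y → x = y ∨ (f x = a ∧ f y = a) := by
  -- A stage is a homeomorphism together with a neighbourhood of the fibre whose image has diameter
  -- at most `(1 / 2) ^ n`. The next stage changes the homeomorphism only inside that neighbourhood.
  let St : ℕ → Type _ := fun n => {p : (V ≃ₜ V) × Set V // IsOpen p.2 ∧ f ⁻¹' {a} ⊆ p.2 ∧
    p.2 ⊆ W ∧ (∀ x, x ∉ W → p.1 x = x) ∧ ∀ x ∈ p.2, ∀ y ∈ p.2, dist (p.1 x) (p.1 y) ≤ (1 / 2) ^ n}
  have hstart : Nonempty (St 0) := by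
    obtain ⟨g, W', h1, h2, h3, h4, -, h6⟩ :=
      hf.exists_shrink_step (Homeomorph.refl V) hW hAW (ε := 1) one_pos
    exact ⟨⟨(g, W'), h1, h2, h3, h4, by simpa using h6⟩⟩
  have hstep : ∀ n (p : St n), ∃ q : St (n + 1), q.1.2 ⊆ p.1.2 ∧
      q.1.2 ⊆ f ⁻¹' ball a (1 / (n + 1)) ∧ (∀ x, x ∉ p.1.2 → q.1.1 x = p.1.1 x) ∧
      ∀ x ∈ p.1.2, q.1.1 x ∈ p.1.1 '' p.1.2 := by
    rintro n ⟨⟨g, W₀⟩, h1, h2, h3, h4, h5⟩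
    have hpos : (0 : ℝ) < 1 / (n + 1) := by positivity
    obtain ⟨g', W', k1, k2, k3, k4, k5, k6⟩ := hf.exists_shrink_step g
      (h1.inter (isOpen_ball.preimage hf.proper.continuous))
      (subset_inter h2 (preimage_mono (singleton_subset_iff.2 (mem_ball_self hpos))))
      (ε := (1 / 2) ^ (n + 1)) (by positivity)
    have k4' : ∀ x, x ∉ W₀ → g' x = g x := fun x hx => k4 x fun h => hx h.1
    refine ⟨⟨(g', W'), k1, k2, (k3.trans inter_subset_left).trans h3, ?_, k6⟩,
      k3.trans inter_subset_left, k3.trans inter_subset_right, k4', ?_⟩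
    · intro x hx
      exact (k4' x fun h => hx (h3 h)).trans (h4 x hx)
    · intro x hx
      by_cases hx' : x ∈ W₀ ∩ f ⁻¹' ball a (1 / (n + 1))
      · exact image_mono inter_subset_left (k5 x hx')
      · exact ⟨x, hx, (k4 x hx').symm⟩
  choose step hst1 hst2 hst3 hst4 using hstep
  let S : ∀ n, St n := fun n => Nat.rec hstart.some (fun n p => step n p) n
  have hS : ∀ n, S (n + 1) = step n (S n) := fun n => rfl
  let g : ℕ → V ≃ₜ V := fun n => (S n).1.1
  let U : ℕ → Set V := fun n => (S n).1.2
  have hAU : ∀ n, f ⁻¹' {a} ⊆ U n := fun n => (S n).2.2.1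
  have hUW : ∀ n, U n ⊆ W := fun n => (S n).2.2.2.1
  have hgW : ∀ n x, x ∉ W → g n x = x := fun n => (S n).2.2.2.2.1
  have hdiam : ∀ n, ∀ x ∈ U n, ∀ y ∈ U n, dist (g n x) (g n y) ≤ (1 / 2) ^ n :=
    fun n => (S n).2.2.2.2.2
  have hU : ∀ n, U (n + 1) ⊆ U n := fun n => hst1 n (S n)
  have hUa : ∀ n, U (n + 1) ⊆ f ⁻¹' ball a (1 / ((n : ℝ) + 1)) := fun n => hst2 n (S n)
  have hgU : ∀ n x, x ∉ U n → g (n + 1) x = g n x := fun n => hst3 n (S n)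
  have hgU' : ∀ n, ∀ x ∈ U n, g (n + 1) x ∈ g n '' U n := fun n => hst4 n (S n)
  have hUanti : Antitone U := antitone_nat_of_succ_le hU
  -- Both `g n` and `g (n + 1)` send a point of `U n` into the small set `g n '' U n`, and off `U n`
  -- they agree; hence the homeomorphisms converge uniformly.
  have hdist : ∀ x n, dist (g n x) (g (n + 1) x) ≤ 1 * (1 / 2) ^ n := by
    intro x n
    rw [one_mul]
    by_cases hx : x ∈ U n
    · obtain ⟨y, hy, hyx⟩ := hgU' n x hx
      rw [← hyx]
      exact hdiam n x hx y hy
    · rw [hgU n x hx, dist_self]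
      positivity
  have hcau : ∀ x, CauchySeq fun n => g n x := fun x =>
    cauchySeq_of_le_geometric (1 / 2) 1 (by norm_num) (hdist x)
  choose H hH using fun x => cauchySeq_tendsto_of_complete (hcau x)
  have hHd : ∀ x n, dist (g n x) (H x) ≤ 1 * (1 / 2) ^ n / (1 - 1 / 2) := fun x n =>
    dist_le_of_le_geometric_of_tendsto (1 / 2) 1 (by norm_num) (hdist x) (hH x) n
  have hpow : Tendsto (fun n : ℕ => 1 * (1 / 2 : ℝ) ^ n / (1 - 1 / 2)) atTop (𝓝 0) := by
    have := (tendsto_pow_atTop_nhds_zero_of_lt_one (r := (1 / 2 : ℝ)) (by norm_num)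
      (by norm_num)).const_mul 1
    simpa using this.div_const (1 - 1 / 2 : ℝ)
  have hHc : Continuous H := by
    have hunif : TendstoUniformly (fun n x => g n x) H atTop := by
      rw [Metric.tendstoUniformly_iff]
      intro ε hε
      filter_upwards [hpow.eventually (gt_mem_nhds hε)] with n hn x
      rw [dist_comm]
      exact (hHd x n).trans_lt hn
    exact hunif.continuous (Frequently.of_forall fun n => (g n).continuous)
  have hstable : ∀ n x, x ∉ U n → ∀ m, n ≤ m → g m x = g n x := by
    intro n x hx m hm
    induction m, hm using Nat.le_induction with
    | base => rfl
    | succ m hm ih => rw [hgU m x fun h => hx (hUanti hm h), ih]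
  have hHn : ∀ n x, x ∉ U n → H x = g n x := by
    intro n x hx
    refine tendsto_nhds_unique (hH x) (tendsto_const_nhds.congr' ?_)
    filter_upwards [eventually_ge_atTop n] with m hm
    exact (hstable n x hx m hm).symm
  have hsmall : ∀ n x y, f x = a → y ∈ U n → dist (H x) (g n y) ≤ 3 * (1 / 2) ^ n := by
    intro n x y hx hy
    have h1 := hHd x n
    have h2 := hdiam n x (hAU n hx) y hy
    have h3 := dist_triangle_left (H x) (g n y) (g n x)
    have h4 : 1 * (1 / 2 : ℝ) ^ n / (1 - 1 / 2) = 2 * (1 / 2) ^ n := by ring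
    rw [h4] at h1
    linarith
  have hpow3 : Tendsto (fun n : ℕ => 3 * (1 / 2 : ℝ) ^ n) atTop (𝓝 0) := by
    simpa using (tendsto_pow_atTop_nhds_zero_of_lt_one (r := (1 / 2 : ℝ)) (by norm_num)
      (by norm_num)).const_mul 3
  have hconst : ∀ x y, f x = a → f y = a → H x = H y := by
    intro x y hx hy
    refine tendsto_nhds_unique (hH x) ?_
    rw [tendsto_iff_dist_tendsto_zero]
    refine squeeze_zero (fun _ => dist_nonneg) (fun n => ?_) hpow3
    rw [dist_comm]
    exact hsmall n y x hy (hAU n hx)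
  have hout : ∀ x, f x ≠ a → ∃ n : ℕ, ∀ y, f y ∈ closedBall a (1 / ((n : ℝ) + 1)) → y ≠ x := by
    intro x hx
    obtain ⟨n, hn⟩ := exists_nat_one_div_lt (dist_pos.2 hx)
    exact ⟨n, fun y hy hyx => by rw [hyx, mem_closedBall] at hy; linarith⟩
  have hoff : ∀ x, f x ≠ a → ∃ n, x ∉ closure (U n) := by
    intro x hx
    obtain ⟨n, hn⟩ := hout x hx
    refine ⟨n + 1, fun h => ?_⟩
    have h1 : closure (U (n + 1)) ⊆ f ⁻¹' closedBall a (1 / ((n : ℝ) + 1)) :=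
      closure_minimal ((hUa n).trans (preimage_mono ball_subset_closedBall))
        (isClosed_closedBall.preimage hf.proper.continuous)
    exact hn x (h1 h) rfl
  have himg : ∀ n m, n ≤ m → ∀ x ∈ U m, g m x ∈ g n '' U n := by
    intro n m hm
    induction m, hm using Nat.le_induction with
    | base => exact fun x hx => ⟨x, hx, rfl⟩
    | succ m hm ih =>
      intro x hx
      obtain ⟨y, hy, hyx⟩ := hgU' m x (hU m hx)
      rw [← hyx]
      exact ih y hy
  -- Separates the image of the fibre from that of any other point `y`: for some `n` the point `y`
  -- is outside `closure (U n)`, and there `H y = g n y` with `g n` injective.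
  have hAcl : ∀ n x, f x = a → H x ∈ g n '' closure (U n) := by
    intro n x hx
    rw [(g n).image_closure]
    refine mem_closure_of_tendsto (hH x) ?_
    filter_upwards [eventually_ge_atTop n] with m hm
    exact himg n m hm x (hAU m hx)
  have hne : ∀ x y, f x = a → f y ≠ a → H x ≠ H y := by
    intro x y hx hy h
    obtain ⟨n, hn⟩ := hoff y hy
    obtain ⟨z, hz, hzx⟩ := hAcl n x hx
    rw [h, hHn n y fun h => hn (subset_closure h)] at hzx
    exact hn ((g n).injective hzx ▸ hz)
  refine ⟨H, hHc, ?_, ?_, hconst, ?_⟩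
  · intro y
    obtain ⟨α, hα⟩ := hf.surjective a
    by_cases hy : y = H α
    · exact ⟨α, hy.symm⟩
    -- A point at positive distance from the image of the fibre is outside `g n '' U n` for large
    -- `n`, and its preimage under `g n` is no longer moved by later stages.
    obtain ⟨n, hn⟩ := (hpow3.eventually (gt_mem_nhds (dist_pos.2 (Ne.symm hy)))).exists
    refine ⟨(g n).symm y, ?_⟩
    have : (g n).symm y ∉ U n := by
      intro h
      have := hsmall n α _ hα h
      rw [Homeomorph.apply_symm_apply] at this
      linarith
    rw [hHn n _ this, Homeomorph.apply_symm_apply]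
  · intro x hx
    rw [hHn 0 x fun h => hx (hUW 0 h), hgW 0 x hx]
  · intro x y hxy
    by_cases hx : f x = a <;> by_cases hy : f y = a
    · exact Or.inr ⟨hx, hy⟩
    · exact (hne x y hx hy hxy).elim
    · exact (hne y x hy hx hxy.symm).elim
    · left
      obtain ⟨n, hn⟩ := hoff x hx
      obtain ⟨m, hm⟩ := hoff y hy
      have h1 : x ∉ U (max n m) := fun h => hn (subset_closure (hUanti (le_max_left _ _) h))
      have h2 : y ∉ U (max n m) := fun h => hm (subset_closure (hUanti (le_max_right _ _) h))
      rw [hHn _ x h1, hHn _ y h2] at hxy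
      exact (g _).injective hxy

/-- The preimage of a compact neighbourhood of `a` missing `b` is homeomorphic to it, by a
homeomorphism which is inverse to `f` off the interior. -/
theorem exists_parametrization (hf : TwoFiberCollapse f a b) {T : Set V} (hTb : b ∉ T)
    (hTa : a ∈ interior T) :
    ∃ Ψ : V → V, ContinuousOn Ψ T ∧ InjOn Ψ T ∧ Ψ '' T = f ⁻¹' T ∧
      ∀ x, f x ∈ T → f x ∉ interior T → Ψ (f x) = x := by
  have hfc := hf.proper.continuous
  obtain ⟨s, hs⟩ := hf.surjective.hasRightInverse
  obtain ⟨H, hHc, hHs, hHid, hHA, hHinj⟩ := hf.exists_collapse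
    (isOpen_interior.preimage hfc) (preimage_mono (singleton_subset_iff.2 hTa))
  have hHs' : ∀ x, f x ≠ b → H (s (f x)) = H x := by
    intro x hx
    by_cases h : f x = a
    · exact hHA _ _ (by rw [hs, h]) h
    · rw [hf.inj _ _ (hs (f x)) (by rwa [hs]) (by rwa [hs])]
  -- `H` fixes everything outside the preimage of `interior T`. A point of `f ⁻¹' T` sent outside
  -- would have the same image as the fixed point `H x`, against injectivity off the fibre.
  have hHT : ∀ x, f x ∈ T ↔ f (H x) ∈ T := by
    have h1 : ∀ x, f (H x) ∈ T → f x ∈ T := by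
      intro x hx
      by_contra hcon
      rw [hHid x fun h => hcon (interior_subset h)] at hx
      exact hcon hx
    refine fun x => ⟨fun hx => ?_, h1 x⟩
    by_contra hcon
    have h2 : H (H x) = H x := hHid _ fun h => hcon (interior_subset h)
    rcases hHinj _ _ h2 with h3 | h3
    · rw [h3] at hcon
      exact hcon hx
    · rw [h3.1] at hcon
      exact hcon (interior_subset hTa)
  -- `H ∘ f⁻¹` is single-valued at `a`, since `H` is constant on the fibre there. It is continuous
  -- at `a` because points over a small ball around `a` lie near that fibre.
  refine ⟨fun y => H (s y), ?_, ?_, ?_, ?_⟩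
  · intro y hy
    refine ContinuousAt.continuousWithinAt ?_
    by_cases hya : y = a
    · subst hya
      intro O hO
      obtain ⟨O', hO'O, hO', hmem⟩ := _root_.mem_nhds_iff.1 hO
      obtain ⟨r, hr, hrO⟩ := hf.exists_fiber_subset (hO'.preimage hHc) (by
        intro x hx
        rw [mem_preimage, hHA x (s y) hx (hs y)]
        exact hmem)
      change ∀ᶠ z in 𝓝 y, H (s z) ∈ O
      filter_upwards [ball_mem_nhds y hr] with z hz
      exact hO'O (hrO (show f (s z) ∈ ball y r by rwa [hs]))
    · have hyb : y ≠ b := fun h => hTb (h ▸ hy)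
      refine hHc.continuousAt.comp (hf.proper.isClosedMap.continuousAt_section hs fun x hx => ?_)
      exact hf.inj _ _ (by rw [hx, hs]) (by rwa [hx]) (by rwa [hx])
  · intro y hy z hz hyz
    rcases hHinj _ _ hyz with h | h
    · rw [← hs y, ← hs z, h]
    · rw [← hs y, ← hs z, h.1, h.2]
  · ext x
    constructor
    · rintro ⟨y, hy, rfl⟩
      rw [mem_preimage, ← hHT, hs]
      exact hy
    · intro hx
      obtain ⟨z, rfl⟩ := hHs x
      have hz : f z ∈ T := (hHT z).2 hx
      exact ⟨f z, hz, hHs' z fun h => hTb (h ▸ hz)⟩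
  · intro x hx hx'
    change H (s (f x)) = x
    rw [hHs' x fun h => hTb (h ▸ hx), hHid x hx']

end TwoFiberCollapse

/-- Brown's collapsing theorem for one-point compactifications of a normed space: if `f : X → Y`
is injective off two fibres, then the preimage of a closed neighbourhood of one of the two special
values is homeomorphic to that neighbourhood. -/
theorem exists_parametrization_of_collapse {V X Y : Type*} [NormedAddCommGroup V]
    [NormedSpace ℝ V] [ProperSpace V] [TopologicalSpace X] [CompactSpace X]
    [TopologicalSpace Y] [CompactSpace Y] [T2Space Y] {f : X → Y} {a b : Y} {e : X}
    (φ : OpenPartialHomeomorph X V) (hφs : φ.source = {e}ᶜ) (hφt : φ.target = univ)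
    (ψ : OpenPartialHomeomorph Y V) (hψs : ψ.source = {f e}ᶜ) (hψt : ψ.target = univ)
    (hf : Continuous f) (hsurj : Function.Surjective f) (hab : a ≠ b) (hea : f e ≠ a)
    (heb : f e ≠ b) (hinj : ∀ x y, f x = f y → f x ≠ a → f x ≠ b → x = y)
    {T : Set Y} (hTe : f e ∉ T) (hTb : b ∉ T) (hTa : a ∈ interior T) :
    ∃ Ψ : Y → X, ContinuousOn Ψ T ∧ InjOn Ψ T ∧ Ψ '' T = f ⁻¹' T ∧
      ∀ x, f x ∈ T → f x ∉ interior T → Ψ (f x) = x := by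
  have hfe : ∀ x, x ≠ e → f x ≠ f e := fun x hx h => hx (hinj x e h (h ▸ hea) (h ▸ heb))
  have hmx : ∀ {x}, x ≠ e → x ∈ φ.source := fun h => by rw [hφs]; exact h
  have hmy : ∀ {y}, y ≠ f e → y ∈ ψ.source := fun h => by rw [hψs]; exact h
  have htx : ∀ v, v ∈ φ.target := fun v => hφt ▸ mem_univ v
  have hty : ∀ v, v ∈ ψ.target := fun v => hψt ▸ mem_univ v
  have hxe : ∀ v, φ.symm v ≠ e := fun v => by
    have := φ.map_target (htx v)
    rwa [hφs] at this
  have hye : ∀ v, ψ.symm v ≠ f e := fun v => by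
    have := ψ.map_target (hty v)
    rwa [hψs] at this
  have hφc : Continuous φ.symm := by
    rw [← continuousOn_univ, ← hφt]; exact φ.symm.continuousOn
  have hψc : Continuous ψ.symm := by
    rw [← continuousOn_univ, ← hψt]; exact ψ.symm.continuousOn
  -- Removing the point `e`, which is the only point over `f e`, turns `f` into a map of the vector
  -- space, proper because the original spaces are compact.
  let F : V → V := fun v => ψ (f (φ.symm v))
  have hFs : ∀ v, ψ.symm (F v) = f (φ.symm v) := fun v => ψ.left_inv (hmy (hfe _ (hxe v)))
  have hFc : Continuous F := ψ.continuousOn.comp_continuous (hf.comp hφc)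
    fun v => hmy (hfe _ (hxe v))
  have hFp : IsProperMap F := by
    rw [isProperMap_iff_isCompact_preimage]
    refine ⟨hFc, fun K hK => ?_⟩
    have h1 : IsCompact (f ⁻¹' (ψ.symm '' K)) :=
      ((hK.image hψc).isClosed.preimage hf).isCompact
    have h2 : F ⁻¹' K = φ '' (f ⁻¹' (ψ.symm '' K)) := by
      ext v
      constructor
      · intro hv
        exact ⟨φ.symm v, ⟨F v, hv, hFs v⟩, φ.right_inv (htx v)⟩
      · rintro ⟨x, ⟨k, hk, hkx⟩, rfl⟩
        have hx : x ≠ e := fun h => hye k (by rw [hkx, h])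
        change ψ (f (φ.symm (φ x))) ∈ K
        rw [φ.left_inv (hmx hx), ← hkx, ψ.right_inv (hty k)]
        exact hk
    rw [h2]
    refine h1.image_of_continuousOn (φ.continuousOn.mono ?_)
    rintro x ⟨k, hk, hkx⟩
    exact hmx fun h => hye k (by rw [hkx, h])
  have hcol : TwoFiberCollapse F (ψ a) (ψ b) := by
    refine ⟨hFp, ?_, fun h => hab (ψ.injOn (hmy hea.symm) (hmy heb.symm) h), ?_⟩
    · intro w
      obtain ⟨x, hx⟩ := hsurj (ψ.symm w)
      have hxe' : x ≠ e := fun h => hye w (by rw [← hx, h])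
      refine ⟨φ x, ?_⟩
      change ψ (f (φ.symm (φ x))) = w
      rw [φ.left_inv (hmx hxe'), hx, ψ.right_inv (hty w)]
    · intro v w h h1 h2
      have h3 : f (φ.symm v) = f (φ.symm w) := by rw [← hFs, ← hFs, h]
      have h4 := hinj _ _ h3 (fun h => h1 (congrArg ψ h)) (fun h => h2 (congrArg ψ h))
      rw [← φ.right_inv (htx v), ← φ.right_inv (htx w), h4]
  let T' : Set V := ψ.symm ⁻¹' T
  have hint : ∀ y, y ≠ f e → (ψ y ∈ interior T' ↔ y ∈ interior T) := by
    intro y hy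
    rw [mem_interior_iff_mem_nhds, mem_interior_iff_mem_nhds]
    have h1 : map ψ.symm (𝓝 (ψ y)) = 𝓝 y := by
      have := ψ.symm.map_nhds_eq (x := ψ y) (ψ.map_source (hmy hy))
      rwa [ψ.left_inv (hmy hy)] at this
    rw [← h1, mem_map]
  obtain ⟨Ψ, hΨc, hΨi, hΨim, hΨid⟩ := hcol.exists_parametrization (T := T')
    (by rw [mem_preimage, ψ.left_inv (hmy heb.symm)]; exact hTb)
    ((hint a hea.symm).2 hTa)
  have hTne : ∀ y ∈ T, y ≠ f e := fun y hy h => hTe (h ▸ hy)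
  have hTT' : ∀ y ∈ T, ψ y ∈ T' := fun y hy => by
    rw [mem_preimage, ψ.left_inv (hmy (hTne y hy))]
    exact hy
  refine ⟨fun y => φ.symm (Ψ (ψ y)), ?_, ?_, ?_, ?_⟩
  · exact hφc.comp_continuousOn (hΨc.comp (ψ.continuousOn.mono fun y hy => hmy (hTne y hy)) hTT')
  · intro y hy z hz h
    have h1 := φ.symm.injOn (htx _) (htx _) h
    exact ψ.injOn (hmy (hTne y hy)) (hmy (hTne z hz)) (hΨi (hTT' y hy) (hTT' z hz) h1)
  · ext x
    constructor
    · rintro ⟨y, hy, rfl⟩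
      have h1 : Ψ (ψ y) ∈ F ⁻¹' T' := hΨim ▸ mem_image_of_mem Ψ (hTT' y hy)
      rw [mem_preimage, mem_preimage, hFs] at h1
      exact h1
    · intro hx
      have hxe' : x ≠ e := fun h => hTe (h ▸ hx)
      have h1 : φ x ∈ F ⁻¹' T' := by
        rw [mem_preimage, mem_preimage, hFs, φ.left_inv (hmx hxe')]
        exact hx
      rw [← hΨim] at h1
      obtain ⟨v, hv, hvx⟩ := h1
      refine ⟨ψ.symm v, hv, ?_⟩
      change φ.symm (Ψ (ψ (ψ.symm v))) = x
      rw [ψ.right_inv (hty v), hvx, φ.left_inv (hmx hxe')]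
  · intro x hx hx'
    have hxe' : x ≠ e := fun h => hTe (h ▸ hx)
    have hF : F (φ x) = ψ (f x) := by
      change ψ (f (φ.symm (φ x))) = _
      rw [φ.left_inv (hmx hxe')]
    have := hΨid (φ x) (by rw [hF]; exact hTT' _ hx)
      (by rw [hF, hint _ (hTne _ hx)]; exact hx')
    change φ.symm (Ψ (ψ (f x))) = x
    rw [← hF, this, φ.left_inv (hmx hxe')]

end Brown

/-! ### Bicollars of regular `C¹` plane curves -/

section Collar

open Topology Filter ComplexConjugate

/-- Chords of a periodic regular `C¹` curve make an acute angle with the tangent, if they are short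
enough. -/
theorem exists_acute_chord {γ : ℝ → ℂ} (hγ : ContDiff ℝ 1 γ)
    (hper : Function.Periodic γ (2 * Real.pi)) (hne : ∀ s, deriv γ s ≠ 0) :
    ∃ δ : ℝ, 0 < δ ∧ ∀ s, 0 < (conj (deriv γ s) * (γ (s + δ) - γ s)).re := by
  have hdc : Continuous (deriv γ) := hγ.continuous_deriv le_rfl
  have hdper : Function.Periodic (deriv γ) (2 * Real.pi) := by
    intro s
    have h1 : (fun x => γ (x + 2 * Real.pi)) = γ := funext hper
    rw [← deriv_comp_add_const, h1]
  have hpi := Real.two_pi_pos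
  -- One period plus length `1`, so that with `δ ≤ 1` the interval from `s` to `s + δ` stays inside
  -- for every `s` in the period.
  have hcomp : IsCompact (Icc (0 : ℝ) (2 * Real.pi + 1)) := isCompact_Icc
  obtain ⟨s₀, -, hs₀⟩ := hcomp.exists_isMinOn ⟨0, by constructor <;> linarith⟩
    (hdc.norm.continuousOn)
  have hm : 0 < ‖deriv γ s₀‖ := norm_pos_iff.2 (hne s₀)
  obtain ⟨η, hη, hun⟩ := Metric.uniformContinuousOn_iff.1
    (hcomp.uniformContinuousOn_of_continuous hdc.continuousOn) _ (half_pos hm)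
  refine ⟨min (η / 2) 1, by positivity, ?_⟩
  set δ := min (η / 2) 1 with hδdef
  have hδ : 0 < δ := by positivity
  have hδ1 : δ ≤ 1 := min_le_right _ _
  have hδη : δ < η := (min_le_left _ _).trans_lt (by linarith)
  have main : ∀ s ∈ Ico (0 : ℝ) (2 * Real.pi),
      0 < (conj (deriv γ s) * (γ (s + δ) - γ s)).re := by
    intro s hs
    have hsm : ‖deriv γ s₀‖ ≤ ‖deriv γ s‖ := hs₀ ⟨hs.1, by linarith [hs.2]⟩
    -- The mean value inequality for `γ u - u * γ' s`: the chord differs from `δ * γ' s` by at most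
    -- half its length, which keeps the angle acute.
    have hbound : ‖(γ (s + δ) - (s + δ) * deriv γ s) - (γ s - s * deriv γ s)‖ ≤
        ‖deriv γ s₀‖ / 2 * ‖(s + δ) - s‖ := by
      have hd : ∀ u : ℝ, HasDerivAt (fun u : ℝ => γ u - u * deriv γ s)
          (deriv γ u - deriv γ s) u := by
        intro u
        have h1 := (hγ.differentiable one_ne_zero u).hasDerivAt
        have h2 : HasDerivAt (fun u : ℝ => (u : ℂ) * deriv γ s) (1 * deriv γ s) u :=
          (Complex.ofRealCLM.hasDerivAt).mul_const _
        rw [one_mul] at h2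
        exact h1.sub h2
      have := (convex_Icc s (s + δ)).norm_image_sub_le_of_norm_hasDerivWithin_le
        (f := fun u : ℝ => γ u - u * deriv γ s) (f' := fun u => deriv γ u - deriv γ s)
        (C := ‖deriv γ s₀‖ / 2) (x := s) (y := s + δ)
        (fun u hu => (hd u).hasDerivWithinAt) (fun u hu => ?_)
        ⟨le_rfl, by linarith⟩ ⟨by linarith, le_rfl⟩
      · simpa using this
      · have := hun u ⟨by linarith [hs.1, hu.1], by linarith [hs.2, hu.2]⟩ s
          ⟨hs.1, by linarith [hs.2]⟩ (by
            rw [Real.dist_eq, abs_of_nonneg (by linarith [hu.1])]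
            linarith [hu.2])
        rw [dist_eq_norm] at this
        exact this.le
    set E := (γ (s + δ) - (s + δ) * deriv γ s) - (γ s - s * deriv γ s) with hE
    have hEn : ‖E‖ ≤ ‖deriv γ s‖ / 2 * δ := by
      refine hbound.trans ?_
      rw [add_sub_cancel_left, Real.norm_eq_abs, abs_of_pos hδ]
      gcongr
    have hsplit : conj (deriv γ s) * (γ (s + δ) - γ s) =
        (δ * ‖deriv γ s‖ ^ 2 : ℝ) + conj (deriv γ s) * E := by
      rw [hE]
      push_cast
      rw [← Complex.conj_mul' (deriv γ s)]
      ring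
    rw [hsplit, Complex.add_re, Complex.ofReal_re]
    have h1 : |(conj (deriv γ s) * E).re| ≤ ‖deriv γ s‖ * (‖deriv γ s‖ / 2 * δ) := by
      refine (Complex.abs_re_le_norm _).trans ?_
      rw [norm_mul, RCLike.norm_conj]
      gcongr
    have h2 := (abs_le.1 h1).1
    have h3 : 0 < ‖deriv γ s‖ := norm_pos_iff.2 (hne s)
    have h4 : 0 < δ * ‖deriv γ s‖ ^ 2 := by positivity
    nlinarith
  intro s
  obtain ⟨y, hy, hsy⟩ := hdper.exists_mem_Ico₀ Real.two_pi_pos s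
  obtain ⟨n, hn⟩ : ∃ n : ℤ, s = toIcoMod Real.two_pi_pos 0 s + n * (2 * Real.pi) :=
    ⟨toIcoDiv Real.two_pi_pos 0 s, by
      have := toIcoMod_add_toIcoDiv_zsmul Real.two_pi_pos 0 s
      rw [zsmul_eq_mul] at this
      exact this.symm⟩
  have hmem := toIcoMod_mem_Ico Real.two_pi_pos 0 s
  rw [zero_add] at hmem
  have h1 := main _ hmem
  have e1 : deriv γ s = deriv γ (toIcoMod Real.two_pi_pos 0 s) := by
    conv_lhs => rw [hn]
    exact hdper.int_mul n _
  have e2 : γ s = γ (toIcoMod Real.two_pi_pos 0 s) := by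
    conv_lhs => rw [hn]
    exact hper.int_mul n _
  have e3 : γ (s + δ) = γ (toIcoMod Real.two_pi_pos 0 s + δ) := by
    conv_lhs => rw [hn, add_right_comm]
    exact hper.int_mul n _
  rw [e1, e2, e3]
  exact h1

/-- A closed regular `C¹` Jordan curve in the plane, parametrized by the circle. -/
structure IsC1JordanCurve (γ : ℝ → ℂ) : Prop where
  contDiff : ContDiff ℝ 1 γ
  deriv_ne_zero : ∀ s, deriv γ s ≠ 0
  eq_iff : ∀ s t, γ s = γ t ↔ Circle.exp s = Circle.exp t

/-- A bicollar of a closed curve, parametrized by the annulus `S¹ × (-2, 2)`. -/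
structure IsBicollar {X : Type*} [TopologicalSpace X] (c : Circle → X) (F : Circle × ℝ → X) :
    Prop where
  continuousOn : ContinuousOn F (univ ×ˢ Ioo (-2) 2)
  map_nhds : ∀ q ∈ (univ : Set Circle) ×ˢ Ioo (-2 : ℝ) 2, map F (𝓝 q) = 𝓝 (F q)
  injOn : InjOn F (univ ×ˢ Ioo (-2) 2)
  zero : ∀ z, F (z, 0) = c z

/-- The normal field of a `C¹` curve is only continuous, so moving along it need not give a `C¹`
map. A rotated short chord is a `C¹` field which is still transverse to the curve, and the inverse
function theorem applies. Compactness of the curve then gives a collar of uniform width. -/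
theorem IsC1JordanCurve.exists_bicollar {γ : ℝ → ℂ} (h : IsC1JordanCurve γ) :
    ∃ (c : Circle → ℂ) (F : Circle × ℝ → ℂ), (∀ s, c (Circle.exp s) = γ s) ∧ IsBicollar c F := by
  have hγ := h.contDiff
  have hper : Function.Periodic γ (2 * Real.pi) := fun s => by
    rw [h.eq_iff, Circle.exp_add, Circle.exp_two_pi, mul_one]
  obtain ⟨δ, hδ, hac⟩ := exists_acute_chord hγ hper h.deriv_ne_zero
  let ν : ℝ → ℂ := fun s => Complex.I * (γ (s + δ) - γ s)
  have hν : ContDiff ℝ 1 ν :=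
    contDiff_const.mul ((hγ.comp (contDiff_id.add contDiff_const)).sub hγ)
  let Φ : ℝ × ℝ → ℂ := fun q => γ q.1 + q.2 • ν q.1
  have hΦ : ContDiff ℝ 1 Φ := (hγ.comp contDiff_fst).add
    (contDiff_snd.smul (hν.comp contDiff_fst))
  have hΦexp : ∀ s s' t, Circle.exp s = Circle.exp s' → Φ (s, t) = Φ (s', t) := by
    intro s s' t hs
    have h1 : γ s = γ s' := (h.eq_iff _ _).2 hs
    have h2 : γ (s + δ) = γ (s' + δ) := (h.eq_iff _ _).2 (by
      rw [Circle.exp_add, Circle.exp_add, hs])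
    simp only [Φ, ν, h1, h2]
  have hlocal : ∀ s, ∃ e : OpenPartialHomeomorph (ℝ × ℝ) ℂ, (s, (0 : ℝ)) ∈ e.source ∧
      ∀ q ∈ e.source, e q = Φ q := by
    intro s
    have hd : HasFDerivAt Φ ((ContinuousLinearMap.fst ℝ ℝ ℝ).smulRight (deriv γ s) +
        (ContinuousLinearMap.snd ℝ ℝ ℝ).smulRight (ν s)) (s, 0) := by
      have h1 : HasFDerivAt (fun q : ℝ × ℝ => γ q.1)
          ((ContinuousLinearMap.fst ℝ ℝ ℝ).smulRight (deriv γ s)) (s, 0) := by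
        have := (hγ.differentiable one_ne_zero s).hasDerivAt.hasFDerivAt.comp
          (s, (0 : ℝ)) (hasFDerivAt_fst (𝕜 := ℝ) (E := ℝ) (F := ℝ))
        convert! this using 1
      have h2 : HasFDerivAt (fun q : ℝ × ℝ => q.2 • ν q.1)
          ((ContinuousLinearMap.snd ℝ ℝ ℝ).smulRight (ν s)) (s, 0) := by
        have h3 : HasFDerivAt (fun q : ℝ × ℝ => ν q.1)
            (fderiv ℝ (fun q : ℝ × ℝ => ν q.1) (s, 0)) (s, 0) :=
          ((hν.comp contDiff_fst).differentiable one_ne_zero _).hasFDerivAt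
        have := (hasFDerivAt_snd (𝕜 := ℝ) (E := ℝ) (F := ℝ) (p := (s, (0 : ℝ)))).smul h3
        convert! this using 1
        ext <;> simp
      exact h1.add h2
    set L := (ContinuousLinearMap.fst ℝ ℝ ℝ).smulRight (deriv γ s) +
        (ContinuousLinearMap.snd ℝ ℝ ℝ).smulRight (ν s) with hL
    have hinj : Function.Injective (L : ℝ × ℝ →ₗ[ℝ] ℂ) := by
      rw [injective_iff_map_eq_zero]
      rintro ⟨σ, τ⟩ h0
      have h0' : (σ : ℂ) * deriv γ s + τ * ν s = 0 := by
        simpa [hL] using h0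
      -- After multiplication by the conjugate tangent, the first term is real and the imaginary
      -- part of the second is `τ` times the positive quantity of the acute chord.
      have h1 : conj (deriv γ s) * ((σ : ℂ) * deriv γ s + τ * ν s) = 0 := by
        rw [h0', mul_zero]
      have h2 : conj (deriv γ s) * ((σ : ℂ) * deriv γ s + τ * ν s) =
          ((σ * ‖deriv γ s‖ ^ 2 : ℝ) : ℂ) +
            (τ : ℂ) * (Complex.I * (conj (deriv γ s) * (γ (s + δ) - γ s))) := by
        push_cast
        rw [← Complex.conj_mul' (deriv γ s)]
        simp only [ν]
        ring
      rw [h2] at h1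
      have h3 := congrArg Complex.im h1
      rw [Complex.add_im, Complex.ofReal_im, Complex.im_ofReal_mul, Complex.I_mul_im,
        zero_add, Complex.zero_im] at h3
      have hτ : τ = 0 := (mul_eq_zero.1 h3).resolve_right (hac s).ne'
      subst hτ
      have hσ : (σ : ℂ) = 0 := by
        have := h0'
        simp only [Complex.ofReal_zero, zero_mul, add_zero] at this
        exact (mul_eq_zero.1 this).resolve_right (h.deriv_ne_zero s)
      rw [Complex.ofReal_eq_zero.1 hσ]
      rfl
    let Le : (ℝ × ℝ) ≃L[ℝ] ℂ := (LinearEquiv.ofInjectiveOfFinrankEq (L : ℝ × ℝ →ₗ[ℝ] ℂ) hinj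
      (by simp [Complex.finrank_real_complex])).toContinuousLinearEquiv
    have hLe : (Le : ℝ × ℝ →L[ℝ] ℂ) = L := by
      ext <;> rfl
    have hd' : HasFDerivAt Φ (Le : ℝ × ℝ →L[ℝ] ℂ) (s, 0) := by rw [hLe]; exact hd
    exact ⟨hΦ.contDiffAt.toOpenPartialHomeomorph Φ hd' one_ne_zero,
      hΦ.contDiffAt.mem_toOpenPartialHomeomorph_source hd' one_ne_zero, fun q _ => rfl⟩
  let F₀ : Circle × ℝ → ℂ := fun q => Φ (Complex.arg q.1, q.2)
  have hF₀ : ∀ s t, F₀ (Circle.exp s, t) = Φ (s, t) := fun s t =>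
    hΦexp _ _ _ (Circle.exp_arg _)
  have hexpmap : ∀ s t, map (Prod.map Circle.exp id) (𝓝 (s, t)) = 𝓝 (Circle.exp s, (t : ℝ)) := by
    intro s t
    rw [nhds_prod_eq, ← Filter.prod_map_map_eq', Filter.map_id, nhds_prod_eq,
      isLocalHomeomorph_circleExp.map_nhds_eq]
  have hmapF : ∀ s t, map F₀ (𝓝 (Circle.exp s, t)) = map Φ (𝓝 (s, t)) := by
    intro s t
    rw [← hexpmap, Filter.map_map]
    congr 1
    funext q
    exact hF₀ q.1 q.2
  have hF₀c : Continuous F₀ := by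
    rw [continuous_iff_continuousAt]
    rintro ⟨z, t⟩
    obtain ⟨s, rfl⟩ := Circle.exp_surjective z
    rw [ContinuousAt, Tendsto, hmapF, hF₀]
    exact hΦ.continuous.continuousAt
  have hnear : ∀ s, ∃ u ∈ 𝓝 (Circle.exp s, (0 : ℝ)), InjOn F₀ u ∧
      ∀ q ∈ u, map F₀ (𝓝 q) = 𝓝 (F₀ q) := by
    intro s
    obtain ⟨e, hes, he⟩ := hlocal s
    refine ⟨Prod.map Circle.exp id '' e.source, ?_, ?_, ?_⟩
    · rw [← hexpmap]
      exact image_mem_map (e.open_source.mem_nhds hes)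
    · rintro _ ⟨⟨s₁, t₁⟩, h₁, rfl⟩ _ ⟨⟨s₂, t₂⟩, h₂, rfl⟩ heq
      simp only [Prod.map_apply, id] at heq ⊢
      rw [hF₀, hF₀, ← he _ h₁, ← he _ h₂] at heq
      have := e.injOn h₁ h₂ heq
      rw [Prod.mk.injEq] at this
      rw [this.1, this.2]
    · rintro _ ⟨⟨s₁, t₁⟩, h₁, rfl⟩
      simp only [Prod.map_apply, id]
      rw [hmapF, hF₀, ← he _ h₁, ← e.map_nhds_eq h₁]
      refine Filter.map_congr ?_
      filter_upwards [e.open_source.mem_nhds h₁] with q hq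
      exact (he q hq).symm
  -- Injectivity on the compact core and local injectivity near it give injectivity on a
  -- neighbourhood of the core, which contains a strip by the tube lemma.
  set K : Set (Circle × ℝ) := univ ×ˢ {0} with hK
  have hKc : IsCompact K := isCompact_univ.prod isCompact_singleton
  have hmemK : ∀ q ∈ K, ∃ s, q = (Circle.exp s, 0) := by
    rintro ⟨z, t⟩ ⟨-, ht⟩
    obtain ⟨s, rfl⟩ := Circle.exp_surjective z
    obtain rfl : t = 0 := ht
    exact ⟨s, rfl⟩
  have hzero : ∀ s, F₀ (Circle.exp s, 0) = γ s := fun s => by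
    rw [hF₀]
    simp [Φ]
  obtain ⟨u, hu, hinj⟩ := Set.InjOn.exists_mem_nhdsSet (f := F₀) (s := K) (by
      intro q hq q' hq' hqq
      obtain ⟨s, rfl⟩ := hmemK q hq
      obtain ⟨s', rfl⟩ := hmemK q' hq'
      rw [hzero, hzero, h.eq_iff] at hqq
      rw [hqq]) hKc (fun _ _ => hF₀c.continuousAt) (by
      intro q hq
      obtain ⟨s, rfl⟩ := hmemK q hq
      obtain ⟨u, hu, hu', -⟩ := hnear s
      exact ⟨u, hu, hu'⟩)
  have hgood : {q | map F₀ (𝓝 q) = 𝓝 (F₀ q)} ∈ 𝓝ˢ K := by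
    rw [mem_nhdsSet_iff_forall]
    intro q hq
    obtain ⟨s, rfl⟩ := hmemK q hq
    obtain ⟨u, hu, -, hu'⟩ := hnear s
    exact mem_of_superset hu hu'
  obtain ⟨U, hUo, hKU, hU⟩ := mem_nhdsSet_iff_exists.1 (inter_mem hu hgood)
  obtain ⟨u', v', -, hv', hu'', hv'', huv⟩ :=
    generalized_tube_lemma (isCompact_univ (X := Circle)) (isCompact_singleton (x := (0 : ℝ)))
      hUo hKU
  obtain ⟨ε, hε, hεv⟩ := Metric.isOpen_iff.1 hv' 0 (hv'' rfl)
  have hstrip : ∀ q ∈ (univ : Set Circle) ×ˢ Ioo (-2 : ℝ) 2, (q.1, ε / 2 * q.2) ∈ U := by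
    rintro ⟨z, t⟩ ⟨-, ht⟩
    refine huv ⟨hu'' (mem_univ _), hεv ?_⟩
    simp only [mem_ball, dist_zero_right, Real.norm_eq_abs, abs_mul, abs_of_pos (half_pos hε)]
    have := abs_lt.2 ⟨ht.1, ht.2⟩
    nlinarith
  have hε2 : ε / 2 ≠ 0 := (half_pos hε).ne'
  -- Rescales the strip of half-width `ε` to the normalized half-width `2`.
  let m : Circle × ℝ ≃ₜ Circle × ℝ :=
    (Homeomorph.refl Circle).prodCongr (Homeomorph.mulLeft₀ (ε / 2) hε2)
  refine ⟨fun z => F₀ (z, 0), fun q => F₀ (m q), hzero, ⟨?_, ?_, ?_, ?_⟩⟩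
  · exact (hF₀c.comp m.continuous).continuousOn
  · intro q hq
    have h1 : map (fun q => F₀ (m q)) (𝓝 q) = map F₀ (map m (𝓝 q)) := rfl
    rw [h1, m.map_nhds_eq]
    exact (hU (hstrip q hq)).2
  · intro q hq q' hq' hqq
    exact m.injective (hinj (hU (hstrip q hq)).1 (hU (hstrip q' hq')).1 hqq)
  · intro z
    change F₀ (z, ε / 2 * 0) = F₀ (z, 0)
    rw [mul_zero]


end Collar

/-! ### The Schoenflies theorem for bicollared curves on the sphere -/

section SphereSchoenflies

open Topology Filter

namespace IsBicollar

variable {X : Type*} [TopologicalSpace X] {c : Circle → X} {F : Circle × ℝ → X}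

theorem isOpen_image (h : IsBicollar c F) {U : Set (Circle × ℝ)} (hU : IsOpen U)
    (hUs : U ⊆ univ ×ˢ Ioo (-2) 2) : IsOpen (F '' U) := by
  rw [isOpen_iff_mem_nhds]
  rintro _ ⟨q, hq, rfl⟩
  rw [← h.map_nhds q (hUs hq)]
  exact image_mem_map (hU.mem_nhds hq)

theorem continuousAt (h : IsBicollar c F) {q : Circle × ℝ} (hq : q ∈ univ ×ˢ Ioo (-2 : ℝ) 2) :
    ContinuousAt F q := (h.map_nhds q hq).le

theorem zero_mem (z : Circle) : (z, (0 : ℝ)) ∈ (univ : Set Circle) ×ˢ Ioo (-2 : ℝ) 2 :=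
  ⟨mem_univ _, by norm_num⟩

theorem mem_range_iff (h : IsBicollar c F) {q : Circle × ℝ} (hq : q ∈ univ ×ˢ Ioo (-2 : ℝ) 2) :
    F q ∈ range c ↔ q.2 = 0 := by
  constructor
  · rintro ⟨z, hz⟩
    rw [← h.zero] at hz
    exact (congrArg Prod.snd (h.injOn (zero_mem z) hq hz)).symm
  · intro h0
    refine ⟨q.1, ?_⟩
    rw [← h.zero, ← h0]

theorem continuous_curve (h : IsBicollar c F) : Continuous c := by
  rw [continuous_iff_continuousAt]
  intro z
  have h1 : ContinuousAt (fun z : Circle => F (z, 0)) z :=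
    ContinuousAt.comp (f := fun z : Circle => (z, (0 : ℝ))) (h.continuousAt (zero_mem z))
      (by fun_prop)
  exact h1.congr (Eventually.of_forall h.zero)

/-- The images of small boxes, arc times interval, are the required neighbourhoods; the half-boxes
are their two sides. -/
theorem locallyTwoSided (h : IsBicollar c F) : LocallyTwoSided (range c) := by
  rintro _ ⟨z₀, rfl⟩ O hO
  obtain ⟨s₀, rfl⟩ := Circle.exp_surjective z₀
  have hc : ContinuousAt (fun q : ℝ × ℝ => F (Circle.exp q.1, q.2)) (s₀, 0) :=
    ContinuousAt.comp (f := fun q : ℝ × ℝ => (Circle.exp q.1, q.2)) (h.continuousAt (zero_mem _))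
      (by fun_prop)
  rw [← h.zero] at hO
  obtain ⟨η₀, hη₀, hη₀O⟩ := Metric.mem_nhds_iff.1 (hc hO)
  obtain ⟨η, hη, hηη, hη2⟩ : ∃ η : ℝ, 0 < η ∧ η ≤ η₀ ∧ η ≤ 2 :=
    ⟨min η₀ 2, by positivity, min_le_left _ _, min_le_right _ _⟩
  set U : Set Circle := Circle.exp '' Ioo (s₀ - η) (s₀ + η) with hU
  have hUo : IsOpen U := isLocalHomeomorph_circleExp.isOpenMap _ isOpen_Ioo
  have hUc : IsPreconnected U := isPreconnected_Ioo.image _ Circle.exp.continuous.continuousOn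
  have hstrip : ∀ I : Set ℝ, I ⊆ Ioo (-η) η → U ×ˢ I ⊆ univ ×ˢ Ioo (-2 : ℝ) 2 := by
    rintro I hI ⟨z, t⟩ ⟨-, ht⟩
    have := hI ht
    exact ⟨mem_univ _, by linarith [this.1], by linarith [this.2]⟩
  have hpos : Ioo 0 η ⊆ Ioo (-η) η := Ioo_subset_Ioo (by linarith) le_rfl
  have hneg : Ioo (-η) 0 ⊆ Ioo (-η) η := Ioo_subset_Ioo le_rfl hη.le
  refine ⟨F '' (U ×ˢ Ioo (-η) η), F '' (U ×ˢ Ioo 0 η), F '' (U ×ˢ Ioo (-η) 0),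
    h.isOpen_image (hUo.prod isOpen_Ioo) (hstrip _ Subset.rfl), ?_, ?_, ?_, ?_,
    h.isOpen_image (hUo.prod isOpen_Ioo) (hstrip _ hpos),
    h.isOpen_image (hUo.prod isOpen_Ioo) (hstrip _ hneg),
    (hUc.prod isPreconnected_Ioo).image _ (h.continuousOn.mono (hstrip _ hpos)),
    (hUc.prod isPreconnected_Ioo).image _ (h.continuousOn.mono (hstrip _ hneg)), ?_, ?_⟩
  · exact ⟨(Circle.exp s₀, 0), ⟨⟨s₀, by constructor <;> linarith, rfl⟩, by constructor <;> linarith⟩,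
      h.zero _⟩
  · rintro _ ⟨⟨z, t⟩, ⟨⟨s, hs, rfl⟩, ht⟩, rfl⟩
    refine hη₀O (show (s, t) ∈ ball (s₀, (0 : ℝ)) η₀ from ?_)
    rw [mem_ball, Prod.dist_eq, max_lt_iff, Real.dist_eq, Real.dist_eq, abs_lt, abs_lt]
    simp only at ht ⊢
    exact ⟨⟨by linarith [hs.1], by linarith [hs.2]⟩, by linarith [ht.1], by linarith [ht.2]⟩
  · ext x
    constructor
    · rintro (⟨q, hq, rfl⟩ | ⟨q, hq, rfl⟩)
      · refine ⟨⟨q, ⟨hq.1, hpos hq.2⟩, rfl⟩, ?_⟩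
        rw [h.mem_range_iff (hstrip _ hpos hq)]
        exact hq.2.1.ne'
      · refine ⟨⟨q, ⟨hq.1, hneg hq.2⟩, rfl⟩, ?_⟩
        rw [h.mem_range_iff (hstrip _ hneg hq)]
        exact hq.2.2.ne
    · rintro ⟨⟨q, hq, rfl⟩, hx⟩
      rw [h.mem_range_iff (hstrip _ Subset.rfl hq)] at hx
      rcases lt_or_gt_of_ne hx with h1 | h1
      · exact Or.inr ⟨q, ⟨hq.1, hq.2.1, h1⟩, rfl⟩
      · exact Or.inl ⟨q, ⟨hq.1, h1, hq.2.2⟩, rfl⟩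
  · rw [disjoint_left]
    rintro _ ⟨q, hq, rfl⟩ ⟨q', hq', heq⟩
    have := h.injOn (hstrip _ hneg hq') (hstrip _ hpos hq) heq
    subst this
    exact lt_asymm hq.2.1 hq'.2.2
  all_goals
    rintro _ ⟨⟨q, hq, rfl⟩, hx⟩
    rw [h.mem_range_iff (hstrip _ Subset.rfl hq)] at hx
    refine mem_closure_image (h.continuousAt (hstrip _ Subset.rfl hq)) ?_
    rw [closure_prod_eq, closure_Ioo (by linarith)]
    refine ⟨subset_closure hq.1, ?_⟩
    rw [hx]
    constructor <;> linarith

end IsBicollar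

/-- A bicollar of a closed curve together with the two sides of the curve. -/
structure IsSidedBicollar {X : Type*} [TopologicalSpace X] (c : Circle → X) (F : Circle × ℝ → X)
    (A B : Set X) : Prop extends IsBicollar c F where
  isOpen_left : IsOpen A
  isOpen_right : IsOpen B
  disjoint : Disjoint A B
  union_eq : A ∪ B = (range c)ᶜ
  image_pos : ∀ z, ∀ t ∈ Ioo (0 : ℝ) 2, F (z, t) ∈ A
  image_neg : ∀ z, ∀ t ∈ Ioo (-2 : ℝ) 0, F (z, t) ∈ B

/-- The opposite orientation of a bicollar. -/
theorem IsSidedBicollar.symm {X : Type*} [TopologicalSpace X] {c : Circle → X}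
    {F : Circle × ℝ → X} {A B : Set X} (h : IsSidedBicollar c F A B) :
    IsSidedBicollar c (fun q => F (q.1, -q.2)) B A := by
  have hneg : ∀ q ∈ (univ : Set Circle) ×ˢ Ioo (-2 : ℝ) 2,
      (q.1, -q.2) ∈ (univ : Set Circle) ×ˢ Ioo (-2 : ℝ) 2 := by
    rintro q ⟨-, h1, h2⟩
    exact ⟨mem_univ _, by simp only; linarith, by simp only; linarith⟩
  let m : Circle × ℝ ≃ₜ Circle × ℝ := (Homeomorph.refl Circle).prodCongr (Homeomorph.neg ℝ)
  refine ⟨⟨?_, ?_, ?_, ?_⟩, h.isOpen_right, h.isOpen_left, h.disjoint.symm, ?_, ?_, ?_⟩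
  · exact h.continuousOn.comp (by fun_prop) hneg
  · intro q hq
    have h1 : map (fun q : Circle × ℝ => F (q.1, -q.2)) (𝓝 q) = map F (map m (𝓝 q)) := rfl
    rw [h1, m.map_nhds_eq]
    exact h.map_nhds _ (hneg q hq)
  · intro q hq q' hq' hqq
    exact m.injective (h.injOn (hneg q hq) (hneg q' hq') hqq)
  · intro z
    simp only [neg_zero, h.zero]
  · rw [union_comm, h.union_eq]
  · intro z t ht
    exact h.image_neg z _ ⟨by linarith [ht.2], by linarith [ht.1]⟩
  · intro z t ht
    exact h.image_pos z _ ⟨by linarith [ht.2], by linarith [ht.1]⟩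

/-- The point of the sphere at height `t` (clamped to `[-1, 1]`) in the direction `z`. -/
noncomputable def latitudePoint (z : ℂ) (t : ℝ) : Euc 3 :=
  !₂[Real.sqrt (1 - t ^ 2) * z.re, Real.sqrt (1 - t ^ 2) * z.im, t]

theorem latitudePoint_mem {z : ℂ} (hz : ‖z‖ = 1) {t : ℝ} (ht : t ∈ Icc (-1 : ℝ) 1) :
    latitudePoint z t ∈ sphere (0 : Euc 3) 1 := by
  have h1 : 0 ≤ 1 - t ^ 2 := by nlinarith [ht.1, ht.2]
  have h2 : z.re * z.re + z.im * z.im = 1 := by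
    rw [← Complex.normSq_apply, Complex.normSq_eq_norm_sq, hz, one_pow]
  rw [mem_sphere_zero_iff_norm, EuclideanSpace.norm_eq, Real.sqrt_eq_one]
  simp only [latitudePoint, Fin.sum_univ_three, Real.norm_eq_abs, sq_abs]
  simp only [Matrix.cons_val_zero, Matrix.cons_val_one, Matrix.cons_val]
  rw [mul_pow, mul_pow, Real.sq_sqrt h1]
  linear_combination (1 - t ^ 2) * h2

theorem continuous_latitudePoint : Continuous fun q : ℂ × ℝ => latitudePoint q.1 q.2 := by
  unfold latitudePoint
  refine (PiLp.continuous_toLp 2 _).comp (continuous_pi fun i => ?_)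
  fin_cases i <;> simp <;> fun_prop

/-- Spherical cylinder coordinates, with the height clamped to `[-1, 1]`. -/
noncomputable def cylinderToSphere (q : Circle × ℝ) : StdSphere2 :=
  ⟨latitudePoint q.1 (max (-1) (min 1 q.2)), latitudePoint_mem (Circle.norm_coe q.1)
    ⟨le_max_left _ _, max_le (by norm_num) (min_le_left _ _)⟩⟩

theorem continuous_cylinderToSphere : Continuous cylinderToSphere := by
  refine Continuous.subtype_mk ?_ _
  exact continuous_latitudePoint.comp (f := fun q : Circle × ℝ =>
    ((q.1 : ℂ), max (-1) (min 1 q.2))) (by fun_prop)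

theorem cylinderToSphere_height (q : Circle × ℝ) :
    (cylinderToSphere q : Euc 3) 2 = max (-1) (min 1 q.2) := by
  simp [cylinderToSphere, latitudePoint]

theorem cylinderToSphere_of_one_le {q : Circle × ℝ} (h : 1 ≤ q.2) :
    cylinderToSphere q = cylinderToSphere (1, 1) := by
  have : max (-1) (min 1 q.2) = 1 := by rw [min_eq_left h]; norm_num
  ext i
  fin_cases i <;> simp [cylinderToSphere, latitudePoint, this]

theorem cylinderToSphere_of_le_neg_one {q : Circle × ℝ} (h : q.2 ≤ -1) :
    cylinderToSphere q = cylinderToSphere (1, -1) := by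
  have : max (-1) (min 1 q.2) = -1 := by rw [min_eq_right (by linarith), max_eq_left h]
  ext i
  fin_cases i <;> simp [cylinderToSphere, latitudePoint, this]

theorem cylinderToSphere_injOn : InjOn cylinderToSphere (univ ×ˢ Ioo (-1) 1) := by
  have hcl : ∀ t ∈ Ioo (-1 : ℝ) 1, max (-1) (min 1 t) = t := fun t ht => by
    rw [min_eq_right ht.2.le, max_eq_right ht.1.le]
  rintro ⟨z, t⟩ ⟨-, ht⟩ ⟨w, u⟩ ⟨-, hu⟩ h
  simp only at ht hu
  have h1 := cylinderToSphere_height (z, t)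
  rw [h, cylinderToSphere_height] at h1
  simp only [hcl _ ht, hcl _ hu] at h1
  subst h1
  have h2 : Real.sqrt (1 - u ^ 2) ≠ 0 := (Real.sqrt_pos.2 (by nlinarith [hu.1, hu.2])).ne'
  have h3 := congrArg (fun y : StdSphere2 => (y : Euc 3) 0) h
  have h4 := congrArg (fun y : StdSphere2 => (y : Euc 3) 1) h
  simp [cylinderToSphere, latitudePoint, hcl _ hu, h2] at h3 h4
  rw [Prod.mk.injEq]
  exact ⟨Circle.ext (Complex.ext h3 h4), rfl⟩

theorem cylinderToSphere_surjective (y : StdSphere2) :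
    ∃ q : Circle × ℝ, q.2 ∈ Icc (-1 : ℝ) 1 ∧ cylinderToSphere q = y := by
  obtain ⟨y, hy⟩ := y
  have hsum : y 0 ^ 2 + y 1 ^ 2 + y 2 ^ 2 = 1 := by
    rw [mem_sphere_zero_iff_norm, EuclideanSpace.norm_eq, Real.sqrt_eq_one] at hy
    simpa only [Fin.sum_univ_three, Real.norm_eq_abs, sq_abs] using hy
  have ht : y 2 ∈ Icc (-1 : ℝ) 1 := abs_le.1 (by
    rw [← sq_le_one_iff_abs_le_one]; nlinarith [sq_nonneg (y 0), sq_nonneg (y 1)])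
  have hcl : max (-1) (min 1 (y 2)) = y 2 := by
    rw [min_eq_right ht.2, max_eq_right ht.1]
  set w : ℂ := ⟨y 0, y 1⟩ with hw
  have hwn : ‖w‖ ^ 2 = 1 - y 2 ^ 2 := by
    rw [← Complex.normSq_eq_norm_sq, Complex.normSq_apply]
    simp only [hw]
    linarith
  have hwn' : Real.sqrt (1 - y 2 ^ 2) = ‖w‖ := by
    rw [← hwn, Real.sqrt_sq (norm_nonneg _)]
  obtain ⟨z, hz⟩ : ∃ z : Circle, (‖w‖ : ℂ) * z = w :=
    ⟨Circle.exp (Complex.arg w), by simp [Complex.norm_mul_exp_arg_mul_I]⟩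
  refine ⟨(z, y 2), ht, ?_⟩
  have hre : ‖w‖ * (z : ℂ).re = y 0 := by
    have := congrArg Complex.re hz
    simpa [hw] using this
  have him : ‖w‖ * (z : ℂ).im = y 1 := by
    have := congrArg Complex.im hz
    simpa [hw] using this
  ext i
  fin_cases i
  · simpa [cylinderToSphere, latitudePoint, hcl, hwn'] using hre
  · simpa [cylinderToSphere, latitudePoint, hcl, hwn'] using him
  · simp [cylinderToSphere, latitudePoint, hcl]

open Classical in
/-- The map of the sphere to itself which spreads a bicollar over the sphere and collapses the rest
of the two sides to the poles. -/
noncomputable def collarCollapse (F : Circle × ℝ → StdSphere2) (A : Set StdSphere2)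
    (x : StdSphere2) : StdSphere2 :=
  if h : ∃ q ∈ (univ : Set Circle) ×ˢ Ioo (-2 : ℝ) 2, F q = x then cylinderToSphere h.choose
  else if x ∈ A then cylinderToSphere (1, 1) else cylinderToSphere (1, -1)

namespace IsSidedBicollar

variable {c : Circle → StdSphere2} {F : Circle × ℝ → StdSphere2} {A B : Set StdSphere2}

theorem collapse_apply (h : IsSidedBicollar c F A B) {q : Circle × ℝ}
    (hq : q ∈ (univ : Set Circle) ×ˢ Ioo (-2 : ℝ) 2) :
    collarCollapse F A (F q) = cylinderToSphere q := by
  have hex : ∃ q' ∈ (univ : Set Circle) ×ˢ Ioo (-2 : ℝ) 2, F q' = F q := ⟨q, hq, rfl⟩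
  rw [collarCollapse, dif_pos hex, h.injOn hex.choose_spec.1 hq hex.choose_spec.2]

theorem mem_left_iff (h : IsSidedBicollar c F A B) {q : Circle × ℝ}
    (hq : q ∈ (univ : Set Circle) ×ˢ Ioo (-2 : ℝ) 2) : F q ∈ A ↔ 0 < q.2 := by
  refine ⟨fun hA => ?_, fun h0 => h.image_pos _ _ ⟨h0, hq.2.2⟩⟩
  by_contra hle
  rcases (not_lt.1 hle).lt_or_eq with h1 | h1
  · exact h.disjoint.le_bot ⟨hA, h.image_neg _ _ ⟨hq.2.1, h1⟩⟩
  · have : F q ∈ (range c)ᶜ := h.union_eq ▸ Or.inl hA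
    exact this ((h.mem_range_iff hq).2 h1)

theorem mem_right_iff (h : IsSidedBicollar c F A B) {q : Circle × ℝ}
    (hq : q ∈ (univ : Set Circle) ×ˢ Ioo (-2 : ℝ) 2) : F q ∈ B ↔ q.2 < 0 := by
  refine ⟨fun hB => ?_, fun h0 => h.image_neg _ _ ⟨hq.2.1, h0⟩⟩
  by_contra hle
  rcases (not_lt.1 hle).lt_or_eq with h1 | h1
  · exact h.disjoint.le_bot ⟨h.image_pos _ _ ⟨h1, hq.2.2⟩, hB⟩
  · have : F q ∈ (range c)ᶜ := h.union_eq ▸ Or.inr hB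
    exact this ((h.mem_range_iff hq).2 h1.symm)

theorem collapse_of_left (h : IsSidedBicollar c F A B) {x : StdSphere2} (hx : x ∈ A)
    (hx' : x ∉ F '' (univ ×ˢ Icc (-1) 1)) :
    collarCollapse F A x = cylinderToSphere (1, 1) := by
  by_cases hex : ∃ q ∈ (univ : Set Circle) ×ˢ Ioo (-2 : ℝ) 2, F q = x
  · obtain ⟨q, hq, rfl⟩ := hex
    rw [h.collapse_apply hq]
    apply cylinderToSphere_of_one_le
    by_contra hlt
    have := (h.mem_left_iff hq).1 hx
    exact hx' ⟨q, ⟨mem_univ _, by linarith, by linarith⟩, rfl⟩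
  · rw [collarCollapse, dif_neg hex, if_pos hx]

theorem collapse_of_right (h : IsSidedBicollar c F A B) {x : StdSphere2} (hx : x ∈ B)
    (hx' : x ∉ F '' (univ ×ˢ Icc (-1) 1)) :
    collarCollapse F A x = cylinderToSphere (1, -1) := by
  by_cases hex : ∃ q ∈ (univ : Set Circle) ×ˢ Ioo (-2 : ℝ) 2, F q = x
  · obtain ⟨q, hq, rfl⟩ := hex
    rw [h.collapse_apply hq]
    apply cylinderToSphere_of_le_neg_one
    by_contra hlt
    have := (h.mem_right_iff hq).1 hx
    exact hx' ⟨q, ⟨mem_univ _, by linarith, by linarith⟩, rfl⟩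
  · rw [collarCollapse, dif_neg hex, if_neg fun hA => h.disjoint.le_bot ⟨hA, hx⟩]

theorem mem_collar_or (h : IsSidedBicollar c F A B) (x : StdSphere2) :
    (∃ q ∈ (univ : Set Circle) ×ˢ Icc (-1 : ℝ) 1, F q = x) ∨
      (x ∈ A ∧ x ∉ F '' (univ ×ˢ Icc (-1) 1)) ∨ (x ∈ B ∧ x ∉ F '' (univ ×ˢ Icc (-1) 1)) := by
  by_cases hx : x ∈ F '' (univ ×ˢ Icc (-1) 1)
  · exact Or.inl hx
  · have : x ∈ A ∪ B := by
      rw [h.union_eq]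
      rintro ⟨z, rfl⟩
      exact hx ⟨(z, 0), ⟨mem_univ _, by norm_num⟩, h.zero z⟩
    rcases this with h1 | h1
    · exact Or.inr (Or.inl ⟨h1, hx⟩)
    · exact Or.inr (Or.inr ⟨h1, hx⟩)

theorem closed_collar_subset : (univ : Set Circle) ×ˢ Icc (-1 : ℝ) 1 ⊆ univ ×ˢ Ioo (-2) 2 :=
  prod_mono Subset.rfl (Icc_subset_Ioo (by norm_num) (by norm_num))

/-- The collapse is already constant at heights of absolute value at least `1`, while the collar
reaches to `2`. So the open collar and the complement of the closed collar `|t| ≤ 1` form an open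
cover, on which the map is respectively given by cylinder coordinates and locally constant. -/
theorem continuous_collapse (h : IsSidedBicollar c F A B) : Continuous (collarCollapse F A) := by
  have hK : IsClosed (F '' (univ ×ˢ Icc (-1) 1)) :=
    ((isCompact_univ.prod isCompact_Icc).image_of_continuousOn
      (h.continuousOn.mono closed_collar_subset)).isClosed
  rw [continuous_iff_continuousAt]
  intro x
  rcases h.mem_collar_or x with ⟨q, hq, rfl⟩ | ⟨h1, h2⟩ | ⟨h1, h2⟩
  · have hq' := closed_collar_subset hq
    rw [ContinuousAt, ← h.map_nhds q hq', tendsto_map'_iff, h.collapse_apply hq']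
    refine (continuous_cylinderToSphere.continuousAt (x := q)).congr' ?_
    filter_upwards [(isOpen_univ.prod isOpen_Ioo).mem_nhds hq'] with q' hq''
    exact (h.collapse_apply hq'').symm
  · refine continuousAt_const.congr (f := fun _ => cylinderToSphere (1, 1)) ?_
    filter_upwards [(h.isOpen_left.inter hK.isOpen_compl).mem_nhds ⟨h1, h2⟩] with y hy
    exact (h.collapse_of_left hy.1 hy.2).symm
  · refine continuousAt_const.congr (f := fun _ => cylinderToSphere (1, -1)) ?_
    filter_upwards [(h.isOpen_right.inter hK.isOpen_compl).mem_nhds ⟨h1, h2⟩] with y hy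
    exact (h.collapse_of_right hy.1 hy.2).symm

/-- Identifies the closed side of the curve with the preimage of a hemisphere, the form in which
Brown's theorem yields a disc. -/
theorem height_collapse_nonneg_iff (h : IsSidedBicollar c F A B) (x : StdSphere2) :
    0 ≤ (collarCollapse F A x : Euc 3) 2 ↔ x ∈ A ∪ range c := by
  rcases h.mem_collar_or x with ⟨q, hq, rfl⟩ | ⟨h1, h2⟩ | ⟨h1, h2⟩
  · have hq' := closed_collar_subset hq
    rw [h.collapse_apply hq', cylinderToSphere_height, mem_union, h.mem_left_iff hq',
      h.mem_range_iff hq', min_eq_right hq.2.2, max_eq_right hq.2.1, le_iff_lt_or_eq]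
    exact or_congr Iff.rfl eq_comm
  · rw [h.collapse_of_left h1 h2, cylinderToSphere_height]
    exact iff_of_true (by norm_num) (Or.inl h1)
  · rw [h.collapse_of_right h1 h2, cylinderToSphere_height]
    refine iff_of_false (by norm_num) ?_
    rintro (h3 | h3)
    · exact h.disjoint.le_bot ⟨h3, h1⟩
    · have : x ∈ (range c)ᶜ := h.union_eq ▸ Or.inr h1
      exact this h3

/-- The point of the closed upper hemisphere above a point of the closed unit disc. -/
noncomputable def hemispherePoint (w : ℂ) : StdSphere2 :=
  if h : ‖w‖ ≤ 1 then ⟨!₂[w.re, w.im, Real.sqrt (1 - ‖w‖ ^ 2)], by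
    have h1 : 0 ≤ 1 - ‖w‖ ^ 2 := by nlinarith [norm_nonneg w]
    have h2 : w.re * w.re + w.im * w.im = ‖w‖ ^ 2 := by
      rw [← Complex.normSq_apply, Complex.normSq_eq_norm_sq]
    rw [mem_sphere_zero_iff_norm, EuclideanSpace.norm_eq, Real.sqrt_eq_one]
    simp only [Fin.sum_univ_three, Real.norm_eq_abs, sq_abs]
    simp only [Matrix.cons_val_zero, Matrix.cons_val_one, Matrix.cons_val]
    rw [Real.sq_sqrt h1]
    linear_combination h2⟩
  else cylinderToSphere (1, 1)

theorem hemispherePoint_coe {w : ℂ} (h : ‖w‖ ≤ 1) :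
    (hemispherePoint w : Euc 3) = !₂[w.re, w.im, Real.sqrt (1 - ‖w‖ ^ 2)] := by
  rw [hemispherePoint, dif_pos h]

theorem continuousOn_hemispherePoint : ContinuousOn hemispherePoint (closedBall 0 1) := by
  rw [Topology.IsInducing.subtypeVal.continuousOn_iff]
  have : Continuous fun w : ℂ => (!₂[w.re, w.im, Real.sqrt (1 - ‖w‖ ^ 2)] : Euc 3) := by
    refine (PiLp.continuous_toLp 2 _).comp (continuous_pi fun i => ?_)
    fin_cases i <;> simp <;> fun_prop
  refine this.continuousOn.congr fun w hw => ?_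
  exact hemispherePoint_coe (mem_closedBall_zero_iff.1 hw)

theorem injOn_hemispherePoint : InjOn hemispherePoint (closedBall 0 1) := by
  intro w hw w' hw' h
  rw [mem_closedBall_zero_iff] at hw hw'
  have h1 : (hemispherePoint w : Euc 3) = hemispherePoint w' := congrArg _ h
  rw [hemispherePoint_coe hw, hemispherePoint_coe hw'] at h1
  have h2 := congrArg (fun y : Euc 3 => y 0) h1
  have h3 := congrArg (fun y : Euc 3 => y 1) h1
  simp at h2 h3
  exact Complex.ext h2 h3

theorem image_hemispherePoint :
    hemispherePoint '' closedBall 0 1 = {y : StdSphere2 | 0 ≤ (y : Euc 3) 2} := by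
  ext y
  constructor
  · rintro ⟨w, hw, rfl⟩
    rw [mem_closedBall_zero_iff] at hw
    rw [mem_ofPred_eq, hemispherePoint_coe hw]
    simp [Real.sqrt_nonneg]
  · intro hy
    obtain ⟨y, hy'⟩ := y
    have hsum : y 0 ^ 2 + y 1 ^ 2 + y 2 ^ 2 = 1 := by
      rw [mem_sphere_zero_iff_norm, EuclideanSpace.norm_eq, Real.sqrt_eq_one] at hy'
      simpa only [Fin.sum_univ_three, Real.norm_eq_abs, sq_abs] using hy'
    have hwn : ‖(⟨y 0, y 1⟩ : ℂ)‖ ^ 2 = 1 - y 2 ^ 2 := by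
      rw [← Complex.normSq_eq_norm_sq, Complex.normSq_apply]
      simp only
      linarith
    have hw : ‖(⟨y 0, y 1⟩ : ℂ)‖ ≤ 1 := by
      rw [← abs_norm, ← sq_le_one_iff_abs_le_one, hwn]
      nlinarith [sq_nonneg (y 2)]
    refine ⟨⟨y 0, y 1⟩, mem_closedBall_zero_iff.2 hw, Subtype.ext ?_⟩
    rw [hemispherePoint_coe hw, hwn]
    ext i
    fin_cases i
    · simp
    · simp
    · simpa using Real.sqrt_sq hy

theorem hemispherePoint_circle (z : Circle) : hemispherePoint z = cylinderToSphere (z, 0) := by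
  apply Subtype.ext
  rw [hemispherePoint_coe (Circle.norm_coe z).le]
  rw [Circle.norm_coe]
  ext i
  fin_cases i <;> simp [cylinderToSphere, latitudePoint]

/-- **Schoenflies theorem** for bicollared curves on the sphere: each closed side of the curve is a
disc. -/
theorem exists_disc (h : IsSidedBicollar c F A B) :
    ∃ p : ℂ → StdSphere2, ContinuousOn p (closedBall 0 1) ∧ InjOn p (closedBall 0 1) ∧
      p '' closedBall 0 1 = A ∪ range c ∧ ∀ z : Circle, p z = c z := by
  have hcl : ∀ t ∈ Icc (-1 : ℝ) 1, max (-1) (min 1 t) = t := fun t ht => by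
    rw [min_eq_right ht.2, max_eq_right ht.1]
  have hstrip : ∀ (z : Circle) {t : ℝ}, t ∈ Icc (-1 : ℝ) 1 →
      (z, t) ∈ (univ : Set Circle) ×ˢ Ioo (-2 : ℝ) 2 := fun z t ht =>
    closed_collar_subset ⟨mem_univ _, ht⟩
  have hhalf : (-1 / 2 : ℝ) ∈ Icc (-1 : ℝ) 1 := by norm_num
  set f := collarCollapse F A
  set T : Set StdSphere2 := {y | 0 ≤ (y : Euc 3) 2} with hT
  have hheight : Continuous fun y : StdSphere2 => (y : Euc 3) 2 := by fun_prop
  -- The point to be removed: it lies inside the collar, so its fibre is a single point, and its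
  -- image lies below the equator, outside the hemisphere `T`.
  set e := F (1, -1 / 2) with he
  have hfe : f e = cylinderToSphere (1, -1 / 2) := h.collapse_apply (hstrip 1 hhalf)
  have hfe2 : (f e : Euc 3) 2 = -1 / 2 := by
    rw [hfe, cylinderToSphere_height, hcl _ hhalf]
  have hN : (cylinderToSphere (1, 1) : Euc 3) 2 = 1 := by
    rw [cylinderToSphere_height]; norm_num
  have hS : (cylinderToSphere (1, -1) : Euc 3) 2 = -1 := by
    rw [cylinderToSphere_height]; norm_num
  have hinside : ∀ x, f x ≠ cylinderToSphere (1, 1) → f x ≠ cylinderToSphere (1, -1) →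
      ∃ q ∈ (univ : Set Circle) ×ˢ Ioo (-1 : ℝ) 1, F q = x := by
    intro x h1 h2
    rcases h.mem_collar_or x with ⟨q, hq, rfl⟩ | ⟨h3, h4⟩ | ⟨h3, h4⟩
    · have hq' := closed_collar_subset hq
      refine ⟨q, ⟨mem_univ _, ?_, ?_⟩, rfl⟩
      · by_contra hcon
        exact h2 ((h.collapse_apply hq').trans (cylinderToSphere_of_le_neg_one (not_lt.1 hcon)))
      · by_contra hcon
        exact h1 ((h.collapse_apply hq').trans (cylinderToSphere_of_one_le (not_lt.1 hcon)))
    · exact (h1 (h.collapse_of_left h3 h4)).elim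
    · exact (h2 (h.collapse_of_right h3 h4)).elim
  have hsub : (univ : Set Circle) ×ˢ Ioo (-1 : ℝ) 1 ⊆ univ ×ˢ Ioo (-2) 2 :=
    prod_mono Subset.rfl (Ioo_subset_Ioo (by norm_num) (by norm_num))
  -- The special values are the poles: the north pole is interior to the hemisphere `T` and the
  -- south pole is outside. The planes are obtained by stereographic projection.
  obtain ⟨Ψ, hΨc, hΨi, hΨim, hΨid⟩ := exists_parametrization_of_collapse (V := Euc 2)
    (f := f) (a := cylinderToSphere (1, 1)) (b := cylinderToSphere (1, -1)) (e := e)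
    (stereographic' 2 e) (stereographic'_source e) (stereographic'_target e)
    (stereographic' 2 (f e)) (stereographic'_source _) (stereographic'_target _)
    h.continuous_collapse (fun y => by
      obtain ⟨q, hq, rfl⟩ := cylinderToSphere_surjective y
      exact ⟨F q, h.collapse_apply (hstrip q.1 hq)⟩)
    (fun h => by rw [h, hS] at hN; norm_num at hN)
    (fun h => by rw [h, hN] at hfe2; norm_num at hfe2)
    (fun h => by rw [h, hS] at hfe2; norm_num at hfe2)
    (fun x y hxy h1 h2 => by
      obtain ⟨q, hq, rfl⟩ := hinside x h1 h2
      obtain ⟨q', hq', rfl⟩ := hinside y (hxy ▸ h1) (hxy ▸ h2)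
      have : cylinderToSphere q = cylinderToSphere q' := by
        rw [← h.collapse_apply (hsub hq), ← h.collapse_apply (hsub hq')]
        exact hxy
      rw [cylinderToSphere_injOn hq hq' this])
    (T := T) (by rw [hT, mem_ofPred_eq, hfe2]; norm_num)
    (by rw [hT, mem_ofPred_eq, hS]; norm_num)
    (by
      rw [mem_interior_iff_mem_nhds]
      filter_upwards [hheight.continuousAt.eventually (lt_mem_nhds
        (show (0 : ℝ) < (cylinderToSphere (1, 1) : Euc 3) 2 by rw [hN]; norm_num))] with y hy
      exact le_of_lt hy)
  refine ⟨fun w => Ψ (hemispherePoint w), ?_, ?_, ?_, ?_⟩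
  · refine hΨc.comp continuousOn_hemispherePoint fun w hw => ?_
    rw [hT, ← image_hemispherePoint]
    exact mem_image_of_mem _ hw
  · refine hΨi.comp injOn_hemispherePoint fun w hw => ?_
    rw [hT, ← image_hemispherePoint]
    exact mem_image_of_mem _ hw
  · rw [← image_image Ψ hemispherePoint, image_hemispherePoint, hΨim]
    ext x
    exact h.height_collapse_nonneg_iff x
  · intro z
    have h0 : (0 : ℝ) ∈ Icc (-1 : ℝ) 1 := by norm_num
    have hfz : f (c z) = cylinderToSphere (z, 0) := by
      rw [← h.zero]
      exact h.collapse_apply (hstrip z h0)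
    change Ψ (hemispherePoint z) = c z
    rw [hemispherePoint_circle, ← hfz]
    refine hΨid _ ?_ ?_
    · rw [hT, mem_ofPred_eq, hfz, cylinderToSphere_height]
      norm_num
    -- Points of the equator are not interior to the hemisphere, as is seen by moving to negative
    -- heights; hence the parametrization inverts the collapse there and restricts to `c`.
    · intro hint
      rw [hfz, mem_interior_iff_mem_nhds] at hint
      have hct : Tendsto (fun t : ℝ => cylinderToSphere (z, t)) (𝓝[<] 0)
          (𝓝 (cylinderToSphere (z, 0))) :=
        ((continuous_cylinderToSphere.comp (by fun_prop : Continuous fun t : ℝ => (z, t))).tendsto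
          0).mono_left nhdsWithin_le_nhds
      have hev : ∀ᶠ t in 𝓝[<] (0 : ℝ), cylinderToSphere (z, t) ∈ T := hct hint
      obtain ⟨t, ht, ht0⟩ := (hev.and self_mem_nhdsWithin).exists
      rw [hT, mem_ofPred_eq, cylinderToSphere_height] at ht
      have ht0' : t < 0 := ht0
      rw [min_eq_right (by linarith)] at ht
      exact absurd ht (not_le.2 (max_lt (by norm_num) ht0'))

end IsSidedBicollar

end SphereSchoenflies

/-! ### From plane curves to curves on the sphere -/

section JordanOnSphere

open Topology Filter

theorem isPreconnected_norm_gt {R : ℝ} (hR : 0 ≤ R) : IsPreconnected {z : ℂ | R < ‖z‖} := by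
  have : {z : ℂ | R < ‖z‖} = (fun q : ℝ × Circle => (q.1 : ℂ) * q.2) '' (Ioi R ×ˢ univ) := by
    ext z
    constructor
    · intro hz
      refine ⟨(‖z‖, Circle.exp (Complex.arg z)), ⟨hz, mem_univ _⟩, ?_⟩
      simp [Complex.norm_mul_exp_arg_mul_I]
    · rintro ⟨⟨r, w⟩, ⟨hr, -⟩, rfl⟩
      have hr' : R < r := hr
      rw [mem_ofPred_eq, norm_mul, Circle.norm_coe, mul_one, Complex.norm_real, Real.norm_eq_abs,
        abs_of_pos (hR.trans_lt hr')]
      exact hr'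
  rw [this]
  exact (isPreconnected_Ioi.prod isPreconnected_univ).image _ (by fun_prop)

/-- A bicollared closed curve in the plane has two connected sides. -/
theorem IsBicollar.exists_sides {c : Circle → ℂ} {F : Circle × ℝ → ℂ} (h : IsBicollar c F) :
    ∃ A B : Set ℂ, IsConnected A ∧ IsConnected B ∧ IsSidedBicollar c F A B := by
  have hcc := h.continuous_curve
  have hLTS := h.locallyTwoSided
  obtain ⟨A, B, hA, hB, hAc, hBc, hAB, hU, hDA, hDB⟩ := hLTS.exists_separation
    (isCompact_range hcc).isClosed (isConnected_range hcc)
  have hAD : Disjoint A (range c) := disjoint_left.2 fun x hx => hU.subset (Or.inl hx)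
  have hBD : Disjoint B (range c) := disjoint_left.2 fun x hx => hU.subset (Or.inr hx)
  have hposs : (univ : Set Circle) ×ˢ Ioo (0 : ℝ) 2 ⊆ univ ×ˢ Ioo (-2) 2 :=
    prod_mono Subset.rfl (Ioo_subset_Ioo (by norm_num) le_rfl)
  have hnegs : (univ : Set Circle) ×ˢ Ioo (-2 : ℝ) 0 ⊆ univ ×ˢ Ioo (-2) 2 :=
    prod_mono Subset.rfl (Ioo_subset_Ioo le_rfl (by norm_num))
  have hPN : F '' (univ ×ˢ Ioo 0 2) ∪ F '' (univ ×ˢ Ioo (-2) 0) =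
      F '' (univ ×ˢ Ioo (-2) 2) \ range c := by
    ext x
    constructor
    · rintro (⟨q, hq, rfl⟩ | ⟨q, hq, rfl⟩)
      · exact ⟨⟨q, hposs hq, rfl⟩, by rw [h.mem_range_iff (hposs hq)]; exact hq.2.1.ne'⟩
      · exact ⟨⟨q, hnegs hq, rfl⟩, by rw [h.mem_range_iff (hnegs hq)]; exact hq.2.2.ne⟩
    · rintro ⟨⟨q, hq, rfl⟩, hx⟩
      rw [h.mem_range_iff hq] at hx
      rcases lt_or_gt_of_ne hx with h1 | h1
      · exact Or.inr ⟨q, ⟨hq.1, hq.2.1, h1⟩, rfl⟩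
      · exact Or.inl ⟨q, ⟨hq.1, h1, hq.2.2⟩, rfl⟩
  have hc1 : c 1 ∈ range c := mem_range_self 1
  -- The two half-collars are connected, so the sides they belong to can be decided at one point of
  -- the curve.
  have hopp := opposite_sides (x := c 1) (W := F '' (univ ×ˢ Ioo (-2) 2))
    ((isPreconnected_univ.prod isPreconnected_Ioo).image _ (h.continuousOn.mono hposs))
    ((isPreconnected_univ.prod isPreconnected_Ioo).image _ (h.continuousOn.mono hnegs))
    hA hB hAB ((h.isOpen_image (isOpen_univ.prod isOpen_Ioo) Subset.rfl).mem_nhds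
      ⟨(1, 0), zero_mem 1, h.zero 1⟩) hPN (by rw [hU]; exact fun x hx => hx.2) hAD hBD
    (hDA hc1) (hDB hc1)
  rcases hopp with ⟨h1, h2⟩ | ⟨h1, h2⟩
  · exact ⟨A, B, hAc, hBc, ⟨h, hA, hB, hAB, hU, fun z t ht => h1 ⟨_, ⟨mem_univ _, ht⟩, rfl⟩,
      fun z t ht => h2 ⟨_, ⟨mem_univ _, ht⟩, rfl⟩⟩⟩
  · exact ⟨B, A, hBc, hAc, ⟨h, hB, hA, hAB.symm, by rw [union_comm, hU],
      fun z t ht => h1 ⟨_, ⟨mem_univ _, ht⟩, rfl⟩, fun z t ht => h2 ⟨_, ⟨mem_univ _, ht⟩, rfl⟩⟩⟩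

/-- A sided bicollar in the plane whose first side contains a neighbourhood of infinity gives a
sided bicollar in the one-point compactification. -/
theorem IsSidedBicollar.of_chart {X : Type*} [TopologicalSpace X] [T2Space X] [CompactSpace X]
    {v : X} (χ : OpenPartialHomeomorph X ℂ) (hχs : χ.source = {v}ᶜ) (hχt : χ.target = univ)
    {c : Circle → ℂ} {F : Circle × ℝ → ℂ} {A B : Set ℂ} (hA : IsConnected A) (hB : IsConnected B)
    (h : IsSidedBicollar c F A B) {R : ℝ} (hR : ∀ z, R < ‖z‖ → z ∈ A) :
    ∃ A' B' : Set X, IsConnected A' ∧ IsConnected B' ∧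
      IsSidedBicollar (fun z => χ.symm (c z)) (fun q => χ.symm (F q)) A' B' := by
  have ht : ∀ z, z ∈ χ.target := fun z => hχt ▸ mem_univ z
  have hsv : ∀ z, χ.symm z ≠ v := fun z => by
    have := χ.map_target (ht z)
    rwa [hχs] at this
  have hcont : Continuous χ.symm := by
    rw [← continuousOn_univ, ← hχt]; exact χ.symm.continuousOn
  have hinj : Function.Injective χ.symm := fun z w hzw => χ.symm.injOn (ht z) (ht w) hzw
  have hopen : ∀ U : Set ℂ, IsOpen U → IsOpen (χ.symm '' U) := fun U hU =>
    χ.symm.isOpen_image_of_subset_source hU fun z _ => ht z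
  have hnhds : ∀ z, map χ.symm (𝓝 z) = 𝓝 (χ.symm z) := fun z => χ.symm.map_nhds_eq (ht z)
  have hsurj : ∀ x, x ≠ v → ∃ z, χ.symm z = x := fun x hx =>
    ⟨χ x, χ.left_inv (by rw [hχs]; exact hx)⟩
  have hcomp : IsCompact Aᶜ := by
    refine Metric.isCompact_of_isClosed_isBounded h.isOpen_left.isClosed_compl ?_
    refine (Metric.isBounded_closedBall (x := (0 : ℂ)) (r := R)).subset fun z hz => ?_
    rw [mem_closedBall_zero_iff]
    by_contra hcon
    exact hz (hR z (not_le.1 hcon))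
  -- Otherwise the closure of the image of `A` would be a compact set avoiding `v`, and the plane
  -- would be the union of two compact sets. Adding a point of its closure keeps the image of `A`
  -- connected.
  have hvcl : v ∈ closure (χ.symm '' A) := by
    by_contra hcon
    have h1 : IsCompact (χ '' closure (χ.symm '' A)) := by
      refine isClosed_closure.isCompact.image_of_continuousOn (χ.continuousOn.mono ?_)
      rw [hχs]
      exact fun x hx hxv => hcon (hxv ▸ hx)
    refine noncompact_univ ℂ ((hcomp.union h1).of_isClosed_subset isClosed_univ fun z _ => ?_)
    by_cases hz : z ∈ A
    · exact Or.inr ⟨χ.symm z, subset_closure ⟨z, hz, rfl⟩, χ.right_inv (ht z)⟩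
    · exact Or.inl hz
  have hA'o : IsOpen (insert v (χ.symm '' A)) := by
    have : insert v (χ.symm '' A) = (χ.symm '' Aᶜ)ᶜ := by
      ext x
      constructor
      · rintro (rfl | ⟨z, hz, rfl⟩) ⟨w, hw, hwx⟩
        · exact hsv w hwx
        · exact hw (hinj hwx ▸ hz)
      · intro hx
        by_cases hxv : x = v
        · exact Or.inl hxv
        · obtain ⟨z, rfl⟩ := hsurj x hxv
          refine Or.inr ⟨z, ?_, rfl⟩
          by_contra hz
          exact hx ⟨z, hz, rfl⟩
    rw [this]
    exact (hcomp.image hcont).isClosed.isOpen_compl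
  refine ⟨insert v (χ.symm '' A), χ.symm '' B, ?_, hB.image _ hcont.continuousOn, ?_⟩
  · exact (hA.image _ hcont.continuousOn).subset_closure (subset_insert _ _)
      (insert_subset hvcl subset_closure)
  refine ⟨⟨hcont.comp_continuousOn h.continuousOn, ?_, ?_, ?_⟩, hA'o, hopen _ h.isOpen_right,
    ?_, ?_, ?_, ?_⟩
  · intro q hq
    have h1 : map (fun q => χ.symm (F q)) (𝓝 q) = map χ.symm (map F (𝓝 q)) := rfl
    rw [h1, h.map_nhds q hq, hnhds]
  · exact hinj.comp_injOn h.injOn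
  · exact fun z => congrArg _ (h.zero z)
  · rw [disjoint_left]
    rintro x (rfl | ⟨z, hz, rfl⟩) ⟨w, hw, hwx⟩
    · exact hsv w hwx
    · exact h.disjoint.le_bot ⟨hz, hinj hwx ▸ hw⟩
  · ext x
    constructor
    · rintro ((rfl | ⟨z, hz, rfl⟩) | ⟨z, hz, rfl⟩) ⟨w, hw⟩
      · exact hsv _ hw
      · have : z ∈ (range c)ᶜ := h.union_eq ▸ Or.inl hz
        exact this ⟨w, hinj hw⟩
      · have : z ∈ (range c)ᶜ := h.union_eq ▸ Or.inr hz
        exact this ⟨w, hinj hw⟩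
    · intro hx
      by_cases hxv : x = v
      · exact Or.inl (Or.inl hxv)
      · obtain ⟨z, rfl⟩ := hsurj x hxv
        have : z ∈ A ∪ B := by
          rw [h.union_eq]
          rintro ⟨w, rfl⟩
          exact hx ⟨w, rfl⟩
        exact this.imp (fun hz => Or.inr ⟨z, hz, rfl⟩) fun hz => ⟨z, hz, rfl⟩
  · exact fun z t htt => Or.inr ⟨_, h.image_pos z t htt, rfl⟩
  · exact fun z t htt => ⟨_, h.image_neg z t htt, rfl⟩

/-- **Jordan–Schoenflies theorem** for regular `C¹` curves on the sphere: the complement has two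
components, and the closed sides are discs. -/
theorem IsC1JordanCurve.exists_discs {γ : ℝ → ℂ} (h : IsC1JordanCurve γ) {v : StdSphere2}
    (χ : OpenPartialHomeomorph StdSphere2 ℂ) (hχs : χ.source = {v}ᶜ) (hχt : χ.target = univ) :
    ∃ (c : Circle → StdSphere2) (A B : Set StdSphere2), (∀ s, c (Circle.exp s) = χ.symm (γ s)) ∧
      IsOpen A ∧ IsOpen B ∧ IsConnected A ∧ IsConnected B ∧ Disjoint A B ∧
      A ∪ B = (range c)ᶜ ∧
      (∃ p : ℂ → StdSphere2, ContinuousOn p (closedBall 0 1) ∧ InjOn p (closedBall 0 1) ∧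
        p '' closedBall 0 1 = A ∪ range c ∧ ∀ z : Circle, p z = c z) ∧
      ∃ p : ℂ → StdSphere2, ContinuousOn p (closedBall 0 1) ∧ InjOn p (closedBall 0 1) ∧
        p '' closedBall 0 1 = B ∪ range c ∧ ∀ z : Circle, p z = c z := by
  obtain ⟨c₀, F₀, hc₀, hF₀⟩ := h.exists_bicollar
  obtain ⟨A₀, B₀, hA₀, hB₀, hS⟩ := hF₀.exists_sides
  obtain ⟨R₀, hR₀⟩ := (isCompact_range hF₀.continuous_curve).isBounded.subset_closedBall (0 : ℂ)
  have hout : ∀ z, max R₀ 0 < ‖z‖ → z ∈ A₀ ∪ B₀ := by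
    intro z hz
    rw [hS.union_eq]
    intro hzc
    exact absurd (mem_closedBall_zero_iff.1 (hR₀ hzc)) (not_le.2 ((le_max_left _ _).trans_lt hz))
  have main : ∃ (c : Circle → StdSphere2) (F : Circle × ℝ → StdSphere2) (A B : Set StdSphere2),
      (∀ s, c (Circle.exp s) = χ.symm (γ s)) ∧ IsConnected A ∧ IsConnected B ∧
        IsSidedBicollar c F A B := by
    -- The exterior of a large disc is connected, so one side contains it; the orientation of the
    -- bicollar is reversed if this is the second side.
    rcases (isPreconnected_norm_gt (le_max_right R₀ 0)).subset_left_of_disjoint_of_mem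
      hS.isOpen_left hS.isOpen_right hS.disjoint hout with h1 | h1
    · obtain ⟨A, B, hA, hB, hAB⟩ := hS.of_chart χ hχs hχt hA₀ hB₀ (R := max R₀ 0) h1
      exact ⟨_, _, A, B, fun s => by rw [hc₀], hA, hB, hAB⟩
    · obtain ⟨A, B, hA, hB, hAB⟩ := hS.symm.of_chart χ hχs hχt hB₀ hA₀ (R := max R₀ 0) h1
      exact ⟨_, _, A, B, fun s => by rw [hc₀], hA, hB, hAB⟩
  obtain ⟨c, F, A, B, hc, hA, hB, hAB⟩ := main
  exact ⟨c, A, B, hc, hAB.isOpen_left, hAB.isOpen_right, hA, hB, hAB.disjoint, hAB.union_eq,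
    hAB.exists_disc, hAB.symm.exists_disc⟩

end JordanOnSphere

/-! ### `C¹` diffeomorphisms, gluing and extension by reflection -/

section C1Tools

open Topology Filter

/-- A partial homeomorphism which is `C¹` together with its inverse. -/
structure IsC1Diffeo {E F : Type*} [NormedAddCommGroup E] [NormedSpace ℝ E]
    [NormedAddCommGroup F] [NormedSpace ℝ F] (e : OpenPartialHomeomorph E F) : Prop where
  contDiffOn : ContDiffOn ℝ 1 e e.source
  contDiffOn_symm : ContDiffOn ℝ 1 e.symm e.target

namespace IsC1Diffeo

variable {E F G : Type*} [NormedAddCommGroup E] [NormedSpace ℝ E]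
  [NormedAddCommGroup F] [NormedSpace ℝ F] [NormedAddCommGroup G] [NormedSpace ℝ G]

theorem symm {e : OpenPartialHomeomorph E F} (h : IsC1Diffeo e) : IsC1Diffeo e.symm :=
  ⟨h.2, h.1⟩

theorem trans {e : OpenPartialHomeomorph E F} {e' : OpenPartialHomeomorph F G}
    (h : IsC1Diffeo e) (h' : IsC1Diffeo e') : IsC1Diffeo (e.trans e') := by
  constructor
  · refine h'.1.comp (h.1.mono ?_) ?_
    · rw [e.trans_source]; exact inter_subset_left
    · intro x hx; rw [e.trans_source] at hx; exact hx.2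
  · refine h.2.comp (h'.2.mono ?_) ?_
    · rw [e.trans_target]; exact inter_subset_left
    · intro x hx; rw [e.trans_target] at hx; exact hx.2

theorem restrOpen {e : OpenPartialHomeomorph E F} (h : IsC1Diffeo e) {s : Set E}
    (hs : IsOpen s) : IsC1Diffeo (e.restrOpen s hs) := by
  constructor
  · refine h.1.mono ?_
    rw [e.restrOpen_source]; exact inter_subset_left
  · refine h.2.mono ?_
    intro y hy
    have := (e.restrOpen s hs).map_target hy
    rw [e.restrOpen_source] at this
    have h2 := e.map_source this.1
    have h3 := (e.restrOpen s hs).right_inv hy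
    exact h3 ▸ h2

theorem of_continuousLinearEquiv (L : E ≃L[ℝ] F) :
    IsC1Diffeo L.toHomeomorph.toOpenPartialHomeomorph :=
  ⟨L.contDiff.contDiffOn, L.symm.contDiff.contDiffOn⟩

end IsC1Diffeo

/-- The inverse function theorem for `C¹` maps, in the form of a `C¹` partial homeomorphism with
prescribed smallness of the source. -/
theorem exists_isC1Diffeo {E F : Type*} [NormedAddCommGroup E] [NormedSpace ℝ E]
    [CompleteSpace E] [NormedAddCommGroup F] [NormedSpace ℝ F] {f : E → F} {x : E}
    (hf : ContDiffAt ℝ 1 f x) (f' : E ≃L[ℝ] F) (hf' : HasFDerivAt f (f' : E →L[ℝ] F) x)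
    {N : Set E} (hN : N ∈ 𝓝 x) :
    ∃ e : OpenPartialHomeomorph E F, IsC1Diffeo e ∧ x ∈ e.source ∧ e.source ⊆ N ∧
      ∀ y, e y = f y := by
  let e₀ := hf.toOpenPartialHomeomorph f hf' one_ne_zero
  have he₀ : ∀ y, e₀ y = f y := fun y => by rw [ContDiffAt.toOpenPartialHomeomorph_coe]
  have hx₀ : x ∈ e₀.source := hf.mem_toOpenPartialHomeomorph_source hf' one_ne_zero
  have h1 : ∀ᶠ y in 𝓝 x, ContDiffAt ℝ 1 e₀ y := by
    have : ContDiffAt ℝ 1 e₀ x := hf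
    exact this.eventually (by simp)
  have hsymm : ContDiffAt ℝ 1 e₀.symm (e₀ x) :=
    hf.to_localInverse hf' one_ne_zero
  have h2 : ∀ᶠ z in 𝓝 (e₀ x), ContDiffAt ℝ 1 e₀.symm z := hsymm.eventually (by simp)
  have h3 : ∀ᶠ y in 𝓝 x, ContDiffAt ℝ 1 e₀.symm (e₀ y) :=
    (e₀.continuousAt hx₀).eventually h2
  obtain ⟨s, hs, hso, hxs⟩ := _root_.mem_nhds_iff.1 ((h1.and h3).and hN)
  refine ⟨e₀.restrOpen s hso, ⟨?_, ?_⟩, ?_, ?_, he₀⟩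
  · intro y hy
    rw [e₀.restrOpen_source] at hy
    exact (hs hy.2).1.1.contDiffWithinAt
  · intro z hz
    have h4 := (e₀.restrOpen s hso).map_target hz
    rw [e₀.restrOpen_source] at h4
    have h5 := (hs h4.2).1.2
    have h6 : e₀ ((e₀.restrOpen s hso).symm z) = z := (e₀.restrOpen s hso).right_inv hz
    rw [h6] at h5
    exact h5.contDiffWithinAt
  · rw [e₀.restrOpen_source]; exact ⟨hx₀, hxs⟩
  · rw [e₀.restrOpen_source]; exact fun y hy => (hs hy.2).2

/-- Two `C¹` functions on closed sets covering the space, agreeing to first order on the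
intersection, glue to a `C¹` function. -/
theorem contDiffAt_one_of_glue {E F : Type*} [NormedAddCommGroup E] [NormedSpace ℝ E]
    [NormedAddCommGroup F] [NormedSpace ℝ F] {f : E → F} {f' : E → E →L[ℝ] F} {B S O : Set E}
    (hB : IsClosed B) (hS : IsClosed S) (hBS : B ∪ S = univ) (hO : IsOpen O)
    (hcB : ContinuousOn f' (B ∩ O)) (hcS : ContinuousOn f' (S ∩ O))
    (hfB : ∀ x ∈ B ∩ O, HasFDerivWithinAt f (f' x) (B ∩ O) x)
    (hfS : ∀ x ∈ S ∩ O, HasFDerivWithinAt f (f' x) (S ∩ O) x) {x : E} (hx : x ∈ O) :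
    ContDiffAt ℝ 1 f x := by
  have hun : B ∩ O ∪ S ∩ O = O := by
    rw [← union_inter_distrib_right, hBS, univ_inter]
  have hnot : ∀ {K : Set E}, IsClosed K → ∀ {y}, y ∈ O → y ∉ K ∩ O → y ∉ closure (K ∩ O) := by
    intro K hK y hy hyK hcl
    exact hyK ⟨hK.closure_subset (closure_mono inter_subset_left hcl), hy⟩
  rw [contDiffAt_one_iff]
  refine ⟨f', O, hO.mem_nhds hx, ?_, ?_⟩
  · intro y hy
    have h : ∀ K : Set E, IsClosed K → ContinuousOn f' (K ∩ O) →
        ContinuousWithinAt f' (K ∩ O) y := by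
      intro K hK hc
      by_cases hyK : y ∈ K ∩ O
      · exact hc y hyK
      · exact continuousWithinAt_of_notMem_closure (hnot hK hy hyK)
    have := (h B hB hcB).union (h S hS hcS)
    rwa [hun] at this
  · intro y hy
    have h : ∀ K : Set E, IsClosed K →
        (∀ x ∈ K ∩ O, HasFDerivWithinAt f (f' x) (K ∩ O) x) →
        HasFDerivWithinAt f (f' y) (K ∩ O) y := by
      intro K hK hc
      by_cases hyK : y ∈ K ∩ O
      · exact hc y hyK
      · exact HasFDerivWithinAt.of_notMem_closure (hnot hK hy hyK)
    have := (h B hB hfB).union (h S hS hfS)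
    rw [hun] at this
    exact this.hasFDerivAt (hO.mem_nhds hy)

/-- A function which is `C¹` up to the boundary of the unit ball extends, by reflection, to a
function which is `C¹` near a given point of the unit sphere. -/
theorem exists_contDiffAt_extension_of_closedBall {E F : Type*} [NormedAddCommGroup E]
    [InnerProductSpace ℝ E] [NormedAddCommGroup F] [NormedSpace ℝ F] {g : E → F} {p : E}
    (hp : ‖p‖ = 1) {O : Set E} (hO : IsOpen O) (hpO : p ∈ O)
    (hg : ContDiffOn ℝ 1 g (closedBall 0 1 ∩ O)) :
    ∃ φ : E → F, ContDiffAt ℝ 1 φ p ∧ (∀ u ∈ closedBall (0 : E) 1, φ u = g u) ∧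
      ∀ u, 1 < ‖u‖ → φ u = (2 : ℝ) • g (‖u‖⁻¹ • u) - g ((2 : ℝ) • (‖u‖⁻¹ • u) - u) := by
  classical
  -- `π` is the radial projection to the sphere and `ρ` the reflection in it along the ray. Outside
  -- the ball the extension is `2 • g ∘ π - g ∘ ρ`.
  set π : E → E := fun u => ‖u‖⁻¹ • u with hπ
  set ρ : E → E := fun u => (2 : ℝ) • π u - u with hρ
  let φ : E → F := fun u => if u ∈ closedBall (0 : E) 1 then g u else (2 : ℝ) • g (π u) - g (ρ u)
  have hπd : ∀ u : E, u ≠ 0 → ContDiffAt ℝ 1 π u := fun u hu =>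
    ((contDiffAt_norm ℝ hu).inv (norm_ne_zero_iff.2 hu)).smul contDiffAt_id
  have hπ1 : ∀ u : E, ‖u‖ = 1 → π u = u := fun u hu => by simp [hπ, hu]
  have hρ1 : ∀ u : E, ‖u‖ = 1 → ρ u = u := fun u hu => by
    simp only [hρ, hπ1 u hu, two_smul, add_sub_cancel_right]
  have hπn : ∀ u : E, u ≠ 0 → ‖π u‖ = 1 := fun u hu => by
    rw [hπ]; simp [norm_smul, inv_mul_cancel₀ (norm_ne_zero_iff.2 hu)]
  -- The reflected point has norm `|2 - ‖u‖|`; this is the source of the bound `3`.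
  have hρn : ∀ u : E, 1 ≤ ‖u‖ → ‖u‖ ≤ 3 → ‖ρ u‖ ≤ 1 := fun u hu hu3 => by
    have hne : ‖u‖ ≠ 0 := by linarith
    have : ρ u = (2 * ‖u‖⁻¹ - 1) • u := by
      simp only [hρ, hπ, sub_smul, one_smul, mul_smul]
    rw [this, norm_smul, Real.norm_eq_abs, ← abs_of_nonneg (norm_nonneg u), ← abs_mul,
      abs_of_nonneg (norm_nonneg u), sub_mul, mul_assoc, inv_mul_cancel₀ hne, abs_le]
    constructor <;> linarith
  have hp0 : p ≠ 0 := by rintro rfl; simp at hp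
  have hcπ : ContinuousAt π p := (hπd p hp0).continuousAt
  have hcρ : ContinuousAt ρ p := (hcπ.const_smul _).sub continuousAt_id
  have hev : ∀ᶠ u in 𝓝 p, ((u ∈ O ∧ π u ∈ O) ∧ ρ u ∈ O) ∧ ‖u‖ ∈ Ioo (0 : ℝ) 3 := by
    refine ((Filter.Eventually.and (hO.mem_nhds hpO) (hcπ.eventually_mem ?_)).and
      (hcρ.eventually_mem ?_)).and (continuous_norm.continuousAt.eventually_mem ?_)
    · rw [hπ1 p hp]; exact hO.mem_nhds hpO
    · rw [hρ1 p hp]; exact hO.mem_nhds hpO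
    · rw [hp]; exact Ioo_mem_nhds (by norm_num) (by norm_num)
  obtain ⟨Q, hQ, hQo, hpQ⟩ := _root_.mem_nhds_iff.1 hev
  set B : Set E := closedBall 0 1
  set S : Set E := {u | 1 ≤ ‖u‖}
  have hBO : UniqueDiffOn ℝ (B ∩ O) := by
    refine UniqueDiffOn.inter (uniqueDiffOn_convex (convex_closedBall 0 1) ?_) hO
    exact ⟨0, ball_subset_interior_closedBall (by simp)⟩
  set Dg : E → E →L[ℝ] F := fderivWithin ℝ g (B ∩ O)
  have hDg : ∀ u ∈ B ∩ O, HasFDerivWithinAt g (Dg u) (B ∩ O) u := fun u hu =>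
    (hg.differentiableOn one_ne_zero u hu).hasFDerivWithinAt
  have hDgc : ContinuousOn Dg (B ∩ O) := hg.continuousOn_fderivWithin hBO le_rfl
  -- On the sphere the derivatives of `π` cancel, leaving `Dg`; so the two pieces agree to first
  -- order there.
  let φS : E → E →L[ℝ] F := fun u =>
    (2 : ℝ) • (Dg (π u)).comp (fderiv ℝ π u) -
      (Dg (ρ u)).comp ((2 : ℝ) • fderiv ℝ π u - ContinuousLinearMap.id ℝ E)
  let φ' : E → E →L[ℝ] F := fun u => if u ∈ B then Dg u else φS u
  have hBmem : ∀ u, u ∈ B ↔ ‖u‖ ≤ 1 := fun u => mem_closedBall_zero_iff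
  have hSeq : ∀ u ∈ S, φ' u = φS u := by
    intro u hu
    by_cases hB : u ∈ B
    · have h1 : ‖u‖ = 1 := le_antisymm ((hBmem u).1 hB) hu
      simp only [φ', if_pos hB, φS, hπ1 u h1, hρ1 u h1]
      ext w
      simp
    · simp only [φ', if_neg hB]
  have hSeqφ : ∀ u ∈ S, φ u = (2 : ℝ) • g (π u) - g (ρ u) := by
    intro u hu
    by_cases hB : u ∈ B
    · have h1 : ‖u‖ = 1 := le_antisymm ((hBmem u).1 hB) hu
      simp only [φ, B] at hB ⊢
      rw [if_pos hB, hπ1 u h1, hρ1 u h1, two_smul, add_sub_cancel_right]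
    · simp only [φ, B] at hB ⊢
      rw [if_neg hB]
  have hne : ∀ u ∈ S, u ≠ 0 := by
    rintro u hu rfl
    simp only [S, mem_ofPred_eq, norm_zero] at hu
    linarith
  have hmapπ : MapsTo π (S ∩ Q) (B ∩ O) := fun u hu =>
    ⟨(hBmem _).2 (hπn u (hne u hu.1)).le, (hQ hu.2).1.1.2⟩
  have hmapρ : MapsTo ρ (S ∩ Q) (B ∩ O) := fun u hu =>
    ⟨(hBmem _).2 (hρn u hu.1 (hQ hu.2).2.2.le), (hQ hu.2).1.2⟩
  have hQO : Q ⊆ O := fun u hu => (hQ hu).1.1.1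
  have hQ0 : ∀ u ∈ Q, u ≠ 0 := by
    rintro u hu rfl
    have := (hQ hu).2.1
    simp at this
  refine ⟨φ, ?_, fun u hu => if_pos hu, fun u hu => if_neg fun h => ?_⟩
  · refine contDiffAt_one_of_glue (f' := φ') (B := B) (S := S) (O := Q) isClosed_closedBall
      (isClosed_le continuous_const continuous_norm) ?_ hQo ?_ ?_ ?_ ?_ hpQ
    · refine eq_univ_of_forall fun u => ?_
      rcases le_total ‖u‖ 1 with h | h
      · exact Or.inl ((hBmem u).2 h)
      · exact Or.inr h
    · exact (hDgc.mono (inter_subset_inter_right _ hQO)).congr fun u hu => if_pos hu.1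
    · have hcπ' : ContinuousOn (fderiv ℝ π) Q :=
        ContDiffOn.continuousOn_fderiv_of_isOpen
          (fun u hu => (hπd u (hQ0 u hu)).contDiffWithinAt) hQo le_rfl
      have hcπQ : ContinuousOn π Q := fun u hu => (hπd u (hQ0 u hu)).continuousAt.continuousWithinAt
      have hcρQ : ContinuousOn ρ Q := (hcπQ.const_smul _).sub continuousOn_id
      refine ContinuousOn.congr (f := φS) ?_ fun u hu => hSeq u hu.1
      have hcπ₂ := hcπ'.mono (inter_subset_right : S ∩ Q ⊆ Q)
      have h1 : ContinuousOn (fun u => (Dg (π u)).comp (fderiv ℝ π u)) (S ∩ Q) :=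
        (hDgc.comp (hcπQ.mono inter_subset_right) hmapπ).clm_comp hcπ₂
      have h2 : ContinuousOn (fun u => (2 : ℝ) • fderiv ℝ π u - ContinuousLinearMap.id ℝ E)
          (S ∩ Q) := (hcπ₂.const_smul (2 : ℝ)).sub continuousOn_const
      have h3 : ContinuousOn (fun u => (Dg (ρ u)).comp
          ((2 : ℝ) • fderiv ℝ π u - ContinuousLinearMap.id ℝ E)) (S ∩ Q) :=
        (hDgc.comp (hcρQ.mono inter_subset_right) hmapρ).clm_comp h2
      exact (h1.const_smul (2 : ℝ)).sub h3
    · intro u hu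
      have h := (hDg u ⟨hu.1, hQO hu.2⟩).mono (inter_subset_inter_right B hQO)
      have h' : φ' u = Dg u := if_pos hu.1
      rw [h']
      exact h.congr (fun v hv => if_pos hv.1) (if_pos hu.1)
    · intro u hu
      rw [hSeq u hu.1]
      have hd : HasFDerivWithinAt π (fderiv ℝ π u) (S ∩ Q) u :=
        ((hπd u (hQ0 u hu.2)).differentiableAt one_ne_zero).hasFDerivAt.hasFDerivWithinAt
      have hdρ : HasFDerivWithinAt ρ ((2 : ℝ) • fderiv ℝ π u - ContinuousLinearMap.id ℝ E)
          (S ∩ Q) u := (hd.const_smul (2 : ℝ)).sub (hasFDerivWithinAt_id u _)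
      have h1 := ((hDg _ (hmapπ hu)).comp u hd hmapπ).const_smul (2 : ℝ)
      have h2 := (hDg _ (hmapρ hu)).comp u hdρ hmapρ
      have h3 : HasFDerivWithinAt (fun v => (2 : ℝ) • g (π v) - g (ρ v)) (φS u) (S ∩ Q) u :=
        h1.sub h2
      exact h3.congr (fun v hv => hSeqφ v hv.1) (hSeqφ u hu.1)
  · exact absurd ((hBmem u).1 h) (not_le.2 hu)

end C1Tools

/-! ### Straightening a surface patch together with a function on it -/

section Straightening

open Topology Filter

/-- The inverse function theorem in finite dimension, for maps of injective derivative between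
spaces of the same dimension. -/
theorem exists_isC1Diffeo_of_injective {E F : Type*} [NormedAddCommGroup E] [NormedSpace ℝ E]
    [FiniteDimensional ℝ E] [NormedAddCommGroup F] [NormedSpace ℝ F] [FiniteDimensional ℝ F]
    (hdim : Module.finrank ℝ E = Module.finrank ℝ F) {f : E → F} {x : E}
    (hf : ContDiffAt ℝ 1 f x) (hinj : Function.Injective (fderiv ℝ f x))
    {N : Set E} (hN : N ∈ 𝓝 x) :
    ∃ e : OpenPartialHomeomorph E F, IsC1Diffeo e ∧ x ∈ e.source ∧ e.source ⊆ N ∧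
      ∀ y, e y = f y := by
  have := FiniteDimensional.complete ℝ E
  let L : E ≃L[ℝ] F := (LinearMap.linearEquivOfInjective
    (fderiv ℝ f x : E →ₗ[ℝ] F) hinj hdim).toContinuousLinearEquiv
  refine exists_isC1Diffeo hf L ?_ hN
  have h : (L : E →L[ℝ] F) = fderiv ℝ f x := by
    ext v
    rfl
  rw [h]
  exact (hf.differentiableAt one_ne_zero).hasFDerivAt

/-- A surface patch `φ` in `ℝ³` with a transverse vector `n` and a function `h` without critical
point on the patch: there are local coordinates of `ℝ³` whose first coordinate is the height in
the direction `n` over the patch, and whose second coordinate is `h`. -/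
theorem exists_straightening {φ : Euc 2 → Euc 3} {p : Euc 2} (hφ : ContDiffAt ℝ 1 φ p)
    (hinj : Function.Injective (fderiv ℝ φ p)) {n : Euc 3}
    (hn : ∀ v, fderiv ℝ φ p v ≠ n) {h : Euc 2 → ℝ}
    (hh : ContDiffAt ℝ 1 h p) (hh' : fderiv ℝ h p ≠ 0) {N : Set (Euc 2)} (hN : N ∈ 𝓝 p) :
    ∃ (Φ : OpenPartialHomeomorph (Euc 2 × ℝ) (Euc 3)) (G : OpenPartialHomeomorph (Euc 3) (Euc 3)),
      (p, (0 : ℝ)) ∈ Φ.source ∧ (∀ q ∈ Φ.source, q.1 ∈ N) ∧ (∀ q, Φ q = φ q.1 + q.2 • n) ∧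
      IsC1Diffeo G ∧ φ p ∈ G.source ∧ G.source ⊆ Φ.target ∧
      ∀ q ∈ Φ.source, G (Φ q) 0 = q.2 ∧ G (Φ q) 1 = h q.1 ∧ 0 < G (Φ q) 2 := by
  set a := fderiv ℝ h p (EuclideanSpace.single 0 1) with ha
  set b := fderiv ℝ h p (EuclideanSpace.single 1 1) with hb
  have hexp : ∀ v : Euc 2, fderiv ℝ h p v = v 0 * a + v 1 * b := by
    intro v
    have : v = v 0 • EuclideanSpace.single 0 (1 : ℝ) + v 1 • EuclideanSpace.single 1 (1 : ℝ) := by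
      ext i; fin_cases i <;> simp
    conv_lhs => rw [this]
    simp [ha, hb]
  have hab : a * a + b * b ≠ 0 := by
    intro hz
    have h1 : a = 0 := by nlinarith [mul_self_nonneg a, mul_self_nonneg b]
    have h2 : b = 0 := by nlinarith [mul_self_nonneg a, mul_self_nonneg b]
    exact hh' (by ext v; rw [hexp, h1, h2]; simp)
  -- The differential of `h` rotated by a right angle, so that `h` and `ℓ` are local coordinates of
  -- the plane at `p`.
  let ℓ : Euc 2 →L[ℝ] ℝ := a • (EuclideanSpace.proj 1 : Euc 2 →L[ℝ] ℝ) -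
    b • (EuclideanSpace.proj 0 : Euc 2 →L[ℝ] ℝ)
  have hℓ : ∀ v, ℓ v = a * v 1 - b * v 0 := fun v => by simp [ℓ]
  have hker : ∀ v : Euc 2, fderiv ℝ h p v = 0 → ℓ v = 0 → v = 0 := by
    intro v h1 h2
    rw [hexp] at h1
    rw [hℓ] at h2
    have h3 : (a * a + b * b) * v 0 = 0 := by linear_combination a * h1 - b * h2
    have h4 : (a * a + b * b) * v 1 = 0 := by linear_combination b * h1 + a * h2
    ext i
    fin_cases i
    · exact (mul_eq_zero.1 h3).resolve_left hab
    · exact (mul_eq_zero.1 h4).resolve_left hab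
  have hdim : Module.finrank ℝ (Euc 2 × ℝ) = Module.finrank ℝ (Euc 3) := by simp
  let F : Euc 2 × ℝ → Euc 3 := fun q => φ q.1 + q.2 • n
  have hφ' : HasFDerivAt φ (fderiv ℝ φ p) p := (hφ.differentiableAt one_ne_zero).hasFDerivAt
  have hhd : HasFDerivAt h (fderiv ℝ h p) p := (hh.differentiableAt one_ne_zero).hasFDerivAt
  have hfst : HasFDerivAt (Prod.fst : Euc 2 × ℝ → Euc 2) (ContinuousLinearMap.fst ℝ (Euc 2) ℝ)
    (p, (0 : ℝ)) := hasFDerivAt_fst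
  have hFd : ContDiffAt ℝ 1 F (p, (0 : ℝ)) :=
    (ContDiffAt.comp (p, (0 : ℝ)) hφ contDiffAt_fst).add (contDiffAt_snd.smul contDiffAt_const)
  have hF' : HasFDerivAt F ((fderiv ℝ φ p).comp (ContinuousLinearMap.fst ℝ (Euc 2) ℝ) +
      (ContinuousLinearMap.snd ℝ (Euc 2) ℝ).smulRight n) (p, (0 : ℝ)) :=
    (HasFDerivAt.comp (p, (0 : ℝ)) hφ' hfst).add
      (hasFDerivAt_snd.smul_const n)
  have hFinj : Function.Injective (fderiv ℝ F (p, (0 : ℝ))) := by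
    rw [hF'.fderiv, injective_iff_map_eq_zero]
    rintro ⟨v, t⟩ hvt
    simp only [add_apply, ContinuousLinearMap.comp_apply,
      ContinuousLinearMap.coe_fst', ContinuousLinearMap.smulRight_apply,
      ContinuousLinearMap.coe_snd'] at hvt
    have ht : t = 0 := by
      by_contra ht
      apply hn (-(t⁻¹ • v))
      rw [map_neg, map_smul, eq_neg_of_add_eq_zero_left hvt, smul_neg, neg_neg, smul_smul,
        inv_mul_cancel₀ ht, one_smul]
    subst ht
    rw [zero_smul, add_zero] at hvt
    rw [(injective_iff_map_eq_zero _).1 hinj v hvt]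
    rfl
  -- The final coordinates are `H ∘ Φ⁻¹`. The constant `1` keeps the third coordinate positive near
  -- `p`, so that it imposes no condition in the quadrant.
  let H : Euc 2 × ℝ → Euc 3 := fun q => !₂[q.2, h q.1, 1 + ℓ (q.1 - p)]
  have hHd : ContDiffAt ℝ 1 H (p, (0 : ℝ)) := by
    rw [contDiffAt_euclidean]
    intro i
    fin_cases i
    · exact contDiffAt_snd
    · exact ContDiffAt.comp (p, (0 : ℝ)) hh contDiffAt_fst
    · exact contDiffAt_const.add (ℓ.contDiff.contDiffAt.comp (p, (0 : ℝ))
        (contDiffAt_fst.sub contDiffAt_const))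
  have hHinj : Function.Injective (fderiv ℝ H (p, (0 : ℝ))) := by
    have hH' : ∀ i : Fin 3, HasFDerivAt (fun q => H q i)
        ((EuclideanSpace.proj i : Euc 3 →L[ℝ] ℝ).comp (fderiv ℝ H (p, (0 : ℝ)))) (p, (0 : ℝ)) :=
      fun i => (EuclideanSpace.proj i : Euc 3 →L[ℝ] ℝ).hasFDerivAt.comp (p, (0 : ℝ))
        (hHd.differentiableAt one_ne_zero).hasFDerivAt
    have h0 := (hH' 0).unique (hasFDerivAt_snd : HasFDerivAt (fun q : Euc 2 × ℝ => q.2) _ _)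
    have h1 := (hH' 1).unique (HasFDerivAt.comp (p, (0 : ℝ)) hhd hfst)
    have h2 := (hH' 2).unique ((HasFDerivAt.comp (p, (0 : ℝ)) (ℓ.hasFDerivAt (x := p - p))
      (hfst.sub_const p)).const_add 1)
    rw [injective_iff_map_eq_zero]
    rintro ⟨v, t⟩ hvt
    have e0 := DFunLike.congr_fun h0 (v, t)
    have e1 := DFunLike.congr_fun h1 (v, t)
    have e2 := DFunLike.congr_fun h2 (v, t)
    simp only [ContinuousLinearMap.comp_apply, hvt, map_zero, ContinuousLinearMap.coe_fst',
      ContinuousLinearMap.coe_snd'] at e0 e1 e2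
    rw [hker v e1.symm e2.symm, ← e0]
    rfl
  have hpos : ∀ᶠ q : Euc 2 × ℝ in 𝓝 (p, (0 : ℝ)), 0 < 1 + ℓ (q.1 - p) := by
    have hc : Continuous fun q : Euc 2 × ℝ => 1 + ℓ (q.1 - p) := by fun_prop
    refine hc.continuousAt.eventually_mem (Ioi_mem_nhds ?_)
    simp
  have hN' : {q : Euc 2 × ℝ | q.1 ∈ N} ∈ 𝓝 (p, (0 : ℝ)) := continuousAt_fst hN
  obtain ⟨Ψ, hΨ, hpΨ, hΨs, hΨe⟩ := exists_isC1Diffeo_of_injective hdim hHd hHinj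
    (Filter.inter_mem hpos hN')
  obtain ⟨Φ, hΦ, hpΦ, hΦs, hΦe⟩ := exists_isC1Diffeo_of_injective hdim hFd hFinj
    (Ψ.open_source.mem_nhds hpΨ)
  have hΦp : Φ (p, 0) = φ p := by rw [hΦe]; simp [F]
  refine ⟨Φ, Φ.symm.trans Ψ, hpΦ, fun q hq => (hΨs (hΦs hq)).2, hΦe, hΦ.symm.trans hΨ, ?_, ?_, ?_⟩
  · rw [OpenPartialHomeomorph.trans_source]
    refine ⟨hΦp ▸ Φ.map_source hpΦ, ?_⟩
    rw [mem_preimage, ← hΦp, Φ.left_inv hpΦ]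
    exact hpΨ
  · rw [OpenPartialHomeomorph.trans_source]
    exact inter_subset_left
  · intro q hq
    have : (Φ.symm.trans Ψ) (Φ q) = H q := by
      rw [OpenPartialHomeomorph.trans_apply, Φ.left_inv hq, hΨe]
    rw [this]
    exact ⟨rfl, rfl, (hΨs (hΦs hq)).1⟩

end Straightening

/-! ### Disc and boundary in the charts of the manifold -/

section LocalStructure

open Topology Filter

/-- An injective continuous map on a compact set reflects neighbourhoods. -/
theorem exists_mem_nhds_forall_of_injOn {X Y : Type*} [TopologicalSpace X] [TopologicalSpace Y]
    [T2Space Y] {K : Set X} (hK : IsCompact K) {f : X → Y} (hf : ContinuousOn f K)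
    (hinj : InjOn f K) {p : X} (hp : p ∈ K) {N : Set X} (hN : N ∈ 𝓝 p) :
    ∃ O ∈ 𝓝 (f p), ∀ u ∈ K, f u ∈ O → u ∈ N := by
  have hc : IsCompact (f '' (K \ interior N)) :=
    (hK.diff isOpen_interior).image_of_continuousOn (hf.mono sdiff_subset)
  refine ⟨(f '' (K \ interior N))ᶜ, hc.isClosed.isOpen_compl.mem_nhds ?_, ?_⟩
  · rintro ⟨u, hu, hup⟩
    rw [hinj hu.1 hp hup] at hu
    exact hu.2 (mem_interior_iff_mem_nhds.2 hN)
  · intro u hu hfu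
    by_contra h
    exact hfu ⟨u, ⟨hu, fun h' => h (interior_subset h')⟩, rfl⟩

variable {M : Type*} [TopologicalSpace M] [ChartedSpace (EuclideanHalfSpace 3) M]

theorem mem_range_modelHalfSpace (y : Euc 3) : y ∈ range (𝓡∂ 3) ↔ 0 ≤ y 0 := by
  rw [range_modelWithCornersEuclideanHalfSpace]
  rfl

theorem nonneg_of_mem_extChartAt_target {x : M} {y : Euc 3}
    (hy : y ∈ (extChartAt (𝓡∂ 3) x).target) : 0 ≤ y 0 :=
  (mem_range_modelHalfSpace y).1 (extChartAt_target_subset_range x hy)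

theorem nonneg_extChartAt {x z : M} (hz : z ∈ (extChartAt (𝓡∂ 3) x).source) :
    0 ≤ extChartAt (𝓡∂ 3) x z 0 :=
  nonneg_of_mem_extChartAt_target ((extChartAt (𝓡∂ 3) x).map_source hz)

/-- Interior points are recognised in any preferred chart. -/
theorem mem_interior_iff_extChartAt [IsManifold (𝓡∂ 3) 1 M] {x z : M}
    (hz : z ∈ (extChartAt (𝓡∂ 3) x).source) :
    z ∈ (𝓡∂ 3).interior M ↔ 0 < extChartAt (𝓡∂ 3) x z 0 := by
  have hz' : z ∈ (chartAt (EuclideanHalfSpace 3) x).source := by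
    rwa [extChartAt_source] at hz
  have h := ModelWithCorners.isInteriorPoint_iff_of_mem_atlas (I := 𝓡∂ 3) (n := 1) one_ne_zero
    (chart_mem_atlas (EuclideanHalfSpace 3) x) hz'
  have h' : 0 < extChartAt (𝓡∂ 3) x z 0 ↔ extChartAt (𝓡∂ 3) x z ∈ interior (range (𝓡∂ 3)) := by
    rw [interior_range_modelWithCornersEuclideanHalfSpace]
    rfl
  rw [h']
  refine h.trans ⟨fun h1 => OpenPartialHomeomorph.interior_extend_target_subset_interior_range _ h1,
    fun h1 => OpenPartialHomeomorph.mem_interior_extend_target _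
      ((chartAt (EuclideanHalfSpace 3) x).map_source hz') h1⟩

/-- Points of the boundary are recognised in any preferred chart. -/
theorem mem_boundary_iff_extChartAt [IsManifold (𝓡∂ 3) 1 M] {x z : M}
    (hz : z ∈ (extChartAt (𝓡∂ 3) x).source) :
    z ∈ (𝓡∂ 3).boundary M ↔ extChartAt (𝓡∂ 3) x z 0 = 0 := by
  rw [← ModelWithCorners.compl_interior, mem_compl_iff, mem_interior_iff_extChartAt hz, not_lt]
  exact ⟨fun h => le_antisymm h (nonneg_extChartAt hz), fun h => h.le⟩

/-- Near a point of the chart, the half-space is contained in the target. -/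
theorem exists_isOpen_extChartAt_symm_mem (x : M) {O : Set M} (hO : O ∈ 𝓝 x) :
    ∃ W : Set (Euc 3), IsOpen W ∧ extChartAt (𝓡∂ 3) x x ∈ W ∧
      ∀ y ∈ W, 0 ≤ y 0 → y ∈ (extChartAt (𝓡∂ 3) x).target ∧ (extChartAt (𝓡∂ 3) x).symm y ∈ O := by
  have h1 := extChartAt_target_mem_nhdsWithin (I := 𝓡∂ 3) x
  have h2 : ContinuousWithinAt (extChartAt (𝓡∂ 3) x).symm (range (𝓡∂ 3)) (extChartAt (𝓡∂ 3) x x) :=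
    (continuousAt_extChartAt_symm x).continuousWithinAt
  have h3 : (extChartAt (𝓡∂ 3) x).symm ⁻¹' O ∈ 𝓝[range (𝓡∂ 3)] (extChartAt (𝓡∂ 3) x x) := by
    apply h2
    rwa [extChartAt_to_inv]
  obtain ⟨W, hW, hxW, hWs⟩ := mem_nhdsWithin.1 (Filter.inter_mem h1 h3)
  exact ⟨W, hW, hxW, fun y hy hy0 => hWs ⟨hy, (mem_range_modelHalfSpace y).2 hy0⟩⟩

/-- The disc read in the preferred chart at the image of a point. -/
theorem exists_contDiffOn_extChartAt_comp [IsManifold (𝓡∂ 3) 1 M] {f : Euc 2 → M}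
    (hf : ContMDiffOn (𝓡 2) (𝓡∂ 3) 1 f (closedBall 0 1)) {p : Euc 2}
    (hp : p ∈ closedBall (0 : Euc 2) 1) :
    (∃ O : Set (Euc 2), IsOpen O ∧ p ∈ O ∧
      (∀ u ∈ closedBall 0 1 ∩ O, f u ∈ (extChartAt (𝓡∂ 3) (f p)).source) ∧
      ContDiffOn ℝ 1 (fun u => extChartAt (𝓡∂ 3) (f p) (f u)) (closedBall 0 1 ∩ O)) ∧
    ∀ v, fderivWithin ℝ (fun u => extChartAt (𝓡∂ 3) (f p) (f u)) (closedBall 0 1) p v =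
      mfderivWithin (𝓡 2) (𝓡∂ 3) f (closedBall 0 1) p v := by
  constructor
  · obtain ⟨O, hO, hOe⟩ := (continuousOn_iff'.1 hf.continuousOn)
      (extChartAt (𝓡∂ 3) (f p)).source (isOpen_extChartAt_source (f p))
    have hpO : p ∈ O := (hOe ▸ (⟨mem_extChartAt_source (f p), hp⟩ :
      p ∈ f ⁻¹' (extChartAt (𝓡∂ 3) (f p)).source ∩ closedBall 0 1) :
        p ∈ O ∩ closedBall 0 1).1
    have hsrc : ∀ u ∈ closedBall 0 1 ∩ O, f u ∈ (extChartAt (𝓡∂ 3) (f p)).source := fun u hu =>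
      (hOe.symm ▸ (⟨hu.2, hu.1⟩ : u ∈ O ∩ closedBall 0 1) :
        u ∈ f ⁻¹' (extChartAt (𝓡∂ 3) (f p)).source ∩ closedBall 0 1).1
    refine ⟨O, hO, hpO, hsrc, ?_⟩
    rw [← contMDiffOn_iff_contDiffOn]
    have h := contMDiffOn_extChartAt (I := 𝓡∂ 3) (n := 1) (x := f p)
    rw [← extChartAt_source (I := 𝓡∂ 3)] at h
    exact h.comp (hf.mono inter_subset_left) hsrc
  · intro v
    have hmd : MDifferentiableWithinAt (𝓡 2) (𝓡∂ 3) f (closedBall 0 1) p :=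
      (hf p hp).mdifferentiableWithinAt one_ne_zero
    have h := hmd.mfderivWithin
    simp only [mfld_simps, writtenInExtChartAt] at h
    rw [h]
    rfl

/-- `G` is a `C¹` change of coordinates of the preferred chart of `M` at `x`, after which the
boundary of `M` is given by the vanishing of the coordinate `1` and `D` by the vanishing of the
coordinate `0`; the corresponding neighbourhood of `x` is contained in `O`. -/
structure IsStraightening (D : Set M) (x : M) (O : Set M)
    (G : OpenPartialHomeomorph (Euc 3) (Euc 3)) : Prop where
  isC1Diffeo : IsC1Diffeo G
  mem_source : extChartAt (𝓡∂ 3) x x ∈ G.source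
  mem_target : ∀ y ∈ G.source, 0 ≤ y 0 → y ∈ (extChartAt (𝓡∂ 3) x).target
  symm_mem : ∀ y ∈ G.source, 0 ≤ y 0 → (extChartAt (𝓡∂ 3) x).symm y ∈ O
  nonneg_iff : ∀ y ∈ G.source, 0 ≤ y 0 ↔ 0 ≤ G y 1
  zero_iff : ∀ y ∈ G.source, y 0 = 0 ↔ G y 1 = 0
  pos : ∀ y ∈ G.source, 0 < G y 2
  mem_iff : ∀ y ∈ G.source, 0 ≤ y 0 → ((extChartAt (𝓡∂ 3) x).symm y ∈ D ↔ G y 0 = 0)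

/-- The common end of the interior and boundary cases. The height over the patch detects `D`, and by
`hW` the function `h` detects the half-space; what remains is to shrink the neighbourhood so that no
other part of the disc enters it. -/
theorem exists_isStraightening_of_patch [T2Space M] {f : Euc 2 → M}
    (hf : ContinuousOn f (closedBall 0 1)) (hinj : InjOn f (closedBall 0 1))
    {p : Euc 2} (hp : p ∈ closedBall (0 : Euc 2) 1)
    {φ : Euc 2 → Euc 3} {n : Euc 3} {h : Euc 2 → ℝ} {N : Set (Euc 2)}
    (hloc : ∀ u ∈ closedBall (0 : Euc 2) 1, u ∈ N → f u ∈ (extChartAt (𝓡∂ 3) (f p)).source ∧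
      φ u = extChartAt (𝓡∂ 3) (f p) (f u))
    {Φ : OpenPartialHomeomorph (Euc 2 × ℝ) (Euc 3)} {G : OpenPartialHomeomorph (Euc 3) (Euc 3)}
    (hpΦ : (p, (0 : ℝ)) ∈ Φ.source) (hΦN : ∀ q ∈ Φ.source, q.1 ∈ N)
    (hΦ : ∀ q, Φ q = φ q.1 + q.2 • n) (hG : IsC1Diffeo G) (hpG : φ p ∈ G.source)
    (hGΦ : G.source ⊆ Φ.target)
    (hGe : ∀ q ∈ Φ.source, G (Φ q) 0 = q.2 ∧ G (Φ q) 1 = h q.1 ∧ 0 < G (Φ q) 2)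
    {W : Set (Euc 3)} (hWo : IsOpen W) (hpW : φ p ∈ W)
    (hW : ∀ q ∈ Φ.source, Φ q ∈ W → (0 ≤ Φ q 0 ↔ 0 ≤ h q.1) ∧ (Φ q 0 = 0 ↔ h q.1 = 0) ∧
      (0 ≤ Φ q 0 → q.2 = 0 → q.1 ∈ closedBall (0 : Euc 2) 1))
    {O : Set M} (hO : O ∈ 𝓝 (f p)) :
    ∃ G : OpenPartialHomeomorph (Euc 3) (Euc 3), IsStraightening (f '' closedBall 0 1) (f p) O G := by
  have hpe : φ p = extChartAt (𝓡∂ 3) (f p) (f p) := (hloc p hp (hΦN _ hpΦ)).2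
  have hN1 : {u : Euc 2 | (u, (0 : ℝ)) ∈ Φ.source} ∈ 𝓝 p := by
    have : ContinuousAt (fun u : Euc 2 => (u, (0 : ℝ))) p := by fun_prop
    exact this (Φ.open_source.mem_nhds hpΦ)
  -- Points of the disc close to `f p` have parameters close to `p`, by injectivity and compactness.
  obtain ⟨O₁, hO₁, hO₁e⟩ := exists_mem_nhds_forall_of_injOn (isCompact_closedBall 0 1) hf hinj hp hN1
  obtain ⟨W₁, hW₁, hpW₁, hW₁e⟩ := exists_isOpen_extChartAt_symm_mem (f p) (Filter.inter_mem hO hO₁)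
  have hsrc : (G.restrOpen (W ∩ W₁) (hWo.inter hW₁)).source = G.source ∩ (W ∩ W₁) :=
    G.restrOpen_source _ _
  refine ⟨G.restrOpen (W ∩ W₁) (hWo.inter hW₁), hG.restrOpen _, ?_, ?_, ?_, ?_, ?_, ?_, ?_⟩
  · rw [hsrc, ← hpe]
    exact ⟨hpG, hpW, hpe ▸ hpW₁⟩
  · intro y hy hy0
    rw [hsrc] at hy
    exact (hW₁e y hy.2.2 hy0).1
  · intro y hy hy0
    rw [hsrc] at hy
    exact (hW₁e y hy.2.2 hy0).2.1
  all_goals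
    intro y hy
    rw [hsrc] at hy
    obtain ⟨q, hq, rfl⟩ : ∃ q ∈ Φ.source, Φ q = y :=
      ⟨Φ.symm y, Φ.map_target (hGΦ hy.1), Φ.right_inv (hGΦ hy.1)⟩
    obtain ⟨e0, e1, e2⟩ := hGe q hq
    obtain ⟨w0, w1, w2⟩ := hW q hq hy.2.1
  · change _ ↔ 0 ≤ G (Φ q) 1
    rw [e1]; exact w0
  · change _ ↔ G (Φ q) 1 = 0
    rw [e1]; exact w1
  · exact e2
  · intro hy0
    change _ ↔ G (Φ q) 0 = 0
    rw [e0]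
    obtain ⟨ht, hs⟩ := hW₁e _ hy.2.2 hy0
    constructor
    · rintro ⟨u, hu, hue⟩
      have hu1 : (u, (0 : ℝ)) ∈ Φ.source := hO₁e u hu (hue ▸ hs.2)
      have h1 : Φ (u, 0) = Φ q := by
        rw [hΦ (u, 0), zero_smul, add_zero, (hloc u hu (hΦN _ hu1)).2, hue,
          (extChartAt (𝓡∂ 3) (f p)).right_inv ht]
      rw [← Φ.injOn hu1 hq h1]
    · intro hq2
      have hq1 := w2 hy0 hq2
      obtain ⟨h1, h2⟩ := hloc _ hq1 (hΦN _ hq)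
      refine ⟨q.1, hq1, ?_⟩
      rw [hΦ q, hq2, zero_smul, add_zero, h2, (extChartAt (𝓡∂ 3) (f p)).left_inv h1]

end LocalStructure

/-! ### Straightening at interior and boundary points of the disc -/

section LocalStructure

open Topology Filter

variable {M : Type*} [TopologicalSpace M] [ChartedSpace (EuclideanHalfSpace 3) M]

theorem exists_notMem_range_of_finrank_lt {E F : Type*} [AddCommGroup E] [Module ℝ E]
    [FiniteDimensional ℝ E] [AddCommGroup F] [Module ℝ F]
    (hdim : Module.finrank ℝ E < Module.finrank ℝ F) (L : E →ₗ[ℝ] F) : ∃ n, ∀ v, L v ≠ n := by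
  by_contra! h
  refine hdim.not_ge ?_
  rw [← finrank_top ℝ F, ← LinearMap.range_eq_top.2 h]
  exact LinearMap.finrank_range_le L

/-- At an interior point `∂M` is absent, so any normal vector will do for the height. -/
theorem exists_isStraightening_of_interior [T2Space M] [IsManifold (𝓡∂ 3) 1 M] {f : Euc 2 → M}
    (hf : ContMDiffOn (𝓡 2) (𝓡∂ 3) 1 f (closedBall 0 1)) (hinj : InjOn f (closedBall 0 1))
    {p : Euc 2} (hp : p ∈ ball (0 : Euc 2) 1)
    (hder : Function.Injective (mfderivWithin (𝓡 2) (𝓡∂ 3) f (closedBall 0 1) p))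
    (hint : f p ∈ (𝓡∂ 3).interior M) {O : Set M} (hO : O ∈ 𝓝 (f p)) :
    ∃ G : OpenPartialHomeomorph (Euc 3) (Euc 3), IsStraightening (f '' closedBall 0 1) (f p) O G := by
  have hpc := ball_subset_closedBall hp
  obtain ⟨⟨Q, hQ, hpQ, hQs, hQd⟩, hD⟩ := exists_contDiffOn_extChartAt_comp hf hpc
  set φ : Euc 2 → Euc 3 := fun u => extChartAt (𝓡∂ 3) (f p) (f u) with hφ
  have hB : closedBall (0 : Euc 2) 1 ∈ 𝓝 p := mem_of_superset (isOpen_ball.mem_nhds hp)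
    ball_subset_closedBall
  have hN : closedBall (0 : Euc 2) 1 ∩ Q ∈ 𝓝 p := Filter.inter_mem hB (hQ.mem_nhds hpQ)
  have hφd : ContDiffAt ℝ 1 φ p := hQd.contDiffAt hN
  have hfd : ∀ v, fderiv ℝ φ p v = mfderivWithin (𝓡 2) (𝓡∂ 3) f (closedBall 0 1) p v := by
    intro v
    rw [← hD v, fderivWithin_of_mem_nhds hB]
  have hφi : Function.Injective (fderiv ℝ φ p) := fun v w hvw => hder (by
    rw [← hfd, ← hfd, hvw])
  obtain ⟨n, hn⟩ := exists_notMem_range_of_finrank_lt (by simp)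
    (fderiv ℝ φ p : Euc 2 →ₗ[ℝ] Euc 3)
  let e0 : Euc 2 →L[ℝ] ℝ := EuclideanSpace.proj 0
  -- An auxiliary regular function, positive near `p`: the condition on the coordinate `1` then
  -- holds automatically, as does the half-space condition near an interior point.
  let h : Euc 2 → ℝ := fun u => 1 + e0 (u - p)
  have hh : ContDiffAt ℝ 1 h p := by
    have : ContDiff ℝ 1 h := contDiff_const.add (e0.contDiff.comp (contDiff_id.sub contDiff_const))
    exact this.contDiffAt
  have hhd : HasFDerivAt h e0 p := by
    have h1 : HasFDerivAt (fun u : Euc 2 => u - p) (ContinuousLinearMap.id ℝ (Euc 2)) p :=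
      (hasFDerivAt_id p).sub_const p
    have h2 : HasFDerivAt (fun u : Euc 2 => e0 (u - p)) e0 p :=
      HasFDerivAt.comp (f := fun u : Euc 2 => u - p) p e0.hasFDerivAt h1
    exact h2.const_add 1
  have hh' : fderiv ℝ h p ≠ 0 := by
    rw [hhd.fderiv]
    intro h0
    have := DFunLike.congr_fun h0 (EuclideanSpace.single 0 1)
    simp [e0] at this
  have hhp : ∀ᶠ u in 𝓝 p, 0 < h u := by
    refine hh.continuousAt.eventually_mem (Ioi_mem_nhds ?_)
    simp [h]
  obtain ⟨Φ, G, hpΦ, hΦN, hΦ, hG, hpG, hGΦ, hGe⟩ := exists_straightening hφd hφi hn hh hh'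
    (Filter.inter_mem hN hhp)
  have hW : IsOpen {y : Euc 3 | 0 < y 0} :=
    isOpen_lt continuous_const (EuclideanSpace.proj (0 : Fin 3) : Euc 3 →L[ℝ] ℝ).continuous
  refine exists_isStraightening_of_patch hf.continuousOn hinj hpc (φ := φ)
    (fun u hu huN => ⟨hQs u huN.1, rfl⟩) hpΦ hΦN hΦ hG hpG hGΦ hGe hW
    ((mem_interior_iff_extChartAt (mem_extChartAt_source (f p))).1 hint) ?_ hO
  intro q hq hqW
  have h1 : 0 < Φ q 0 := hqW
  have h2 : 0 < h q.1 := (hΦN q hq).2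
  exact ⟨⟨fun _ => h2.le, fun _ => h1.le⟩, ⟨fun h => absurd h h1.ne', fun h => absurd h h2.ne'⟩,
    fun _ _ => (hΦN q hq).1.1⟩

/-- The disc is extended past its edge, and `h` is the defining coordinate of `∂M` restricted to the
extended patch; transversality makes its differential nonzero. With the height measured along a
vector tangent to `∂M`, that coordinate depends on the patch parameter only. -/
theorem exists_isStraightening_of_boundary [T2Space M] [IsManifold (𝓡∂ 3) 1 M] {f : Euc 2 → M}
    (hf : ContMDiffOn (𝓡 2) (𝓡∂ 3) 1 f (closedBall 0 1)) (hinj : InjOn f (closedBall 0 1))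
    (hint : f '' ball 0 1 ⊆ (𝓡∂ 3).interior M) (hbd : f '' sphere 0 1 ⊆ (𝓡∂ 3).boundary M)
    {p : Euc 2} (hp : p ∈ sphere (0 : Euc 2) 1)
    (hder : Function.Injective (mfderivWithin (𝓡 2) (𝓡∂ 3) f (closedBall 0 1) p))
    (htrans : LinearMap.range (mfderivWithin (𝓡 2) (𝓡∂ 3) f (closedBall 0 1) p).toLinearMap ⊔
        boundaryTangentSpace (f p) = ⊤) {O : Set M} (hO : O ∈ 𝓝 (f p)) :
    ∃ G : OpenPartialHomeomorph (Euc 3) (Euc 3), IsStraightening (f '' closedBall 0 1) (f p) O G := by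
  have hpc := sphere_subset_closedBall hp
  have hp1 : ‖p‖ = 1 := mem_sphere_zero_iff_norm.1 hp
  obtain ⟨⟨Q, hQ, hpQ, hQs, hQd⟩, hD⟩ := exists_contDiffOn_extChartAt_comp hf hpc
  obtain ⟨φ, hφd, hφin, hφout⟩ := exists_contDiffAt_extension_of_closedBall hp1 hQ hpQ hQd
  have hU : UniqueDiffWithinAt ℝ (closedBall (0 : Euc 2) 1) p :=
    uniqueDiffOn_convex (convex_closedBall 0 1) ⟨0, ball_subset_interior_closedBall (by simp)⟩ p hpc
  have hφ' := (hφd.differentiableAt one_ne_zero).hasFDerivAt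
  have hfd : ∀ v, fderiv ℝ φ p v = mfderivWithin (𝓡 2) (𝓡∂ 3) f (closedBall 0 1) p v := by
    intro v
    rw [← hD v, ((hφ'.hasFDerivWithinAt (s := closedBall 0 1)).congr
      (fun u hu => (hφin u hu).symm) (hφin p hpc).symm).fderivWithin hU]
  have hφi : Function.Injective (fderiv ℝ φ p) := fun v w hvw => hder (by
    rw [← hfd, ← hfd, hvw])
  have htop : LinearMap.range (fderiv ℝ φ p : Euc 2 →ₗ[ℝ] Euc 3) ⊔
      LinearMap.ker ((EuclideanSpace.proj (0 : Fin 3) : Euc 3 →L[ℝ] ℝ) : Euc 3 →ₗ[ℝ] ℝ) = ⊤ := by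
    have : (fderiv ℝ φ p : Euc 2 →ₗ[ℝ] Euc 3) =
        (mfderivWithin (𝓡 2) (𝓡∂ 3) f (closedBall 0 1) p).toLinearMap := by
      ext1 v
      exact hfd v
    rw [this]
    exact htrans
  set e0 : Euc 3 →L[ℝ] ℝ := EuclideanSpace.proj 0 with he0
  -- If every vector tangent to `∂M` were tangent to the disc, transversality would make the tangent
  -- plane of the disc three-dimensional.
  obtain ⟨n, hn0, hn⟩ : ∃ n : Euc 3, n 0 = 0 ∧ ∀ v, fderiv ℝ φ p v ≠ n := by
    by_contra! hcon
    obtain ⟨m, hm⟩ := exists_notMem_range_of_finrank_lt (by simp)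
      (fderiv ℝ φ p : Euc 2 →ₗ[ℝ] Euc 3)
    have hle : LinearMap.ker (e0 : Euc 3 →ₗ[ℝ] ℝ) ≤
        LinearMap.range (fderiv ℝ φ p : Euc 2 →ₗ[ℝ] Euc 3) := fun n hn => hcon n hn
    rw [sup_eq_left.2 hle] at htop
    obtain ⟨v, hv⟩ := LinearMap.range_eq_top.1 htop m
    exact hm v hv
  let h : Euc 2 → ℝ := fun u => φ u 0
  have hh : ContDiffAt ℝ 1 h p := e0.contDiff.contDiffAt.comp p hφd
  have hhd : HasFDerivAt h (e0.comp (fderiv ℝ φ p)) p := e0.hasFDerivAt.comp p hφ'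
  have hh' : fderiv ℝ h p ≠ 0 := by
    rw [hhd.fderiv]
    intro h0
    have hle : LinearMap.range (fderiv ℝ φ p : Euc 2 →ₗ[ℝ] Euc 3) ≤
        LinearMap.ker (e0 : Euc 3 →ₗ[ℝ] ℝ) := by
      rintro _ ⟨v, rfl⟩
      exact DFunLike.congr_fun h0 v
    rw [sup_eq_right.2 hle] at htop
    have h1 : EuclideanSpace.single (0 : Fin 3) (1 : ℝ) ∈ LinearMap.ker (e0 : Euc 3 →ₗ[ℝ] ℝ) :=
      htop ▸ Submodule.mem_top
    simp [he0] at h1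
  -- a neighbourhood of `p` in which the reflected points are controlled
  have hp0 : p ≠ 0 := by rintro rfl; simp at hp1
  have hcπ : ContinuousAt (fun u : Euc 2 => ‖u‖⁻¹ • u) p :=
    (continuous_norm.continuousAt.inv₀ (norm_ne_zero_iff.2 hp0)).smul continuousAt_id
  have hcρ : ContinuousAt (fun u : Euc 2 => (2 : ℝ) • (‖u‖⁻¹ • u) - u) p :=
    (hcπ.const_smul (2 : ℝ)).sub continuousAt_id
  have hN : ∀ᶠ u in 𝓝 p, ((u ∈ Q ∧ ‖u‖⁻¹ • u ∈ Q) ∧ (2 : ℝ) • (‖u‖⁻¹ • u) - u ∈ Q) ∧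
      ‖u‖ ∈ Iio (3 : ℝ) := by
    refine ((Filter.Eventually.and (hQ.mem_nhds hpQ) (hcπ.eventually_mem ?_)).and
      (hcρ.eventually_mem ?_)).and (continuous_norm.continuousAt.eventually_mem ?_)
    · simpa only [hp1, inv_one, one_smul] using hQ.mem_nhds hpQ
    · simpa only [hp1, inv_one, one_smul, two_smul, add_sub_cancel_right] using hQ.mem_nhds hpQ
    · rw [hp1]; exact Iio_mem_nhds (by norm_num)
  -- The added part of the patch lies strictly outside the half-space: its defining coordinate is `2
  -- * 0` minus a positive number, as `π u` maps into `∂M` and the reflected point into the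
  -- interior. So within `M` the extension adds nothing to the disc.
  have hneg : ∀ u, (((u ∈ Q ∧ ‖u‖⁻¹ • u ∈ Q) ∧ (2 : ℝ) • (‖u‖⁻¹ • u) - u ∈ Q) ∧
      ‖u‖ ∈ Iio (3 : ℝ)) → 0 ≤ φ u 0 → u ∈ closedBall (0 : Euc 2) 1 := by
    rintro u ⟨⟨⟨hu1, hu2⟩, hu3⟩, hu4⟩ hu0
    rw [mem_closedBall_zero_iff]
    by_contra! hlt
    have hne : ‖u‖ ≠ 0 := by linarith
    have hπ : ‖u‖⁻¹ • u ∈ sphere (0 : Euc 2) 1 := by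
      rw [mem_sphere_zero_iff_norm, norm_smul, norm_inv, norm_norm, inv_mul_cancel₀ hne]
    have hρ : (2 : ℝ) • (‖u‖⁻¹ • u) - u ∈ ball (0 : Euc 2) 1 := by
      have : (2 : ℝ) • (‖u‖⁻¹ • u) - u = (2 * ‖u‖⁻¹ - 1) • u := by
        simp only [sub_smul, one_smul, mul_smul]
      rw [mem_ball_zero_iff, this, norm_smul, Real.norm_eq_abs, ← abs_of_nonneg (norm_nonneg u),
        ← abs_mul, abs_of_nonneg (norm_nonneg u), sub_mul, mul_assoc, inv_mul_cancel₀ hne, abs_lt]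
      have : ‖u‖ < 3 := hu4
      constructor <;> linarith
    have e1 := (mem_boundary_iff_extChartAt (hQs _ ⟨sphere_subset_closedBall hπ, hu2⟩)).1
      (hbd (mem_image_of_mem f hπ))
    have e2 := (mem_interior_iff_extChartAt (hQs _ ⟨ball_subset_closedBall hρ, hu3⟩)).1
      (hint (mem_image_of_mem f hρ))
    rw [hφout u hlt, PiLp.sub_apply, PiLp.smul_apply, e1, smul_zero] at hu0
    linarith
  obtain ⟨Φ, G, hpΦ, hΦN, hΦ, hG, hpG, hGΦ, hGe⟩ := exists_straightening hφd hφi hn hh hh' hN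
  have hΦ0 : ∀ q, Φ q 0 = h q.1 := by
    intro q
    rw [hΦ, PiLp.add_apply, PiLp.smul_apply, hn0, smul_zero, add_zero]
  refine exists_isStraightening_of_patch hf.continuousOn hinj hpc (φ := φ)
    (fun u hu huN => ⟨hQs u ⟨hu, huN.1.1.1⟩, hφin u hu⟩) hpΦ hΦN hΦ hG hpG hGΦ hGe isOpen_univ
    (mem_univ _) ?_ hO
  intro q hq _
  rw [hΦ0 q]
  exact ⟨Iff.rfl, Iff.rfl, fun h0 _ => hneg q.1 (hΦN q hq) h0⟩

/-- A splitting disc can be straightened, together with the boundary of the manifold, near each of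
its points. -/
theorem IsSplittingDisc.exists_isStraightening [T2Space M] [IsManifold (𝓡∂ 3) 1 M] {D : Set M}
    (hD : IsSplittingDisc D) {x : M} (hx : x ∈ D) {O : Set M} (hO : O ∈ 𝓝 x) :
    ∃ G : OpenPartialHomeomorph (Euc 3) (Euc 3), IsStraightening D x O G := by
  obtain ⟨f, hf, hinj, hder, rfl, hint, hbd, htrans⟩ := hD
  obtain ⟨p, hp, rfl⟩ := hx
  rw [← ball_union_sphere] at hp
  rcases hp with hp | hp
  · exact exists_isStraightening_of_interior hf hinj hp (hder p (ball_subset_closedBall hp))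
      (hint (mem_image_of_mem f hp)) hO
  · exact exists_isStraightening_of_boundary hf hinj hint hbd hp
      (hder p (sphere_subset_closedBall hp)) (htrans p hp) hO

end LocalStructure

/-! ### The two sides of a splitting disc -/

section Sides

open Topology Filter

variable {M : Type*} [TopologicalSpace M] [ChartedSpace (EuclideanHalfSpace 3) M]

namespace IsStraightening

variable {D : Set M} {x : M} {O : Set M} {G : OpenPartialHomeomorph (Euc 3) (Euc 3)}

/-- The part of the chart domain at `x` which is mapped to the source of `G`. -/
def dom (x : M) (G : OpenPartialHomeomorph (Euc 3) (Euc 3)) : Set M :=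
  (extChartAt (𝓡∂ 3) x).source ∩ extChartAt (𝓡∂ 3) x ⁻¹' G.source

theorem isOpen_preimage_dom {s : Set (Euc 3)} (hs : IsOpen s) :
    IsOpen (dom x G ∩ {z | G (extChartAt (𝓡∂ 3) x z) ∈ s}) := by
  have h := (continuousOn_extChartAt (I := 𝓡∂ 3) x).isOpen_inter_preimage
    (isOpen_extChartAt_source x) (G.isOpen_inter_preimage hs)
  rwa [preimage_inter, ← inter_assoc] at h

theorem nonneg_coord (hG : IsStraightening D x O G) {z : M} (hz : z ∈ dom x G) :
    0 ≤ G (extChartAt (𝓡∂ 3) x z) 1 :=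
  (hG.nonneg_iff _ hz.2).1 (nonneg_extChartAt hz.1)

theorem mem_of_mem_dom (hG : IsStraightening D x O G) {z : M} (hz : z ∈ dom x G) : z ∈ O := by
  have := hG.symm_mem _ hz.2 (nonneg_extChartAt hz.1)
  rwa [(extChartAt (𝓡∂ 3) x).left_inv hz.1] at this

theorem mem_iff_coord (hG : IsStraightening D x O G) {z : M} (hz : z ∈ dom x G) :
    z ∈ D ↔ G (extChartAt (𝓡∂ 3) x z) 0 = 0 := by
  have := hG.mem_iff _ hz.2 (nonneg_extChartAt hz.1)
  rwa [(extChartAt (𝓡∂ 3) x).left_inv hz.1] at this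

theorem mem_boundary_iff_coord [IsManifold (𝓡∂ 3) 1 M] (hG : IsStraightening D x O G) {z : M}
    (hz : z ∈ dom x G) :
    z ∈ (𝓡∂ 3).boundary M ↔ G (extChartAt (𝓡∂ 3) x z) 1 = 0 :=
  (mem_boundary_iff_extChartAt hz.1).trans (hG.zero_iff _ hz.2)

theorem symm_coord (hG : IsStraightening D x O G) {w : Euc 3} (hw : w ∈ G.target)
    (hw1 : 0 ≤ w 1) :
    (extChartAt (𝓡∂ 3) x).symm (G.symm w) ∈ dom x G ∧
      G (extChartAt (𝓡∂ 3) x ((extChartAt (𝓡∂ 3) x).symm (G.symm w))) = w := by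
  have h1 := G.map_target hw
  have h2 : 0 ≤ G.symm w 0 := (hG.nonneg_iff _ h1).2 (by rwa [G.right_inv hw])
  have h3 := hG.mem_target _ h1 h2
  have h4 := (extChartAt (𝓡∂ 3) x).right_inv h3
  refine ⟨⟨(extChartAt (𝓡∂ 3) x).map_target h3, ?_⟩, ?_⟩
  · rw [mem_preimage, h4]; exact h1
  · rw [h4, G.right_inv hw]

theorem symm_coord_coord {z : M} (hz : z ∈ dom x G) :
    (extChartAt (𝓡∂ 3) x).symm (G.symm (G (extChartAt (𝓡∂ 3) x z))) = z := by
  rw [G.left_inv hz.2, (extChartAt (𝓡∂ 3) x).left_inv hz.1]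

theorem continuousOn_symm_coord (hG : IsStraightening D x O G) :
    ContinuousOn (fun w => (extChartAt (𝓡∂ 3) x).symm (G.symm w)) (G.target ∩ {w | 0 ≤ w 1}) := by
  refine (continuousOn_extChartAt_symm x).comp (G.continuousOn_symm.mono inter_subset_left) ?_
  intro w hw
  have h1 := G.map_target hw.1
  exact hG.mem_target _ h1 ((hG.nonneg_iff _ h1).2 (by rw [G.right_inv hw.1]; exact hw.2))

/-- The two sides of `D` near a point of `D`, in terms of straightened coordinates. -/
theorem exists_sides [IsManifold (𝓡∂ 3) 1 M] (hG : IsStraightening D x O G) (hx : x ∈ D) :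
    ∃ (s : Set (Euc 3)) (W P N : Set M), IsOpen s ∧ s ⊆ G.target ∧
      G (extChartAt (𝓡∂ 3) x x) ∈ s ∧
      W = dom x G ∩ {z | G (extChartAt (𝓡∂ 3) x z) ∈ s} ∧
      P = W ∩ {z | 0 < G (extChartAt (𝓡∂ 3) x z) 0} ∧
      N = W ∩ {z | G (extChartAt (𝓡∂ 3) x z) 0 < 0} ∧
      IsOpen W ∧ x ∈ W ∧ W ⊆ O ∧ P ∪ N = W \ D ∧ Disjoint P N ∧ IsOpen P ∧ IsOpen N ∧
      IsPreconnected P ∧ IsPreconnected N ∧ W ∩ D ⊆ closure P ∧ W ∩ D ⊆ closure N ∧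
      (x ∈ (𝓡∂ 3).boundary M → (P ∩ (𝓡∂ 3).boundary M).Nonempty ∧
        (N ∩ (𝓡∂ 3).boundary M).Nonempty) := by
  set e := extChartAt (𝓡∂ 3) x
  have hxd : x ∈ dom x G := ⟨mem_extChartAt_source x, hG.mem_source⟩
  have hcoord : ∀ i : Fin 3, Continuous fun w : Euc 3 => w i := fun i =>
    (EuclideanSpace.proj i : Euc 3 →L[ℝ] ℝ).continuous
  obtain ⟨r, hr, hrs⟩ := Metric.mem_nhds_iff.1
    (G.open_target.mem_nhds (G.map_source hG.mem_source))
  set s : Set (Euc 3) := ball (G (e x)) r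
  set W : Set M := dom x G ∩ {z | G (e z) ∈ s} with hW
  have hWo : IsOpen W := isOpen_preimage_dom isOpen_ball
  have hxs : G (e x) ∈ s := mem_ball_self hr
  have hpart : ∀ t : Set (Euc 3), IsOpen t → IsOpen (W ∩ {z | G (e z) ∈ t}) := by
    intro t ht
    have := isOpen_preimage_dom (x := x) (G := G) (isOpen_ball.inter ht : IsOpen (s ∩ t))
    convert! this using 1
    ext z
    exact ⟨fun h => ⟨h.1.1, h.1.2, h.2⟩, fun h => ⟨⟨h.1, h.2.1⟩, h.2.2⟩⟩
  -- In coordinates each side is the intersection of a ball with half-spaces, hence convex and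
  -- connected.
  have himg : ∀ t : Set (Euc 3), W ∩ {z | G (e z) ∈ t} =
      (fun w => e.symm (G.symm w)) '' (s ∩ {w | 0 ≤ w 1} ∩ t) := by
    intro t
    ext z
    constructor
    · rintro ⟨⟨hz, hzs⟩, hzt⟩
      exact ⟨_, ⟨⟨hzs, hG.nonneg_coord hz⟩, hzt⟩, symm_coord_coord hz⟩
    · rintro ⟨w, ⟨⟨hws, hw1⟩, hwt⟩, rfl⟩
      obtain ⟨h1, h2⟩ := hG.symm_coord (hrs hws) hw1
      refine ⟨⟨h1, ?_⟩, ?_⟩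
      · rw [mem_ofPred_eq, h2]; exact hws
      · rw [mem_ofPred_eq, h2]; exact hwt
  have hcσ : ∀ t : Set (Euc 3), ContinuousOn (fun w => e.symm (G.symm w))
      (s ∩ {w | 0 ≤ w 1} ∩ t) := fun t => hG.continuousOn_symm_coord.mono fun w hw =>
    ⟨hrs hw.1.1, hw.1.2⟩
  have hconv1 : Convex ℝ (s ∩ {w : Euc 3 | 0 ≤ w 1}) :=
    (convex_ball _ _).inter (convex_halfSpace_ge
      (EuclideanSpace.proj (1 : Fin 3) : Euc 3 →L[ℝ] ℝ).isLinear 0)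
  have hpc : ∀ t : Set (Euc 3), Convex ℝ t → IsPreconnected (W ∩ {z | G (e z) ∈ t}) := by
    intro t ht
    rw [himg]
    exact (hconv1.inter ht).isPreconnected.image _ (hcσ t)
  have hcP : Convex ℝ {w : Euc 3 | 0 < w 0} :=
    convex_halfSpace_gt (EuclideanSpace.proj (0 : Fin 3) : Euc 3 →L[ℝ] ℝ).isLinear 0
  have hcN : Convex ℝ {w : Euc 3 | w 0 < 0} :=
    convex_halfSpace_lt (EuclideanSpace.proj (0 : Fin 3) : Euc 3 →L[ℝ] ℝ).isLinear 0
  -- perturbation of the first coordinate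
  have hpert : ∀ z ∈ W ∩ D, ∀ (c : ℝ), ∀ᶠ t : ℝ in 𝓝 0,
      G (e z) + (t * c) • EuclideanSpace.single 0 (1 : ℝ) ∈ s := by
    intro z hz c
    have hc : Continuous fun t : ℝ => G (e z) + (t * c) • EuclideanSpace.single (0 : Fin 3) (1 : ℝ) := by
      fun_prop
    refine hc.continuousAt.eventually_mem (isOpen_ball.mem_nhds ?_)
    simp only [zero_mul, zero_smul, add_zero]
    exact hz.1.2
  have hpert0 : ∀ z ∈ W ∩ D, ∀ t c : ℝ,
      (G (e z) + (t * c) • EuclideanSpace.single (0 : Fin 3) (1 : ℝ)) 0 = t * c := by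
    intro z hz t c
    have h0 : G (e z) 0 = 0 := (hG.mem_iff_coord hz.1.1).1 hz.2
    rw [PiLp.add_apply, PiLp.smul_apply, h0]
    simp
  have hpert1 : ∀ z, ∀ t c : ℝ,
      (G (e z) + (t * c) • EuclideanSpace.single (0 : Fin 3) (1 : ℝ)) 1 = G (e z) 1 := by
    intro z t c
    simp
  -- A point of `D` is approached from a side by moving only the coordinate `0`; the coordinate `1`
  -- is unchanged, so the path stays in `M`, and in `∂M` if it starts there. The sign of `c` selects
  -- the side.
  have hcl : ∀ (c : ℝ) (t : Set (Euc 3)), (∀ w : Euc 3, ∀ τ : ℝ, 0 < τ → w 0 = τ * c → w ∈ t) →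
      W ∩ D ⊆ closure (W ∩ {z | G (e z) ∈ t}) := by
    intro c t hct z hz
    rw [himg]
    have hzw : G (e z) ∈ s ∩ {w | 0 ≤ w 1} := ⟨hz.1.2, hG.nonneg_coord hz.1.1⟩
    have hcont : ContinuousWithinAt (fun w => e.symm (G.symm w)) (s ∩ {w | 0 ≤ w 1} ∩ t)
        (G (e z)) := by
      have := hG.continuousOn_symm_coord (G (e z)) ⟨hrs hzw.1, hzw.2⟩
      exact this.mono fun w hw => ⟨hrs hw.1.1, hw.1.2⟩
    have hmem : G (e z) ∈ closure (s ∩ {w | 0 ≤ w 1} ∩ t) := by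
      have hc : Continuous fun τ : ℝ => G (e z) + (τ * c) • EuclideanSpace.single (0 : Fin 3) (1 : ℝ) := by
        fun_prop
      have ht : Tendsto (fun τ : ℝ => G (e z) + (τ * c) • EuclideanSpace.single (0 : Fin 3) (1 : ℝ))
          (𝓝[>] 0) (𝓝 (G (e z))) := by
        have := hc.tendsto 0
        simp only [zero_mul, zero_smul, add_zero] at this
        exact this.mono_left nhdsWithin_le_nhds
      refine mem_closure_of_tendsto ht ?_
      filter_upwards [self_mem_nhdsWithin, nhdsWithin_le_nhds (hpert z hz c)] with τ hτ hτs
      exact ⟨⟨hτs, by rw [mem_ofPred_eq, hpert1]; exact hzw.2⟩, hct _ τ hτ (hpert0 z hz τ c)⟩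
    have := hcont.mem_closure_image hmem
    rwa [symm_coord_coord hz.1.1] at this
  have hbd : ∀ (c : ℝ) (t : Set (Euc 3)), (∀ w : Euc 3, ∀ τ : ℝ, 0 < τ → w 0 = τ * c → w ∈ t) →
      x ∈ (𝓡∂ 3).boundary M → ((W ∩ {z | G (e z) ∈ t}) ∩ (𝓡∂ 3).boundary M).Nonempty := by
    intro c t hct hxb
    have h1 := (hG.mem_boundary_iff_coord hxd).1 hxb
    have hxWD : x ∈ W ∩ D := ⟨⟨hxd, hxs⟩, hx⟩
    obtain ⟨τ, hτs, hτ⟩ := (((hpert x hxWD c).filter_mono nhdsWithin_le_nhds).and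
      (self_mem_nhdsWithin : Ioi (0 : ℝ) ∈ 𝓝[>] 0)).exists
    set w := G (e x) + (τ * c) • EuclideanSpace.single (0 : Fin 3) (1 : ℝ)
    have hw1 : w 1 = 0 := (hpert1 x τ c).trans h1
    obtain ⟨h2, h3⟩ := hG.symm_coord (hrs hτs) hw1.ge
    refine ⟨e.symm (G.symm w), ⟨⟨h2, ?_⟩, ?_⟩, ?_⟩
    · rw [mem_ofPred_eq, h3]; exact hτs
    · rw [mem_ofPred_eq, h3]; exact hct _ τ hτ (hpert0 x hxWD τ c)
    · rw [hG.mem_boundary_iff_coord h2, h3]; exact hw1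
  have hP1 : ∀ w : Euc 3, ∀ τ : ℝ, 0 < τ → w 0 = τ * 1 → w ∈ {w : Euc 3 | 0 < w 0} := by
    intro w τ hτ hw
    rw [mem_ofPred_eq, hw, mul_one]; exact hτ
  have hN1 : ∀ w : Euc 3, ∀ τ : ℝ, 0 < τ → w 0 = τ * (-1) → w ∈ {w : Euc 3 | w 0 < 0} := by
    intro w τ hτ hw
    rw [mem_ofPred_eq, hw]; linarith
  refine ⟨s, W, W ∩ {z | 0 < G (e z) 0}, W ∩ {z | G (e z) 0 < 0}, isOpen_ball, hrs, hxs, rfl, rfl,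
    rfl, hWo, ⟨hxd, hxs⟩, fun z hz => hG.mem_of_mem_dom hz.1, ?_, ?_,
    hpart _ (isOpen_lt continuous_const (hcoord 0)), hpart _ (isOpen_lt (hcoord 0) continuous_const),
    hpc _ hcP, hpc _ hcN, hcl 1 _ hP1, hcl (-1) _ hN1, fun hxb => ⟨hbd 1 _ hP1 hxb, hbd (-1) _ hN1 hxb⟩⟩
  · rw [← inter_union_distrib_left]
    ext z
    refine and_congr_right fun hz => ?_
    rw [hG.mem_iff_coord hz.1]
    exact ⟨fun h => h.elim (fun h => ne_of_gt h) (fun h => ne_of_lt h),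
      fun h => (lt_or_gt_of_ne h).symm⟩
  · rw [disjoint_left]
    rintro z ⟨_, h1⟩ ⟨_, h2⟩
    exact lt_asymm (show 0 < G (e z) 0 from h1) h2

end IsStraightening

theorem IsSplittingDisc.locallyTwoSided [T2Space M] [IsManifold (𝓡∂ 3) 1 M] {D : Set M}
    (hD : IsSplittingDisc D) : LocallyTwoSided D := by
  intro x hx O hO
  obtain ⟨G, hG⟩ := hD.exists_isStraightening hx hO
  obtain ⟨s, W, P, N, -, -, -, -, -, -, hW, hxW, hWO, h1, h2, h3, h4, h5, h6, h7, h8, -⟩ :=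
    hG.exists_sides hx
  exact ⟨W, P, N, hW, hxW, hWO, h1, h2, h3, h4, h5, h6, h7, h8⟩

theorem IsSplittingDisc.isCompact {D : Set M} (hD : IsSplittingDisc D) : IsCompact D := by
  obtain ⟨f, hf, -, -, rfl, -⟩ := hD
  exact (isCompact_closedBall 0 1).image_of_continuousOn hf.continuousOn

theorem IsSplittingDisc.isConnected {D : Set M} (hD : IsSplittingDisc D) : IsConnected D := by
  obtain ⟨f, hf, -, -, rfl, -⟩ := hD
  refine IsConnected.image ⟨⟨0, by simp⟩, (convex_closedBall 0 1).isPreconnected⟩ f hf.continuousOn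

/-- A splitting disc cuts a simply connected manifold into two connected pieces. -/
theorem IsSplittingDisc.exists_separation [T2Space M] [IsManifold (𝓡∂ 3) 1 M]
    [SimplyConnectedSpace M] {D : Set M} (hD : IsSplittingDisc D) :
    ∃ A B : Set M, IsOpen A ∧ IsOpen B ∧ IsConnected A ∧ IsConnected B ∧ Disjoint A B ∧
      A ∪ B = Dᶜ ∧ D ⊆ closure A ∧ D ⊆ closure B := by
  have : LocallyPathConnectedSpace M :=
    ChartedSpace.locallyPathConnectedSpace (EuclideanHalfSpace 3) M
  exact hD.locallyTwoSided.exists_separation hD.isCompact.isClosed hD.isConnected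

end Sides

/-! ### Corner charts for the pieces -/

section CornerCharts

open Topology Filter

variable {M : Type*} [TopologicalSpace M] [ChartedSpace (EuclideanHalfSpace 3) M]

/-- `G` is a `C¹` change of coordinates of the preferred chart of `M` at `x`, after which the subset
`U` of `M` is given by the non-negativity of all coordinates. -/
structure IsCornerChart (U : Set M) (x : M) (G : OpenPartialHomeomorph (Euc 3) (Euc 3)) :
    Prop where
  isC1Diffeo : IsC1Diffeo G
  mem_source : extChartAt (𝓡∂ 3) x x ∈ G.source
  mem_iff : ∀ y ∈ G.source, (y ∈ (extChartAt (𝓡∂ 3) x).target ∧ (extChartAt (𝓡∂ 3) x).symm y ∈ U) ↔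
    ∀ i, 0 ≤ G y i

theorem exists_isCornerChart_of_mem_nhds [IsManifold (𝓡∂ 3) 1 M] {U : Set M} {x : M}
    (hU : U ∈ 𝓝 x) :
    ∃ G, IsCornerChart U x G ∧
      ((∃ i, G (extChartAt (𝓡∂ 3) x x) i = 0) ↔ x ∈ (𝓡∂ 3).boundary M) := by
  obtain ⟨W, hW, hxW, hWe⟩ := exists_isOpen_extChartAt_symm_mem x hU
  set y₀ := extChartAt (𝓡∂ 3) x x
  -- The translation puts the coordinates `1` and `2` of the centre equal to `1`, so near it only
  -- the coordinate `0`, which defines `∂M`, matters.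
  let c : Euc 3 := !₂[0, 1 - y₀ 1, 1 - y₀ 2]
  let T : OpenPartialHomeomorph (Euc 3) (Euc 3) := (Homeomorph.addRight c).toOpenPartialHomeomorph
  have hT : IsC1Diffeo T := ⟨(contDiff_id.add contDiff_const).contDiffOn,
    (contDiff_id.add contDiff_const).contDiffOn⟩
  have hTe : ∀ y : Euc 3, T y = y + c := fun y => rfl
  have hT0 : ∀ y : Euc 3, T y 0 = y 0 := fun y => by rw [hTe]; simp [c]
  have hT1 : ∀ y : Euc 3, T y 1 = y 1 + (1 - y₀ 1) := fun y => by rw [hTe]; simp [c]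
  have hT2 : ∀ y : Euc 3, T y 2 = y 2 + (1 - y₀ 2) := fun y => by rw [hTe]; simp [c]
  have hcoord : ∀ i : Fin 3, Continuous fun w : Euc 3 => T w i := fun i =>
    (EuclideanSpace.proj i : Euc 3 →L[ℝ] ℝ).continuous.comp (Homeomorph.addRight c).continuous
  set s : Set (Euc 3) := W ∩ ({y | 0 < T y 1} ∩ {y | 0 < T y 2})
  have hs : IsOpen s := hW.inter ((isOpen_lt continuous_const (hcoord 1)).inter
    (isOpen_lt continuous_const (hcoord 2)))
  have hsrc : (T.restrOpen s hs).source = s := by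
    rw [OpenPartialHomeomorph.restrOpen_source]
    exact univ_inter s
  refine ⟨T.restrOpen s hs, ⟨hT.restrOpen hs, ?_, ?_⟩, ?_⟩
  · rw [hsrc]
    refine ⟨hxW, ?_, ?_⟩
    · change 0 < T y₀ 1
      rw [hT1]; linarith
    · change 0 < T y₀ 2
      rw [hT2]; linarith
  · intro y hy
    rw [hsrc] at hy
    constructor
    · rintro ⟨h1, -⟩ i
      fin_cases i
      · exact (nonneg_of_mem_extChartAt_target h1).trans_eq (hT0 y).symm
      · exact hy.2.1.le
      · exact hy.2.2.le
    · intro h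
      exact hWe y hy.1 ((h 0).trans_eq (hT0 y))
  · rw [mem_boundary_iff_extChartAt (mem_extChartAt_source x)]
    constructor
    · rintro ⟨i, hi⟩
      fin_cases i
      · exact (hT0 y₀).symm.trans hi
      · have hi' : T y₀ 1 = 0 := hi
        rw [hT1] at hi'
        linarith
      · have hi' : T y₀ 2 = 0 := hi
        rw [hT2] at hi'
        linarith
    · exact fun h => ⟨0, (hT0 y₀).trans h⟩

/-- The reflection of `ℝ³` which changes the sign of the first coordinate. -/
noncomputable def reflectZero : Euc 3 ≃L[ℝ] Euc 3 :=
  (LinearIsometryEquiv.piLpCongrRight 2 fun i : Fin 3 =>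
    if i = 0 then LinearIsometryEquiv.neg ℝ else LinearIsometryEquiv.refl ℝ ℝ).toContinuousLinearEquiv

theorem reflectZero_zero (y : Euc 3) : reflectZero y 0 = -y 0 := rfl

theorem reflectZero_one (y : Euc 3) : reflectZero y 1 = y 1 := rfl

theorem reflectZero_two (y : Euc 3) : reflectZero y 2 = y 2 := rfl

/-- In straightened coordinates `A ∪ D` is a half of the half-space, cut out by the sign of the
coordinate `0`. Only the sign has to be adjusted. -/
theorem IsSplittingDisc.exists_isCornerChart [T2Space M] [IsManifold (𝓡∂ 3) 1 M] {D A B : Set M}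
    (hD : IsSplittingDisc D) (hA : IsOpen A) (hB : IsOpen B) (hAB : Disjoint A B)
    (hun : A ∪ B = Dᶜ) (hDA : D ⊆ closure A) (hDB : D ⊆ closure B) {x : M} (hx : x ∈ D) :
    ∃ G, IsCornerChart (A ∪ D) x G ∧ ∃ i, G (extChartAt (𝓡∂ 3) x x) i = 0 := by
  obtain ⟨G, hG⟩ := hD.exists_isStraightening hx Filter.univ_mem
  obtain ⟨s, W, P, N, hs, hsG, hxs, hW, hP, hN, hWo, hxW, -, hPN, -, -, -, hPc, hNc, -⟩ :=
    hG.exists_sides hx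
  have hAD : Disjoint A D := disjoint_left.2 fun z hz hzD =>
    (hun ▸ Or.inl hz : z ∈ Dᶜ) hzD
  have hBD : Disjoint B D := disjoint_left.2 fun z hz hzD =>
    (hun ▸ Or.inr hz : z ∈ Dᶜ) hzD
  have hside := opposite_sides hPc hNc hA hB hAB (hWo.mem_nhds hxW) hPN
    (fun z hz => hun ▸ hz.2) hAD hBD (hDA hx) (hDB hx)
  have hx0 : G (extChartAt (𝓡∂ 3) x x) 0 = 0 :=
    (hG.mem_iff_coord ⟨mem_extChartAt_source x, hG.mem_source⟩).1 hx
  have hso : IsOpen (G.source ∩ G ⁻¹' s) := G.isOpen_inter_preimage hs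
  have hsrc : (G.restrOpen _ hso).source = G.source ∩ G ⁻¹' s := by
    rw [OpenPartialHomeomorph.restrOpen_source, ← inter_assoc, inter_self]
  -- membership in `W` for points of the half-space
  have hmemW : ∀ y ∈ G.source ∩ G ⁻¹' s, 0 ≤ y 0 →
      (extChartAt (𝓡∂ 3) x).symm y ∈ W ∧
      G (extChartAt (𝓡∂ 3) x ((extChartAt (𝓡∂ 3) x).symm y)) = G y := by
    intro y hy hy0
    obtain ⟨h1, h2⟩ := hG.symm_coord (G.map_source hy.1) ((hG.nonneg_iff y hy.1).1 hy0)
    rw [G.left_inv hy.1] at h1 h2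
    refine ⟨?_, h2⟩
    rw [hW]
    refine ⟨h1, ?_⟩
    rw [mem_ofPred_eq, h2]
    exact hy.2
  have key : ∀ S : Euc 3 ≃L[ℝ] Euc 3, (∀ y, S y 1 = y 1) → (∀ y, S y 2 = y 2) →
      (∀ y : Euc 3, y 0 = 0 → S y 0 = 0) → (∀ z ∈ W, z ∈ A ∪ D ↔
        0 ≤ S (G (extChartAt (𝓡∂ 3) x z)) 0) →
      ∃ G, IsCornerChart (A ∪ D) x G ∧ ∃ i, G (extChartAt (𝓡∂ 3) x x) i = 0 := by
    intro S h1 h2 h0 hz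
    have hsrc' : ((G.restrOpen _ hso).trans S.toHomeomorph.toOpenPartialHomeomorph).source =
        G.source ∩ G ⁻¹' s := by
      rw [OpenPartialHomeomorph.trans_source, hsrc]
      exact inter_univ _
    refine ⟨(G.restrOpen _ hso).trans S.toHomeomorph.toOpenPartialHomeomorph,
      ⟨(hG.isC1Diffeo.restrOpen hso).trans (IsC1Diffeo.of_continuousLinearEquiv S), ?_, ?_⟩,
      0, h0 _ hx0⟩
    · rw [hsrc']
      exact ⟨hG.mem_source, hxs⟩
    · intro y hy
      rw [hsrc'] at hy
      change _ ↔ ∀ i, 0 ≤ S (G y) i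
      constructor
      · rintro ⟨hyt, hyU⟩ i
        have hy0 := nonneg_of_mem_extChartAt_target hyt
        obtain ⟨hyW, hyG⟩ := hmemW y hy hy0
        fin_cases i
        · have := (hz _ hyW).1 hyU
          rwa [hyG] at this
        · exact ((hG.nonneg_iff y hy.1).1 hy0).trans_eq (h1 _).symm
        · exact (hG.pos y hy.1).le.trans_eq (h2 _).symm
      · intro h
        have hy0 : 0 ≤ y 0 := (hG.nonneg_iff y hy.1).2 ((h 1).trans_eq (h1 _))
        obtain ⟨hyW, hyG⟩ := hmemW y hy hy0
        refine ⟨hG.mem_target y hy.1 hy0, (hz _ hyW).2 ?_⟩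
        rw [hyG]
        exact h 0
  have hWd : ∀ z ∈ W, z ∈ D ↔ G (extChartAt (𝓡∂ 3) x z) 0 = 0 := fun z hz =>
    hG.mem_iff_coord (hW ▸ hz : z ∈ IsStraightening.dom x G ∩ _).1
  rcases hside with ⟨hPA, hNB⟩ | ⟨hPB, hNA⟩
  · have h := (inter_eq_of_opposite_sides hPN hAB hAD hBD hPA hNB).1
    refine key (ContinuousLinearEquiv.refl ℝ _) (fun _ => rfl) (fun _ => rfl) (fun _ h => h) ?_
    intro z hz
    have h1 : z ∈ A ↔ 0 < G (extChartAt (𝓡∂ 3) x z) 0 :=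
      ⟨fun hzA => (hP ▸ h ▸ ⟨hz, hzA⟩ : z ∈ W ∩ {z | 0 < G (extChartAt (𝓡∂ 3) x z) 0}).2,
        fun hz0 => hPA (hP ▸ ⟨hz, hz0⟩)⟩
    rw [mem_union, h1, hWd z hz, le_iff_lt_or_eq, eq_comm]
    rfl
  · have h := (inter_eq_of_opposite_sides (by rw [union_comm]; exact hPN) hAB hAD hBD hNA hPB).1
    -- Here `A` is the negative side, and the reflection makes its coordinate non-negative.
    refine key reflectZero reflectZero_one reflectZero_two ?_ ?_
    · intro y hy
      rw [reflectZero_zero, hy, neg_zero]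
    intro z hz
    have h1 : z ∈ A ↔ G (extChartAt (𝓡∂ 3) x z) 0 < 0 :=
      ⟨fun hzA => (hN ▸ h ▸ ⟨hz, hzA⟩ : z ∈ W ∩ {z | G (extChartAt (𝓡∂ 3) x z) 0 < 0}).2,
        fun hz0 => hNA (hN ▸ ⟨hz, hz0⟩)⟩
    rw [mem_union, h1, hWd z hz, reflectZero_zero, neg_nonneg, le_iff_lt_or_eq]

end CornerCharts

/-! ### Manifolds with corners from corner charts -/

section CornerManifold

open Topology Filter

variable {M : Type*} [TopologicalSpace M] [ChartedSpace (EuclideanHalfSpace 3) M]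

theorem mem_range_cornerModel3 (y : Euc 3) : y ∈ range cornerModel3 ↔ ∀ i, 0 ≤ y i := by
  rw [show range cornerModel3 = {y : Euc 3 | ∀ i, 0 ≤ y i} from range_euclideanQuadrant 3]
  rfl

theorem mem_frontier_range_cornerModel3 (y : Euc 3) (hy : ∀ i, 0 ≤ y i) :
    y ∈ frontier (range cornerModel3) ↔ ∃ i, y i = 0 := by
  have h : y ∈ interior (range cornerModel3) ↔ ∀ i, 0 < y i := by
    rw [show range cornerModel3 = {y : Euc 3 | ∀ i, 0 ≤ y i} from range_euclideanQuadrant 3,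
      interior_euclideanQuadrant]
    rfl
  rw [frontier, Set.mem_sdiff, h]
  constructor
  · rintro ⟨-, h1⟩
    by_contra! h2
    exact h1 fun i => lt_of_le_of_ne (hy i) (h2 i).symm
  · rintro ⟨i, hi⟩
    exact ⟨subset_closure ((mem_range_cornerModel3 y).2 hy), fun h1 => (h1 i).ne' hi⟩

namespace IsCornerChart

variable {U : Set M} {x : M} {G : OpenPartialHomeomorph (Euc 3) (Euc 3)}

theorem nonneg (hG : IsCornerChart U x G) {z : M} (hz : z ∈ (extChartAt (𝓡∂ 3) x).source)
    (hzG : extChartAt (𝓡∂ 3) x z ∈ G.source) (hzU : z ∈ U) (i : Fin 3) :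
    0 ≤ G (extChartAt (𝓡∂ 3) x z) i := by
  refine (hG.mem_iff _ hzG).1 ⟨(extChartAt (𝓡∂ 3) x).map_source hz, ?_⟩ i
  rwa [(extChartAt (𝓡∂ 3) x).left_inv hz]

theorem symm_mem (hG : IsCornerChart U x G) {w : Euc 3} (hw : w ∈ G.target) (hw0 : ∀ i, 0 ≤ w i) :
    G.symm w ∈ (extChartAt (𝓡∂ 3) x).target ∧ (extChartAt (𝓡∂ 3) x).symm (G.symm w) ∈ U :=
  (hG.mem_iff _ (G.map_target hw)).2 (by rwa [G.right_inv hw])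

open Classical in
/-- The chart of the subspace `U`, with values in the quadrant. -/
noncomputable def chart (hG : IsCornerChart U x G) (hx : x ∈ U) :
    OpenPartialHomeomorph U (EuclideanQuadrant 3) where
  toFun z := cornerModel3.symm (G (extChartAt (𝓡∂ 3) x z))
  -- The value `x` is a default, never taken on the target, where the condition holds by `symm_mem`.
  invFun w := if h : (extChartAt (𝓡∂ 3) x).symm (G.symm w.1) ∈ U then
    ⟨(extChartAt (𝓡∂ 3) x).symm (G.symm w.1), h⟩ else ⟨x, hx⟩
  source := {z | (z : M) ∈ (extChartAt (𝓡∂ 3) x).source ∩ extChartAt (𝓡∂ 3) x ⁻¹' G.source}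
  target := {w | w.1 ∈ G.target}
  map_source' z hz := by
    change cornerModel3 (cornerModel3.symm _) ∈ G.target
    rw [cornerModel3.right_inv ((mem_range_cornerModel3 _).2 (hG.nonneg hz.1 hz.2 z.2))]
    exact G.map_source hz.2
  map_target' w hw := by
    obtain ⟨h1, h2⟩ := hG.symm_mem hw w.2
    rw [dif_pos h2]
    refine ⟨(extChartAt (𝓡∂ 3) x).map_target h1, ?_⟩
    rw [mem_preimage, (extChartAt (𝓡∂ 3) x).right_inv h1]
    exact G.map_target hw
  left_inv' z hz := by
    have h : (cornerModel3.symm (G (extChartAt (𝓡∂ 3) x z))).1 = G (extChartAt (𝓡∂ 3) x z) :=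
      cornerModel3.right_inv ((mem_range_cornerModel3 _).2 (hG.nonneg hz.1 hz.2 z.2))
    have h' : (extChartAt (𝓡∂ 3) x).symm (G.symm (cornerModel3.symm
        (G (extChartAt (𝓡∂ 3) x z))).1) = z := by
      rw [h, G.left_inv hz.2, (extChartAt (𝓡∂ 3) x).left_inv hz.1]
    rw [dif_pos (by rw [h']; exact z.2)]
    exact Subtype.ext h'
  right_inv' w hw := by
    obtain ⟨h1, h2⟩ := hG.symm_mem hw w.2
    rw [dif_pos h2, (extChartAt (𝓡∂ 3) x).right_inv h1, G.right_inv hw]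
    exact cornerModel3.left_inv w
  open_source := by
    have h := (continuousOn_extChartAt (I := 𝓡∂ 3) x).isOpen_inter_preimage
      (isOpen_extChartAt_source x) G.open_source
    exact h.preimage continuous_subtype_val
  open_target := G.open_target.preimage continuous_subtype_val
  continuousOn_toFun := by
    refine cornerModel3.continuous_symm.comp_continuousOn (G.continuousOn.comp
      ((continuousOn_extChartAt (I := 𝓡∂ 3) x).comp continuous_subtype_val.continuousOn ?_) ?_)
    · exact fun z hz => hz.1
    · exact fun z hz => hz.2
  continuousOn_invFun := by
    rw [IsInducing.subtypeVal.continuousOn_iff]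
    have h : ContinuousOn (fun w : EuclideanQuadrant 3 => (extChartAt (𝓡∂ 3) x).symm (G.symm w.1))
        {w | w.1 ∈ G.target} := by
      refine (continuousOn_extChartAt_symm x).comp (G.continuousOn_symm.comp
        continuous_subtype_val.continuousOn fun w hw => hw) ?_
      exact fun w hw => (hG.symm_mem hw w.2).1
    refine h.congr fun w hw => ?_
    simp only [Function.comp_apply]
    rw [dif_pos (hG.symm_mem hw w.2).2]

theorem model_chart (hG : IsCornerChart U x G) (hx : x ∈ U) {z : U}
    (hz : z ∈ (hG.chart hx).source) :
    cornerModel3 (hG.chart hx z) = G (extChartAt (𝓡∂ 3) x z) :=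
  cornerModel3.right_inv ((mem_range_cornerModel3 _).2 (hG.nonneg hz.1 hz.2 z.2))

theorem chart_symm (hG : IsCornerChart U x G) (hx : x ∈ U) {w : EuclideanQuadrant 3}
    (hw : w ∈ (hG.chart hx).target) :
    ((hG.chart hx).symm w : M) = (extChartAt (𝓡∂ 3) x).symm (G.symm w.1) := by
  have h := (hG.symm_mem hw w.2).2
  exact congrArg Subtype.val (dif_pos h)

theorem mem_chart_source (hG : IsCornerChart U x G) (hx : x ∈ U) :
    ⟨x, hx⟩ ∈ (hG.chart hx).source :=
  ⟨mem_extChartAt_source x, hG.mem_source⟩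

/-- Two charts of `U` are `C¹`-compatible. -/
theorem contDiffOn_coord_change [IsManifold (𝓡∂ 3) 1 M] (hG : IsCornerChart U x G) (hx : x ∈ U)
    {x' : M} {G' : OpenPartialHomeomorph (Euc 3) (Euc 3)} (hG' : IsCornerChart U x' G')
    (hx' : x' ∈ U) :
    ContDiffOn ℝ 1 (cornerModel3 ∘ (hG.chart hx).symm.trans (hG'.chart hx') ∘ cornerModel3.symm)
      (cornerModel3.symm ⁻¹' ((hG.chart hx).symm.trans (hG'.chart hx')).source ∩
        range cornerModel3) := by
  -- The coordinate change factors as `G'` after the coordinate change of `M` after `G.symm`, each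
  -- of class `C¹`.
  have hfact : ∀ w ∈ cornerModel3.symm ⁻¹' ((hG.chart hx).symm.trans (hG'.chart hx')).source ∩
      range cornerModel3, w ∈ G.target ∧
      G.symm w ∈ ((extChartAt (𝓡∂ 3) x).symm.trans (extChartAt (𝓡∂ 3) x')).source ∧
      extChartAt (𝓡∂ 3) x' ((extChartAt (𝓡∂ 3) x).symm (G.symm w)) ∈ G'.source ∧
      (cornerModel3 ∘ (hG.chart hx).symm.trans (hG'.chart hx') ∘ cornerModel3.symm) w =
        G' (extChartAt (𝓡∂ 3) x' ((extChartAt (𝓡∂ 3) x).symm (G.symm w))) := by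
    rintro w ⟨hw, hwr⟩
    have hw0 := (mem_range_cornerModel3 w).1 hwr
    have hval : (cornerModel3.symm w).1 = w := cornerModel3.right_inv hwr
    rw [mem_preimage, OpenPartialHomeomorph.trans_source] at hw
    obtain ⟨hw1, hw2⟩ := hw
    have hw1' : cornerModel3.symm w ∈ (hG.chart hx).target := hw1
    have hwt : w ∈ G.target := by
      have : (cornerModel3.symm w).1 ∈ G.target := hw1
      rwa [hval] at this
    have hsym : ((hG.chart hx).symm (cornerModel3.symm w) : M) =
        (extChartAt (𝓡∂ 3) x).symm (G.symm w) := by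
      rw [hG.chart_symm hx hw1', hval]
    have h1 := hG'.model_chart hx' hw2
    have hs : ((hG.chart hx).symm (cornerModel3.symm w) : M) ∈
      (extChartAt (𝓡∂ 3) x').source ∩ extChartAt (𝓡∂ 3) x' ⁻¹' G'.source := hw2
    rw [hsym] at h1 hs
    refine ⟨hwt, ?_, hs.2, h1⟩
    rw [PartialEquiv.trans_source, PartialEquiv.symm_source]
    exact ⟨(hG.symm_mem hwt hw0).1, hs.1⟩
  have h1 : ContDiffOn ℝ 1 (fun w => extChartAt (𝓡∂ 3) x' ((extChartAt (𝓡∂ 3) x).symm (G.symm w)))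
      (cornerModel3.symm ⁻¹' ((hG.chart hx).symm.trans (hG'.chart hx')).source ∩
        range cornerModel3) :=
    (contDiffOn_ext_coord_change (I := 𝓡∂ 3) (n := 1) x' x).comp
      (hG.isC1Diffeo.contDiffOn_symm.mono fun w hw => (hfact w hw).1) fun w hw => (hfact w hw).2.1
  exact (hG'.isC1Diffeo.contDiffOn.comp h1 fun w hw => (hfact w hw).2.2.1).congr
    fun w hw => (hfact w hw).2.2.2

end IsCornerChart

/-- A subset which has a corner chart at each of its points is a submanifold with corners. -/
theorem exists_chartedSpace_of_isCornerChart [IsManifold (𝓡∂ 3) 1 M] {U bd : Set M}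
    (hU : ∀ x ∈ U, ∃ G, IsCornerChart U x G ∧
      ((∃ i, G (extChartAt (𝓡∂ 3) x x) i = 0) ↔ x ∈ bd)) :
    ∃ _ : ChartedSpace (EuclideanQuadrant 3) U,
      IsManifold cornerModel3 1 U ∧
      ContMDiff cornerModel3 (𝓡∂ 3) 1 (Subtype.val : U → M) ∧
      (∀ x : U, Function.Injective
        (mfderiv cornerModel3 (𝓡∂ 3) (Subtype.val : U → M) x)) ∧
      ∀ x : U, x ∈ cornerModel3.boundary U ↔ (x : M) ∈ bd := by
  choose G hG hGb using hU
  let cs : ChartedSpace (EuclideanQuadrant 3) U :=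
    { atlas := range fun x : U => (hG x x.2).chart x.2
      chartAt := fun x => (hG x x.2).chart x.2
      mem_chart_source := fun x => (hG x x.2).mem_chart_source x.2
      chart_mem_atlas := fun x => mem_range_self x }
  have hchart : ∀ x : U, chartAt (EuclideanQuadrant 3) x = (hG x x.2).chart x.2 := fun x => rfl
  have hcent : ∀ x : U, extChartAt cornerModel3 x x = G x x.2 (extChartAt (𝓡∂ 3) (x : M) x) :=
    fun x => (hG x x.2).model_chart x.2 ((hG x x.2).mem_chart_source x.2)
  -- In the charts the inclusion is `G.symm`, a `C¹` diffeomorphism; this gives both its smoothness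
  -- and the injectivity of its derivative.
  have hread : ∀ x : U, extChartAt (𝓡∂ 3) (x : M) ∘ Subtype.val ∘ (extChartAt cornerModel3 x).symm
      =ᶠ[𝓝[range cornerModel3] (extChartAt cornerModel3 x x)] (G x x.2).symm := by
    intro x
    have h1 : (G x x.2).target ∈ 𝓝 (extChartAt cornerModel3 x x) := by
      rw [hcent]
      exact (G x x.2).open_target.mem_nhds ((G x x.2).map_source (hG x x.2).mem_source)
    filter_upwards [nhdsWithin_le_nhds h1, self_mem_nhdsWithin] with w hw hwr
    have hval : (cornerModel3.symm w).1 = w := cornerModel3.right_inv hwr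
    have hw' : cornerModel3.symm w ∈ ((hG x x.2).chart x.2).target := by
      change (cornerModel3.symm w).1 ∈ (G x x.2).target
      rwa [hval]
    have h2 : ((extChartAt cornerModel3 x).symm w : M) =
        (extChartAt (𝓡∂ 3) (x : M)).symm ((G x x.2).symm w) := by
      have := (hG x x.2).chart_symm x.2 hw'
      rw [hval] at this
      exact this
    simp only [Function.comp_apply]
    rw [h2, (extChartAt (𝓡∂ 3) (x : M)).right_inv
      ((hG x x.2).symm_mem hw ((mem_range_cornerModel3 w).1 hwr)).1]
  have hat : ∀ x : U, extChartAt cornerModel3 x x ∈ range cornerModel3 := fun x => mem_range_self _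
  have hsymmC : ∀ x : U, ContDiffAt ℝ 1 (G x x.2).symm (extChartAt cornerModel3 x x) := by
    intro x
    rw [hcent]
    exact (hG x x.2).isC1Diffeo.contDiffOn_symm.contDiffAt
      ((G x x.2).open_target.mem_nhds ((G x x.2).map_source (hG x x.2).mem_source))
  have hsmooth : ContMDiff cornerModel3 (𝓡∂ 3) 1 (Subtype.val : U → M) := by
    intro x
    rw [contMDiffAt_iff]
    refine ⟨continuous_subtype_val.continuousAt, ?_⟩
    exact (hsymmC x).contDiffWithinAt.congr_of_eventuallyEq (hread x)
      ((hread x).eq_of_nhdsWithin (hat x))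
  refine ⟨cs, ?_, hsmooth, ?_, ?_⟩
  · refine isManifold_of_contDiffOn cornerModel3 1 U ?_
    rintro _ _ ⟨x, rfl⟩ ⟨x', rfl⟩
    exact (hG x x.2).contDiffOn_coord_change x.2 (hG x' x'.2) x'.2
  · intro x
    have hmd := ((hsmooth x).mdifferentiableAt one_ne_zero).mfderiv
    have hud : UniqueDiffWithinAt ℝ (range cornerModel3) (extChartAt cornerModel3 x x) :=
      cornerModel3.uniqueDiffOn _ (hat x)
    have hfd : fderivWithin ℝ (writtenInExtChartAt cornerModel3 (𝓡∂ 3) x (Subtype.val : U → M))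
        (range cornerModel3) (extChartAt cornerModel3 x x) =
        fderiv ℝ (G x x.2).symm (extChartAt cornerModel3 x x) := by
      rw [← ((hsymmC x).differentiableAt one_ne_zero).fderivWithin hud]
      exact (hread x).fderivWithin_eq ((hread x).eq_of_nhdsWithin (hat x))
    have hinj : Function.Injective (fderiv ℝ (G x x.2).symm (extChartAt cornerModel3 x x)) := by
      have hd1 := ((hsymmC x).differentiableAt one_ne_zero).hasFDerivAt
      have hx1 : (G x x.2).symm (extChartAt cornerModel3 x x) = extChartAt (𝓡∂ 3) (x : M) x := by
        rw [hcent, (G x x.2).left_inv (hG x x.2).mem_source]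
      have hc2 : ContDiffAt ℝ 1 (G x x.2) ((G x x.2).symm (extChartAt cornerModel3 x x)) := by
        rw [hx1]
        exact (hG x x.2).isC1Diffeo.contDiffOn.contDiffAt
          ((G x x.2).open_source.mem_nhds (hG x x.2).mem_source)
      have hd2 := (hc2.differentiableAt one_ne_zero).hasFDerivAt
      have hcomp := hd2.comp _ hd1
      have hid : (G x x.2) ∘ (G x x.2).symm =ᶠ[𝓝 (extChartAt cornerModel3 x x)] id := by
        have h1 : (G x x.2).target ∈ 𝓝 (extChartAt cornerModel3 x x) := by
          rw [hcent]
          exact (G x x.2).open_target.mem_nhds ((G x x.2).map_source (hG x x.2).mem_source)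
        filter_upwards [h1] with w hw
        exact (G x x.2).right_inv hw
      have heq := (hcomp.congr_of_eventuallyEq hid.symm).unique (hasFDerivAt_id _)
      exact Function.LeftInverse.injective
        (g := fderiv ℝ (G x x.2) ((G x x.2).symm (extChartAt cornerModel3 x x)))
        fun v => DFunLike.congr_fun heq v
    rw [hmd]
    rw [← hfd] at hinj
    exact hinj
  · intro x
    rw [← hGb x x.2]
    -- Boundary points are tested in the preferred chart at the point itself, so only the
    -- coordinates of the centre of each chart are needed.
    have h1 : x ∈ cornerModel3.boundary U ↔
      extChartAt cornerModel3 x x ∈ frontier (range cornerModel3) := Iff.rfl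
    rw [h1, hcent]
    exact mem_frontier_range_cornerModel3 _ fun i =>
      (hG x x.2).nonneg (mem_extChartAt_source (x : M)) (hG x x.2).mem_source x.2 i

end CornerManifold

/-! ### The boundary circle of the disc as a curve on the boundary sphere -/

section BoundaryCurve

open Topology Filter

variable {M : Type*} [TopologicalSpace M] [ChartedSpace (EuclideanHalfSpace 3) M]

/-- An immersion of the two-sphere has local `C¹` left inverses. -/
theorem exists_contMDiffAt_leftInverse {g : StdSphere2 → M} {x : StdSphere2}
    (h : Manifold.IsImmersionAt (𝓡 2) (𝓡∂ 3) 1 g x) :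
    ∃ ψ : M → StdSphere2, ContMDiffAt (𝓡∂ 3) (𝓡 2) 1 ψ (g x) ∧ ∀ᶠ u in 𝓝 x, ψ (g u) = u := by
  -- In adapted charts an immersion is `u ↦ (u, 0)`, and the first projection is the left inverse.
  have hval : ∀ u ∈ h.domChart.source, h.codChart.extend (𝓡∂ 3) (g u) =
      h.equiv (h.domChart.extend (𝓡 2) u, 0) := by
    intro u hu
    have h1 := h.writtenInCharts ((h.domChart.extend (𝓡 2)).map_source
      (by rwa [h.domChart.extend_source]))
    simp only [Function.comp_apply] at h1
    rwa [h.domChart.extend_left_inv hu] at h1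
  refine ⟨fun y => (h.domChart.extend (𝓡 2)).symm (h.equiv.symm (h.codChart.extend (𝓡∂ 3) y)).1,
    ?_, ?_⟩
  · have h1 := h.codChart.contMDiffAt_extend h.codChart_mem_maximalAtlas h.mem_codChart_source
    let L : Euc 3 →L[ℝ] Euc 2 := (ContinuousLinearMap.fst ℝ (Euc 2) h.complement).comp
      (h.equiv.symm : Euc 3 →L[ℝ] Euc 2 × h.complement)
    have h2 : ContMDiffAt 𝓘(ℝ, Euc 3) 𝓘(ℝ, Euc 2) 1 L (h.codChart.extend (𝓡∂ 3) (g x)) :=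
      L.contMDiff.contMDiffAt
    have hLx : L (h.codChart.extend (𝓡∂ 3) (g x)) = h.domChart x := by
      change (h.equiv.symm _).1 = _
      rw [hval x h.mem_domChart_source, ContinuousLinearEquiv.symm_apply_apply]
      rfl
    have h3 : ContMDiffAt 𝓘(ℝ, Euc 2) (𝓡 2) 1 (h.domChart.extend (𝓡 2)).symm
        (L (h.codChart.extend (𝓡∂ 3) (g x))) := by
      rw [hLx]
      exact contMDiffAt_symm_of_mem_maximalAtlas h.domChart_mem_maximalAtlas
        (h.domChart.map_source h.mem_domChart_source)
    exact (h3.comp (h.codChart.extend (𝓡∂ 3) (g x)) h2).comp (g x) h1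
  · filter_upwards [h.domChart.open_source.mem_nhds h.mem_domChart_source] with u hu
    rw [hval u hu, ContinuousLinearEquiv.symm_apply_apply]
    exact h.domChart.extend_left_inv hu

/-- The standard identification of the complex plane with the Euclidean plane. -/
noncomputable def planeIso : ℂ ≃ₗᵢ[ℝ] Euc 2 := Complex.orthonormalBasisOneI.repr

theorem planeIso_mem_sphere (z : Circle) : planeIso z ∈ sphere (0 : Euc 2) 1 := by
  rw [mem_sphere_zero_iff_norm, planeIso.norm_map, Circle.norm_coe]

theorem continuous_circle_coe : Continuous fun z : Circle => (z : ℂ) := continuous_subtype_val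

/-- A surjective `c` would be a homeomorphism, and its inverse would embed the sphere in the plane.
The omitted point serves as the centre of a stereographic projection. -/
theorem exists_notMem_range_of_circle {c : Circle → StdSphere2} (hc : Continuous c)
    (hinj : Function.Injective c) : ∃ v, v ∉ range c := by
  classical
  by_contra! hsurj
  let e : Circle ≃ₜ StdSphere2 :=
    Continuous.homeoOfEquivCompactToT2 (f := Equiv.ofBijective c ⟨hinj, hsurj⟩) hc
  let φ : StdSphere2 → ℂ := fun u => (e.symm u : ℂ)
  have hφ : Continuous φ := continuous_circle_coe.comp e.symm.continuous
  have hφi : Function.Injective φ := fun u w h => e.symm.injective (Circle.coe_injective h)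
  let F : Euc 3 → ℂ := fun u => if h : u ∈ sphere (0 : Euc 3) 1 then φ ⟨u, h⟩ else 0
  have hF : (sphere (0 : Euc 3) 1).domRestrict F = φ := by
    funext u
    exact dif_pos u.2
  refine not_injOn_sphere_of_continuousOn (f := F) ?_ ?_
  · rw [continuousOn_iff_continuous_domRestrict, hF]
    exact hφ
  · rw [injOn_iff_injective, hF]
    exact hφi

/-- The stereographic projection from `v`, with values in the complex plane. -/
noncomputable def stereoComplex (v : StdSphere2) : OpenPartialHomeomorph StdSphere2 ℂ :=
  (stereographic' 2 v).trans planeIso.symm.toHomeomorph.toOpenPartialHomeomorph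

theorem stereoComplex_source (v : StdSphere2) : (stereoComplex v).source = {v}ᶜ := by
  simp [stereoComplex]

theorem stereoComplex_target (v : StdSphere2) : (stereoComplex v).target = univ := by
  simp [stereoComplex]

theorem stereographic'_mem_maximalAtlas (v : StdSphere2) :
    stereographic' 2 v ∈ IsManifold.maximalAtlas (𝓡 2) 1 StdSphere2 :=
  IsManifold.subset_maximalAtlas ⟨v, rfl⟩

theorem contMDiffOn_stereoComplex (v : StdSphere2) :
    ContMDiffOn (𝓡 2) 𝓘(ℝ, ℂ) 1 (stereoComplex v) {v}ᶜ := by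
  have h := contMDiffOn_of_mem_maximalAtlas (stereographic'_mem_maximalAtlas v)
  rw [stereographic'_source] at h
  have h2 : ContMDiff 𝓘(ℝ, Euc 2) 𝓘(ℝ, ℂ) 1 planeIso.symm :=
    planeIso.symm.contDiff.contMDiff
  exact h2.comp_contMDiffOn h

theorem contMDiff_stereoComplex_symm (v : StdSphere2) :
    ContMDiff 𝓘(ℝ, ℂ) (𝓡 2) 1 (stereoComplex v).symm := by
  have h := contMDiffOn_symm_of_mem_maximalAtlas (stereographic'_mem_maximalAtlas v)
  rw [stereographic'_target, contMDiffOn_univ] at h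
  have h2 : ContMDiff 𝓘(ℝ, ℂ) 𝓘(ℝ, Euc 2) 1 planeIso := planeIso.contDiff.contMDiff
  exact h.comp h2

/-- The standard parametrization of the unit circle of the Euclidean plane. -/
noncomputable def unitCircleMap (s : ℝ) : Euc 2 := planeIso (Circle.exp s)

theorem unitCircleMap_mem_sphere (s : ℝ) : unitCircleMap s ∈ sphere (0 : Euc 2) 1 :=
  planeIso_mem_sphere _

theorem hasDerivAt_unitCircleMap (s : ℝ) :
    HasDerivAt unitCircleMap (planeIso (Circle.exp s * Complex.I)) s := by
  have h : HasDerivAt (fun s : ℝ => (Circle.exp s : ℂ)) (Circle.exp s * Complex.I) s := by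
    have h1 : HasDerivAt (fun s : ℝ => (s : ℂ) * Complex.I) Complex.I s := by
      simpa using (Complex.ofRealCLM.hasDerivAt (x := s)).mul_const Complex.I
    have h2 := h1.cexp
    simpa only [Circle.coe_exp] using h2
  exact (planeIso.toContinuousLinearEquiv : ℂ →L[ℝ] Euc 2).hasFDerivAt.comp_hasDerivAt s h

theorem contDiff_unitCircleMap : ContDiff ℝ 1 unitCircleMap := by
  have h : ContDiff ℝ 1 (fun s : ℝ => Complex.exp ((s : ℂ) * Complex.I)) :=
    (Complex.ofRealCLM.contDiff.mul contDiff_const).cexp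
  exact planeIso.contDiff.comp h

theorem deriv_unitCircleMap_ne_zero (s : ℝ) : planeIso (Circle.exp s * Complex.I) ≠ 0 := by
  rw [Ne, LinearIsometryEquiv.map_eq_zero_iff]
  exact mul_ne_zero (Circle.coe_ne_zero _) Complex.I_ne_zero

/-- The boundary circle of a splitting disc cuts the boundary sphere into two discs. -/
theorem exists_boundary_discs [IsManifold (𝓡∂ 3) 1 M] {f : Euc 2 → M}
    (hf : ContMDiffOn (𝓡 2) (𝓡∂ 3) 1 f (closedBall 0 1)) (hinj : InjOn f (closedBall 0 1))
    (hder : ∀ p ∈ closedBall (0 : Euc 2) 1,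
      Function.Injective (mfderivWithin (𝓡 2) (𝓡∂ 3) f (closedBall 0 1) p))
    {g : StdSphere2 → M} (hg : Manifold.IsSmoothEmbedding (𝓡 2) (𝓡∂ 3) 1 g)
    (hfg : f '' sphere 0 1 ⊆ range g) :
    ∃ (c : Circle → StdSphere2) (A B : Set StdSphere2), (∀ z : Circle, g (c z) = f (planeIso z)) ∧
      IsOpen A ∧ IsOpen B ∧ IsConnected A ∧ IsConnected B ∧ Disjoint A B ∧
      A ∪ B = (range c)ᶜ ∧
      (∃ p : ℂ → StdSphere2, ContinuousOn p (closedBall 0 1) ∧ InjOn p (closedBall 0 1) ∧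
        p '' closedBall 0 1 = A ∪ range c ∧ ∀ z : Circle, p z = c z) ∧
      ∃ p : ℂ → StdSphere2, ContinuousOn p (closedBall 0 1) ∧ InjOn p (closedBall 0 1) ∧
        p '' closedBall 0 1 = B ∪ range c ∧ ∀ z : Circle, p z = c z := by
  have hex : ∀ z : Circle, ∃ u, g u = f (planeIso z) := fun z =>
    hfg (mem_image_of_mem f (planeIso_mem_sphere z))
  choose c hc using hex
  have hcc : Continuous c := by
    rw [hg.isEmbedding.continuous_iff]
    have : g ∘ c = fun z : Circle => f (planeIso z) := funext hc
    rw [this]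
    exact hf.continuousOn.comp_continuous (planeIso.continuous.comp continuous_circle_coe)
      fun z => sphere_subset_closedBall (planeIso_mem_sphere z)
  have hci : Function.Injective c := by
    intro z w hzw
    have h1 : f (planeIso z) = f (planeIso w) := by rw [← hc, ← hc, hzw]
    exact Circle.coe_injective (planeIso.injective
      (hinj (sphere_subset_closedBall (planeIso_mem_sphere z))
        (sphere_subset_closedBall (planeIso_mem_sphere w)) h1))
  obtain ⟨v, hv⟩ := exists_notMem_range_of_circle hcc hci
  have hcv : ∀ z, c z ∈ (stereoComplex v).source := by
    intro z
    rw [stereoComplex_source]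
    rintro rfl
    exact hv ⟨z, rfl⟩
  have hfω : ContMDiff 𝓘(ℝ, ℝ) (𝓡∂ 3) 1 (fun s => f (unitCircleMap s)) := by
    have h : ContMDiff 𝓘(ℝ, ℝ) (𝓡 2) 1 unitCircleMap := contDiff_unitCircleMap.contMDiff
    exact hf.comp_contMDiff h fun s => sphere_subset_closedBall (unitCircleMap_mem_sphere s)
  have hgc : ∀ s, g (c (Circle.exp s)) = f (unitCircleMap s) := fun s => hc _
  -- The lift of the boundary circle through `g` is `C¹` because locally it is a `C¹` left inverse
  -- of `g` applied to `f`.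
  have hcs : ContMDiff 𝓘(ℝ, ℝ) (𝓡 2) 1 (fun s => c (Circle.exp s)) := by
    intro s
    obtain ⟨ψ, hψ, hψe⟩ := exists_contMDiffAt_leftInverse
      (hg.isImmersion.isImmersionAt (c (Circle.exp s)))
    rw [hgc] at hψ
    have h1 : ContMDiffAt 𝓘(ℝ, ℝ) (𝓡 2) 1 (fun s => ψ (f (unitCircleMap s))) s :=
      hψ.comp s (hfω s)
    refine h1.congr_of_eventuallyEq ?_
    have h2 : ContinuousAt (fun s => c (Circle.exp s)) s :=
      (hcc.comp Circle.exp.continuous).continuousAt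
    filter_upwards [h2.eventually hψe] with t ht
    rw [← hgc]
    exact ht.symm
  let γ : ℝ → ℂ := fun s => stereoComplex v (c (Circle.exp s))
  have hγs : ∀ s, (stereoComplex v).symm (γ s) = c (Circle.exp s) := fun s =>
    (stereoComplex v).left_inv (hcv _)
  have hγ : IsC1JordanCurve γ := by
    have hC : ContDiff ℝ 1 γ := by
      rw [← contMDiff_iff_contDiff]
      exact (contMDiffOn_stereoComplex v).comp_contMDiff hcs fun s =>
        stereoComplex_source v ▸ hcv _
    refine ⟨hC, ?_, ?_⟩
    · intro s hs
      have hp := sphere_subset_closedBall (unitCircleMap_mem_sphere s)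
      obtain ⟨⟨O, hO, hpO, hOs, hOd⟩, hD⟩ := exists_contDiffOn_extChartAt_comp hf hp
      set E : Euc 2 → Euc 3 := fun u => extChartAt (𝓡∂ 3) (f (unitCircleMap s)) (f u) with hE
      have hnh : closedBall (0 : Euc 2) 1 ∩ O ∈ 𝓝[closedBall 0 1] unitCircleMap s :=
        inter_mem_nhdsWithin _ (hO.mem_nhds hpO)
      have hEd : HasFDerivWithinAt E (fderivWithin ℝ E (closedBall 0 1) (unitCircleMap s))
          (closedBall 0 1) (unitCircleMap s) :=
        (((hOd _ ⟨hp, hpO⟩).differentiableWithinAt one_ne_zero).mono_of_mem_nhdsWithin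
          hnh).hasFDerivWithinAt
      have h1 : HasDerivAt (fun t => E (unitCircleMap t)) (fderivWithin ℝ E (closedBall 0 1)
          (unitCircleMap s) (planeIso (Circle.exp s * Complex.I))) s := by
        rw [← hasDerivWithinAt_univ]
        exact hEd.comp_hasDerivWithinAt s (hasDerivAt_unitCircleMap s).hasDerivWithinAt
          fun t _ => sphere_subset_closedBall (unitCircleMap_mem_sphere t)
      have h2 : ContMDiffAt 𝓘(ℝ, ℂ) 𝓘(ℝ, Euc 3) 1
          (fun z => extChartAt (𝓡∂ 3) (f (unitCircleMap s)) (g ((stereoComplex v).symm z)))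
          (γ s) := by
        have e1 : ContMDiffAt 𝓘(ℝ, ℂ) (𝓡∂ 3) 1 (fun z => g ((stereoComplex v).symm z)) (γ s) :=
          (hg.contMDiff.comp (contMDiff_stereoComplex_symm v)).contMDiffAt
        have e2 : ContMDiffAt (𝓡∂ 3) 𝓘(ℝ, Euc 3) 1 (extChartAt (𝓡∂ 3) (f (unitCircleMap s)))
            (g ((stereoComplex v).symm (γ s))) := by
          rw [hγs, hgc]
          exact contMDiffAt_extChartAt
        exact e2.comp (γ s) e1
      have h3 := (contMDiffAt_iff_contDiffAt.1 h2).differentiableAt one_ne_zero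
      -- If `γ` were stationary, so would be its image in `M`, the boundary circle of the disc; but
      -- the derivative of `f` is injective and the unit circle has nonzero velocity.
      have hγd : HasDerivAt γ 0 s := hs ▸ (hC.differentiable one_ne_zero s).hasDerivAt
      have h4 := h3.hasFDerivAt.comp_hasDerivAt s hγd
      rw [map_zero] at h4
      have h5 : (fun t => E (unitCircleMap t)) = (fun z => extChartAt (𝓡∂ 3)
          (f (unitCircleMap s)) (g ((stereoComplex v).symm z))) ∘ γ := by
        funext t
        simp only [Function.comp_apply]
        rw [hγs, hgc]
      rw [← h5] at h4
      have h6 := h1.unique h4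
      rw [hD] at h6
      exact deriv_unitCircleMap_ne_zero s ((injective_iff_map_eq_zero _).1 (hder _ hp) _ h6)
    · intro s t
      constructor
      · intro h
        exact hci ((stereoComplex v).injOn (hcv _) (hcv _) h)
      · intro h
        simp only [γ, h]
  obtain ⟨c', A, B, hc', h⟩ := hγ.exists_discs (stereoComplex v) (stereoComplex_source v)
    (stereoComplex_target v)
  have : c' = c := by
    funext z
    obtain ⟨s, rfl⟩ := Circle.exp_surjective z
    rw [hc', hγs]
  subst this
  exact ⟨c', A, B, hc, h⟩

end BoundaryCurve

/-! ### Gluing two discs to a sphere -/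

section Gluing

open Topology Filter

/-- The orthogonal projection of the two-sphere to the complex plane. -/
noncomputable def sphereProj (y : StdSphere2) : ℂ := ⟨y.1 0, y.1 1⟩

theorem continuous_coord (i : Fin 3) : Continuous fun y : StdSphere2 => y.1 i :=
  (EuclideanSpace.proj i : Euc 3 →L[ℝ] ℝ).continuous.comp continuous_subtype_val

theorem continuous_sphereProj : Continuous sphereProj :=
  Complex.equivRealProdCLM.symm.continuous.comp ((continuous_coord 0).prodMk (continuous_coord 1))

theorem norm_sq_sphereProj_add (y : StdSphere2) : ‖sphereProj y‖ ^ 2 + y.1 2 ^ 2 = 1 := by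
  have h := mem_sphere_zero_iff_norm.1 y.2
  have h2 := EuclideanSpace.real_norm_sq_eq y.1
  rw [h, Fin.sum_univ_three] at h2
  rw [← Complex.normSq_eq_norm_sq, Complex.normSq_apply, sphereProj]
  simp only
  linarith

theorem sphereProj_mem_closedBall (y : StdSphere2) : sphereProj y ∈ closedBall (0 : ℂ) 1 := by
  rw [mem_closedBall_zero_iff]
  nlinarith [norm_sq_sphereProj_add y, norm_nonneg (sphereProj y), sq_nonneg (y.1 2)]

theorem norm_sphereProj_eq_one_iff (y : StdSphere2) : ‖sphereProj y‖ = 1 ↔ y.1 2 = 0 := by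
  have h := norm_sq_sphereProj_add y
  constructor
  · intro h1
    rw [h1] at h
    nlinarith
  · intro h1
    rw [h1] at h
    nlinarith [norm_nonneg (sphereProj y)]

theorem sphereProj_ext {y z : StdSphere2} (h : sphereProj y = sphereProj z)
    (hs : 0 ≤ y.1 2 * z.1 2) : y = z := by
  have h0 : y.1 0 = z.1 0 := congrArg Complex.re h
  have h1 : y.1 1 = z.1 1 := congrArg Complex.im h
  have hy := norm_sq_sphereProj_add y
  have hz := norm_sq_sphereProj_add z
  rw [h] at hy
  have h2 : y.1 2 = z.1 2 := by
    have h3 : y.1 2 ^ 2 = z.1 2 ^ 2 := by linarith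
    rcases sq_eq_sq_iff_eq_or_eq_neg.1 h3 with h4 | h4
    · exact h4
    · rw [h4] at hs ⊢
      have : z.1 2 = 0 := by nlinarith
      rw [this, neg_zero]
  apply Subtype.ext
  ext i
  fin_cases i
  · exact h0
  · exact h1
  · exact h2

theorem exists_sphereProj_eq {w : ℂ} (hw : w ∈ closedBall (0 : ℂ) 1) :
    (∃ y : StdSphere2, 0 ≤ y.1 2 ∧ sphereProj y = w) ∧
      ∃ y : StdSphere2, y.1 2 ≤ 0 ∧ sphereProj y = w := by
  have hw1 : ‖w‖ ≤ 1 := mem_closedBall_zero_iff.1 hw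
  have h0 : 0 ≤ 1 - ‖w‖ ^ 2 := by nlinarith [norm_nonneg w]
  have hmem : ∀ t : ℝ, t ^ 2 = 1 - ‖w‖ ^ 2 → !₂[w.re, w.im, t] ∈ sphere (0 : Euc 3) 1 := by
    intro t ht
    rw [mem_sphere_zero_iff_norm, ← sq_eq_sq₀ (norm_nonneg _) zero_le_one,
      EuclideanSpace.real_norm_sq_eq, Fin.sum_univ_three]
    rw [← Complex.normSq_eq_norm_sq, Complex.normSq_apply] at ht
    simp
    nlinarith
  refine ⟨⟨⟨_, hmem (Real.sqrt (1 - ‖w‖ ^ 2)) (Real.sq_sqrt h0)⟩, Real.sqrt_nonneg _, rfl⟩,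
    ⟨⟨_, hmem (-Real.sqrt (1 - ‖w‖ ^ 2)) ?_⟩, ?_, rfl⟩⟩
  · rw [neg_sq, Real.sq_sqrt h0]
  · exact neg_nonpos.2 (Real.sqrt_nonneg _)

/-- Two discs which meet exactly in their common boundary circle form a sphere. -/
theorem nonempty_homeomorph_sphere_of_discs {Z : Type*} [TopologicalSpace Z] [T2Space Z]
    {p₁ p₂ : ℂ → Z} (hc₁ : ContinuousOn p₁ (closedBall 0 1)) (hc₂ : ContinuousOn p₂ (closedBall 0 1))
    (hi₁ : InjOn p₁ (closedBall 0 1)) (hi₂ : InjOn p₂ (closedBall 0 1))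
    (heq : ∀ z : ℂ, ‖z‖ = 1 → p₁ z = p₂ z)
    (hmeet : ∀ z ∈ closedBall (0 : ℂ) 1, ∀ w ∈ closedBall (0 : ℂ) 1, p₁ z = p₂ w → ‖z‖ = 1) :
    Nonempty (↥(p₁ '' closedBall 0 1 ∪ p₂ '' closedBall 0 1) ≃ₜ StdSphere2) := by
  classical
  -- Each hemisphere projects bijectively to the unit disc and carries one of the two discs; they
  -- agree on the equator, and `hmeet` excludes further coincidences.
  let q : StdSphere2 → Z := fun y => if 0 ≤ y.1 2 then p₁ (sphereProj y) else p₂ (sphereProj y)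
  have hq1 : ∀ y : StdSphere2, 0 ≤ y.1 2 → q y = p₁ (sphereProj y) := fun y hy => if_pos hy
  have hq2 : ∀ y : StdSphere2, y.1 2 ≤ 0 → q y = p₂ (sphereProj y) := by
    intro y hy
    by_cases h : 0 ≤ y.1 2
    · rw [hq1 y h]
      exact heq _ ((norm_sphereProj_eq_one_iff y).2 (le_antisymm hy h))
    · exact if_neg h
  have hqc : Continuous q := by
    refine Continuous.if_le (hc₁.comp_continuous continuous_sphereProj sphereProj_mem_closedBall)
      (hc₂.comp_continuous continuous_sphereProj sphereProj_mem_closedBall) continuous_const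
      (continuous_coord 2) fun y hy => heq _ ((norm_sphereProj_eq_one_iff y).2 hy.symm)
  have hcross : ∀ y z : StdSphere2, 0 ≤ y.1 2 → z.1 2 ≤ 0 → q y = q z → y = z := by
    intro y z hy hz h
    rw [hq1 y hy, hq2 z hz] at h
    have h1 := hmeet _ (sphereProj_mem_closedBall y) _ (sphereProj_mem_closedBall z) h
    have h2 := hi₂ (sphereProj_mem_closedBall y) (sphereProj_mem_closedBall z)
      ((heq _ h1).symm.trans h)
    refine sphereProj_ext h2 ?_
    rw [(norm_sphereProj_eq_one_iff y).1 h1, zero_mul]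
  have hqi : Function.Injective q := by
    intro y z h
    rcases le_total 0 (y.1 2) with hy | hy <;> rcases le_total 0 (z.1 2) with hz | hz
    · rw [hq1 y hy, hq1 z hz] at h
      exact sphereProj_ext (hi₁ (sphereProj_mem_closedBall y) (sphereProj_mem_closedBall z) h)
        (mul_nonneg hy hz)
    · exact hcross y z hy hz h
    · exact (hcross z y hz hy h.symm).symm
    · rw [hq2 y hy, hq2 z hz] at h
      exact sphereProj_ext (hi₂ (sphereProj_mem_closedBall y) (sphereProj_mem_closedBall z) h)
        (mul_nonneg_of_nonpos_of_nonpos hy hz)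
  have hrange : range q = p₁ '' closedBall 0 1 ∪ p₂ '' closedBall 0 1 := by
    apply Subset.antisymm
    · rintro _ ⟨y, rfl⟩
      rcases le_total 0 (y.1 2) with hy | hy
      · exact Or.inl ⟨_, sphereProj_mem_closedBall y, (hq1 y hy).symm⟩
      · exact Or.inr ⟨_, sphereProj_mem_closedBall y, (hq2 y hy).symm⟩
    · rintro _ (⟨w, hw, rfl⟩ | ⟨w, hw, rfl⟩)
      · obtain ⟨y, hy, hyw⟩ := (exists_sphereProj_eq hw).1
        exact ⟨y, by rw [hq1 y hy, hyw]⟩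
      · obtain ⟨y, hy, hyw⟩ := (exists_sphereProj_eq hw).2
        exact ⟨y, by rw [hq2 y hy, hyw]⟩
  have hemb : IsEmbedding q := (hqc.isClosedEmbedding hqi).isEmbedding
  exact ⟨(hemb.toHomeomorph.trans (Homeomorph.setCongr hrange)).symm⟩

end Gluing

/-! ### The pieces and their boundaries -/

section Pieces

open Topology Filter

variable {M : Type*} [TopologicalSpace M] [ChartedSpace (EuclideanHalfSpace 3) M]

/-- One of the two sides of a splitting disc is a submanifold bounded by a sphere, as soon as its
part of the boundary of `M` is a disc with the same boundary circle. -/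
theorem isSubmanifold3BoundedBySphere_of_side [T2Space M] [IsManifold (𝓡∂ 3) 1 M]
    {f : Euc 2 → M} {D A B : Set M} (hD : IsSplittingDisc D)
    (hf : ContinuousOn f (closedBall 0 1)) (hinj : InjOn f (closedBall 0 1))
    (hfD : f '' closedBall 0 1 = D) (hint : f '' ball 0 1 ⊆ (𝓡∂ 3).interior M)
    (hbd : f '' sphere 0 1 ⊆ (𝓡∂ 3).boundary M)
    (hA : IsOpen A) (hB : IsOpen B) (hAB : Disjoint A B)
    (hun : A ∪ B = Dᶜ) (hDA : D ⊆ closure A) (hDB : D ⊆ closure B)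
    {p : ℂ → M} (hp : ContinuousOn p (closedBall 0 1)) (hpi : InjOn p (closedBall 0 1))
    (hpf : ∀ z : ℂ, ‖z‖ = 1 → f (planeIso z) = p z)
    (hpA : p '' closedBall 0 1 = A ∩ (𝓡∂ 3).boundary M ∪ f '' sphere 0 1) :
    IsSubmanifold3BoundedBySphere (A ∪ D) := by
  have hAD : Disjoint A D := disjoint_left.2 fun z hz hzD => (hun ▸ Or.inl hz : z ∈ Dᶜ) hzD
  have hcompl : A ∪ D = Bᶜ := by
    ext z
    constructor
    · rintro (hz | hz) hzB
      · exact disjoint_left.1 hAB hz hzB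
      · exact (hun ▸ Or.inr hzB : z ∈ Dᶜ) hz
    · intro hz
      by_cases hzD : z ∈ D
      · exact Or.inr hzD
      · exact Or.inl ((hun ▸ hzD : z ∈ A ∪ B).resolve_right hz)
  refine ⟨hcompl ▸ hB.isClosed_compl, ?_⟩
  have hcharts : ∀ x ∈ A ∪ D, ∃ G, IsCornerChart (A ∪ D) x G ∧
      ((∃ i, G (extChartAt (𝓡∂ 3) x x) i = 0) ↔ x ∈ D ∪ (𝓡∂ 3).boundary M) := by
    rintro x (hx | hx)
    · obtain ⟨G, hG, hGb⟩ := exists_isCornerChart_of_mem_nhds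
        (mem_of_superset (hA.mem_nhds hx) subset_union_left : A ∪ D ∈ 𝓝 x)
      refine ⟨G, hG, hGb.trans ⟨Or.inr, fun h => h.resolve_left (disjoint_left.1 hAD hx)⟩⟩
    · obtain ⟨G, hG, hGb⟩ := hD.exists_isCornerChart hA hB hAB hun hDA hDB hx
      exact ⟨G, hG, fun _ => Or.inl hx, fun _ => hGb⟩
  obtain ⟨cs, h1, h2, h3, h4⟩ := exists_chartedSpace_of_isCornerChart hcharts
  refine ⟨cs, h1, h2, h3, ?_⟩
  have hfi : (fun z => f (planeIso z)) '' closedBall 0 1 = D := by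
    have : closedBall (0 : Euc 2) 1 = planeIso '' closedBall 0 1 := by
      rw [LinearIsometryEquiv.image_closedBall, map_zero]
    rw [← hfD, this, image_image]
  have hmapsto : MapsTo planeIso (closedBall (0 : ℂ) 1) (closedBall (0 : Euc 2) 1) := by
    intro z hz
    rw [mem_closedBall_zero_iff, planeIso.norm_map]
    exact mem_closedBall_zero_iff.1 hz
  have hDbd : D ∩ (𝓡∂ 3).boundary M = f '' sphere 0 1 := by
    apply Subset.antisymm
    · rintro z ⟨hz, hzb⟩
      rw [← hfD, ← ball_union_sphere, image_union] at hz
      refine hz.resolve_left fun h => ?_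
      exact disjoint_left.1 ((𝓡∂ 3).disjoint_interior_boundary (M := M)) (hint h) hzb
    · exact fun z hz => ⟨hfD ▸ image_mono sphere_subset_closedBall hz, hbd hz⟩
  -- The boundary consists of the splitting disc and of the disc cut from `∂M`.
  have hset : Subtype.val '' (cornerModel3.boundary (A ∪ D : Set M)) =
      (fun z => f (planeIso z)) '' closedBall 0 1 ∪ p '' closedBall 0 1 := by
    rw [hfi, hpA]
    apply Subset.antisymm
    · rintro _ ⟨x, hx, rfl⟩
      by_cases hxD : (x : M) ∈ D
      · exact Or.inl hxD
      · exact Or.inr (Or.inl ⟨x.2.resolve_right hxD, ((h4 x).1 hx).resolve_left hxD⟩)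
    · rintro x (hx | ⟨hx, hxb⟩ | hx)
      · exact ⟨⟨x, Or.inr hx⟩, (h4 ⟨x, Or.inr hx⟩).2 (Or.inl hx), rfl⟩
      · exact ⟨⟨x, Or.inl hx⟩, (h4 ⟨x, Or.inl hx⟩).2 (Or.inr hxb), rfl⟩
      · have hxD : x ∈ D := (hDbd ▸ hx : x ∈ D ∩ _).1
        exact ⟨⟨x, Or.inr hxD⟩, (h4 ⟨x, Or.inr hxD⟩).2 (Or.inl hxD), rfl⟩
  obtain ⟨e⟩ := nonempty_homeomorph_sphere_of_discs (p₁ := fun z => f (planeIso z)) (p₂ := p)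
    (hf.comp planeIso.continuous.continuousOn hmapsto) hp
    (hinj.comp planeIso.injective.injOn hmapsto) hpi hpf (by
      intro z hz w hw hzw
      have hzD : f (planeIso z) ∈ D := hfi ▸ mem_image_of_mem _ hz
      have hpw : p w ∈ A ∩ (𝓡∂ 3).boundary M ∪ f '' sphere 0 1 := hpA ▸ mem_image_of_mem p hw
      rcases hpw with h | ⟨u, hu, huw⟩
      · exact absurd (hzw ▸ hzD) (disjoint_left.1 hAD h.1)
      · have := hinj (hmapsto hz) (sphere_subset_closedBall hu) (hzw.trans huw.symm)
        rw [← planeIso.norm_map, this]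
        exact mem_sphere_zero_iff_norm.1 hu)
  exact ⟨(IsEmbedding.subtypeVal.homeomorphImage _).trans ((Homeomorph.setCongr hset).trans e)⟩

/-- A splitting disc is not a three-dimensional manifold. -/
theorem IsSplittingDisc.not_nonempty_chartedSpace [T2Space M] {D : Set M}
    (hD : IsSplittingDisc D) : ¬ Nonempty (ChartedSpace (EuclideanHalfSpace 3) D) := by
  rintro ⟨cs⟩
  have hne : Nonempty D := hD.elim fun f h => ⟨⟨f 0, h.2.2.2.1 ▸ mem_image_of_mem f (by simp)⟩⟩
  obtain ⟨f, hf, hinj, -, hfD, -⟩ := hD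
  have hbij : BijOn f (closedBall 0 1) D := ⟨fun z hz => hfD ▸ mem_image_of_mem f hz, hinj, hfD.ge⟩
  have : CompactSpace (closedBall (0 : Euc 2) 1) :=
    isCompact_iff_compactSpace.1 (isCompact_closedBall 0 1)
  have hcont : Continuous (hbij.equiv f) :=
    (continuousOn_iff_continuous_domRestrict.1 hf.continuousOn).subtype_mk _
  let e : closedBall (0 : Euc 2) 1 ≃ₜ D := Continuous.homeoOfEquivCompactToT2 hcont
  -- The inverse of the parametrization embeds `D` in the plane.
  exact not_injective_of_chartedSpace_halfSpace (φ := fun d : D => (e.symm d : Euc 2))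
    (continuous_subtype_val.comp e.symm.continuous)
    (Subtype.val_injective.comp e.symm.injective)

end Pieces

/-! ### Uniqueness and the main theorem -/

section Main

open Topology Filter

/-- A decomposition into two closed sets which meet in `D`, and of which neither is `D`, is given by
the two connected pieces of the complement of `D`. -/
theorem eq_of_decomposition {M : Type*} [TopologicalSpace M] {D A B U V : Set M} (hA : IsPreconnected A) (hB : IsPreconnected B)
    (hun : A ∪ B = Dᶜ) (hU : IsClosed U) (hV : IsClosed V) (hUV : U ∪ V = univ)
    (hUVD : U ∩ V = D) (hUD : U ≠ D) (hVD : V ≠ D) :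
    (U = A ∪ D ∧ V = B ∪ D) ∨ (U = B ∪ D ∧ V = A ∪ D) := by
  have hUV' : ∀ z, z ∈ U ∨ z ∈ V := fun z => (hUV ▸ mem_univ z : z ∈ U ∪ V)
  have hmem : ∀ z, z ∈ D ↔ z ∈ U ∧ z ∈ V := fun z => by rw [← hUVD]; rfl
  have hABD : ∀ z, z ∈ A ∨ z ∈ B ↔ z ∉ D := fun z => by rw [← mem_compl_iff, ← hun]; rfl
  -- The sets `Vᶜ = U \ D` and `Uᶜ = V \ D` are disjoint, open and cover `Dᶜ`, so each of the
  -- connected sets `A` and `B` lies in one of them.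
  have hdisj : Disjoint Vᶜ Uᶜ := disjoint_left.2 fun z hz hz' => (hUV' z).elim hz' hz
  have hsub : Dᶜ ⊆ Vᶜ ∪ Uᶜ := fun z hz => by
    by_contra h
    rw [mem_union, not_or, notMem_compl_iff, notMem_compl_iff] at h
    exact hz ((hmem z).2 ⟨h.2, h.1⟩)
  have hAs := hA.subset_left_of_disjoint_of_mem hV.isOpen_compl hU.isOpen_compl hdisj
    ((subset_union_left.trans hun.subset).trans hsub)
  have hBs := hB.subset_left_of_disjoint_of_mem hV.isOpen_compl hU.isOpen_compl hdisj
    ((subset_union_right.trans hun.subset).trans hsub)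
  have key : ∀ {A B U V : Set M}, (∀ z, z ∈ D ↔ z ∈ U ∧ z ∈ V) →
      (∀ z, z ∈ A ∨ z ∈ B ↔ z ∉ D) → (∀ z, z ∈ U ∨ z ∈ V) → A ⊆ Vᶜ → B ⊆ Uᶜ → U = A ∪ D := by
    intro A B U V hmem hABD hUV hAV hBU
    ext z
    have h1 := hmem z
    have h2 := hABD z
    have h3 := hUV z
    have h4 : z ∈ A → z ∉ V := fun h => hAV h
    have h5 : z ∈ B → z ∉ U := fun h => hBU h
    rw [mem_union]
    tauto
  rcases hAs with h1 | h1 <;> rcases hBs with h2 | h2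
  -- If both pieces avoid `V`, nothing but `D` is left for `V`.
  · refine absurd ?_ hVD
    ext z
    have e1 := hmem z
    have e2 := hABD z
    have e4 : z ∈ A → z ∉ V := fun h => h1 h
    have e5 : z ∈ B → z ∉ V := fun h => h2 h
    tauto
  · exact Or.inl ⟨key hmem hABD hUV' h1 h2, key (fun z => by rw [hmem, and_comm])
      (fun z => by rw [← hABD, or_comm]) (fun z => (hUV' z).symm) h2 h1⟩
  · exact Or.inr ⟨key hmem (fun z => by rw [← hABD, or_comm]) hUV' h2 h1,
      key (fun z => by rw [hmem, and_comm]) hABD (fun z => (hUV' z).symm) h1 h2⟩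
  · refine absurd ?_ hUD
    ext z
    have e1 := hmem z
    have e2 := hABD z
    have e4 : z ∈ A → z ∉ U := fun h => h1 h
    have e5 : z ∈ B → z ∉ U := fun h => h2 h
    tauto

variable {M : Type*} [TopologicalSpace M] [ChartedSpace (EuclideanHalfSpace 3) M]

theorem exists_circle_coe_eq {z : ℂ} (hz : ‖z‖ = 1) : ∃ w : Circle, (w : ℂ) = z :=
  ⟨⟨z, mem_sphere_zero_iff_norm.2 hz⟩, rfl⟩

/-- Both sides of a splitting disc meet the boundary of the manifold. -/
theorem IsSplittingDisc.inter_boundary_nonempty [T2Space M] [IsManifold (𝓡∂ 3) 1 M]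
    {D A B : Set M} (hD : IsSplittingDisc D) (hA : IsOpen A) (hB : IsOpen B)
    (hAB : Disjoint A B) (hun : A ∪ B = Dᶜ) (hDA : D ⊆ closure A) (hDB : D ⊆ closure B) :
    (A ∩ (𝓡∂ 3).boundary M).Nonempty ∧ (B ∩ (𝓡∂ 3).boundary M).Nonempty := by
  obtain ⟨x, hx, hxb⟩ : ∃ x ∈ D, x ∈ (𝓡∂ 3).boundary M := by
    obtain ⟨f, -, -, -, hfD, -, hbd, -⟩ := hD
    have hs := planeIso_mem_sphere 1
    exact ⟨_, hfD ▸ mem_image_of_mem f (sphere_subset_closedBall hs), hbd (mem_image_of_mem f hs)⟩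
  obtain ⟨G, hG⟩ := hD.exists_isStraightening hx Filter.univ_mem
  obtain ⟨s, W, P, N, -, -, -, -, -, -, hWo, hxW, -, hPN, -, -, -, hPc, hNc, -, -, hbd⟩ :=
    hG.exists_sides hx
  obtain ⟨⟨y, hyP, hyb⟩, z, hzN, hzb⟩ := hbd hxb
  have hAD : Disjoint A D := disjoint_left.2 fun z hz hzD => (hun ▸ Or.inl hz : z ∈ Dᶜ) hzD
  have hBD : Disjoint B D := disjoint_left.2 fun z hz hzD => (hun ▸ Or.inr hz : z ∈ Dᶜ) hzD
  rcases opposite_sides hPc hNc hA hB hAB (hWo.mem_nhds hxW) hPN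
    (fun z hz => hun ▸ hz.2) hAD hBD (hDA hx) (hDB hx) with ⟨h1, h2⟩ | ⟨h1, h2⟩
  · exact ⟨⟨y, h1 hyP, hyb⟩, ⟨z, h2 hzN, hzb⟩⟩
  · exact ⟨⟨z, h2 hzN, hzb⟩, ⟨y, h1 hyP, hyb⟩⟩

/-- The two sides of a splitting disc in a homotopy disc are bounded by spheres. -/
theorem IsSplittingDisc.isSubmanifold3BoundedBySphere [T2Space M] [IsManifold (𝓡∂ 3) 1 M]
    (hM : IsHomotopyDisc3 M) {D A B : Set M} (hD : IsSplittingDisc D) (hA : IsOpen A)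
    (hB : IsOpen B) (hAB : Disjoint A B) (hun : A ∪ B = Dᶜ) (hDA : D ⊆ closure A)
    (hDB : D ⊆ closure B) :
    IsSubmanifold3BoundedBySphere (A ∪ D) ∧ IsSubmanifold3BoundedBySphere (B ∪ D) := by
  obtain ⟨⟨a, haA, hab⟩, ⟨b, hbB, hbb⟩⟩ :=
    hD.inter_boundary_nonempty hA hB hAB hun hDA hDB
  obtain ⟨g, hg, hgr⟩ := hM.boundary_sphere
  have hD' := hD
  obtain ⟨f, hf, hinj, hder, hfD, hint, hbd, -⟩ := hD'
  obtain ⟨c, A', B', hc, -, -, hA'c, hB'c, hAB', hun', ⟨p, hp, hpi, hpA, hpc⟩,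
    ⟨q, hq, hqi, hqB, hqc⟩⟩ := exists_boundary_discs hf hinj hder hg (hgr ▸ hbd)
  have hginj := hg.isEmbedding.injective
  have hgc := hg.isEmbedding.continuous
  have hcirc : g '' range c = f '' sphere 0 1 := by
    apply Subset.antisymm
    · rintro _ ⟨_, ⟨z, rfl⟩, rfl⟩
      rw [hc]
      exact mem_image_of_mem f (planeIso_mem_sphere z)
    · rintro _ ⟨u, hu, rfl⟩
      obtain ⟨z, hz⟩ := exists_circle_coe_eq (z := planeIso.symm u) (by
        rw [planeIso.symm.norm_map]
        exact mem_sphere_zero_iff_norm.1 hu)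
      refine ⟨c z, mem_range_self _, ?_⟩
      rw [hc, hz, planeIso.apply_symm_apply]
  have hDbd : ∀ u, g u ∈ D → u ∈ range c := by
    intro u hu
    have hub : g u ∈ (𝓡∂ 3).boundary M := hgr ▸ mem_range_self u
    rw [← hfD, ← ball_union_sphere, image_union] at hu
    have h1 := hu.resolve_left fun h =>
      disjoint_left.1 ((𝓡∂ 3).disjoint_interior_boundary (M := M)) (hint h) hub
    rw [← hcirc] at h1
    obtain ⟨w, hw, hwu⟩ := h1
    exact hginj hwu ▸ hw
  have hsub : ∀ S : Set StdSphere2, S ⊆ A' ∪ B' → g '' S ⊆ A ∪ B := by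
    rintro S hS _ ⟨u, hu, rfl⟩
    rw [hun]
    intro huD
    exact (hun' ▸ hS hu : u ∈ (range c)ᶜ) (hDbd u huD)
  -- Each component of `∂M \ ∂D` is connected and misses `D`, so it lies on one side of `D`.
  have hsideA := (hA'c.isPreconnected.image g hgc.continuousOn).subset_left_of_disjoint_of_mem
    hA hB hAB (hsub A' subset_union_left)
  have hsideB := (hB'c.isPreconnected.image g hgc.continuousOn).subset_left_of_disjoint_of_mem
    hA hB hAB (hsub B' subset_union_right)
  have hcover : ∀ x ∈ (𝓡∂ 3).boundary M, x ∉ D → x ∈ g '' A' ∪ g '' B' := by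
    intro x hx hxD
    obtain ⟨u, rfl⟩ : x ∈ range g := hgr ▸ hx
    rw [← image_union, hun']
    refine mem_image_of_mem g ?_
    rintro ⟨z, rfl⟩
    apply hxD
    rw [hc, ← hfD]
    exact mem_image_of_mem f (sphere_subset_closedBall (planeIso_mem_sphere z))
  -- the boundary part of a side, given the corresponding side of the curve
  have hpart : ∀ {A B : Set M} {A' B' : Set StdSphere2}, Disjoint A B → A ∪ B = Dᶜ →
      (∀ x ∈ (𝓡∂ 3).boundary M, x ∉ D → x ∈ g '' A' ∪ g '' B') → g '' A' ⊆ A → g '' B' ⊆ B →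
      A ∩ (𝓡∂ 3).boundary M = g '' A' := by
    intro A B A' B' hAB hun hcover hA' hB'
    apply Subset.antisymm
    · rintro x ⟨hxA, hxb⟩
      refine (hcover x hxb (hun ▸ Or.inl hxA : x ∈ Dᶜ)).resolve_right fun h => ?_
      exact disjoint_left.1 hAB hxA (hB' h)
    · intro x hx
      refine ⟨hA' hx, ?_⟩
      rw [← hgr]
      exact image_subset_range _ _ hx
  have hfinal : ∀ {A B : Set M} {A' : Set StdSphere2} {p : ℂ → StdSphere2}, IsOpen A → IsOpen B →
      Disjoint A B → A ∪ B = Dᶜ → D ⊆ closure A → D ⊆ closure B →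
      ContinuousOn p (closedBall 0 1) → InjOn p (closedBall 0 1) →
      p '' closedBall 0 1 = A' ∪ range c → (∀ z : Circle, p z = c z) →
      A ∩ (𝓡∂ 3).boundary M = g '' A' → IsSubmanifold3BoundedBySphere (A ∪ D) := by
    intro A B A' p hA hB hAB hun hDA hDB hp hpi hpA hpc hAA'
    refine isSubmanifold3BoundedBySphere_of_side hD hf.continuousOn hinj hfD hint hbd hA hB hAB hun
      hDA hDB (p := g ∘ p) (hgc.comp_continuousOn hp) (hginj.comp_injOn hpi) ?_ ?_
    · intro z hz
      obtain ⟨w, rfl⟩ := exists_circle_coe_eq hz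
      rw [Function.comp_apply, hpc, hc]
    · rw [image_comp, hpA, image_union, hcirc, hAA']
  have hun2 : B ∪ A = Dᶜ := by rw [union_comm]; exact hun
  have haD : a ∉ D := (hun ▸ Or.inl haA : a ∈ Dᶜ)
  have hbD : b ∉ D := (hun ▸ Or.inr hbB : b ∈ Dᶜ)
  have hcover2 : ∀ x ∈ (𝓡∂ 3).boundary M, x ∉ D → x ∈ g '' B' ∪ g '' A' :=
    fun x h1 h2 => (hcover x h1 h2).symm
  rcases hsideA with h1 | h1 <;> rcases hsideB with h2 | h2
  -- Both components on the same side is impossible, because each side of `D` contains a point of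
  -- `∂M`.
  · exact absurd ((hcover b hbb hbD).elim (fun h => h1 h) fun h => h2 h)
      (disjoint_right.1 hAB hbB)
  · exact ⟨hfinal hA hB hAB hun hDA hDB hp hpi hpA hpc (hpart hAB hun hcover h1 h2),
      hfinal hB hA hAB.symm hun2 hDB hDA hq hqi hqB hqc (hpart hAB.symm hun2 hcover2 h2 h1)⟩
  · exact ⟨hfinal hA hB hAB hun hDA hDB hq hqi hqB hqc (hpart hAB hun hcover2 h2 h1),
      hfinal hB hA hAB.symm hun2 hDB hDA hp hpi hpA hpc (hpart hAB.symm hun2 hcover h1 h2)⟩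
  · exact absurd ((hcover a hab haD).elim (fun h => h1 h) fun h => h2 h)
      (disjoint_left.1 hAB haA)

end Main

theorem mainTheorem6 {M : Type*} [TopologicalSpace M] [T2Space M]
    [ChartedSpace (EuclideanHalfSpace 3) M] [IsManifold (𝓡∂ 3) 1 M]
    (hM : IsHomotopyDisc3 M) (D : Set M) (hD : IsSplittingDisc D) :
    ∃ U V : Set M,
      U ≠ V ∧ U ∪ V = univ ∧ U ∩ V = D ∧
      IsSubmanifold3BoundedBySphere U ∧ IsSubmanifold3BoundedBySphere V ∧
      ∀ U' V' : Set M, U' ≠ V' → IsTopSubmanifold3 U' → IsTopSubmanifold3 V' →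
        U' ∪ V' = univ → U' ∩ V' = D →
        (U' = U ∧ V' = V) ∨ (U' = V ∧ V' = U) := by
  have := hM.simplyConnected
  obtain ⟨A, B, hA, hB, hAc, hBc, hAB, hun, hDA, hDB⟩ := hD.exists_separation
  obtain ⟨hU, hV⟩ := hD.isSubmanifold3BoundedBySphere hM hA hB hAB hun hDA hDB
  have hAD : ∀ z ∈ A, z ∉ D := fun z hz => (hun ▸ Or.inl hz : z ∈ Dᶜ)
  have hBD : ∀ z ∈ B, z ∉ D := fun z hz => (hun ▸ Or.inr hz : z ∈ Dᶜ)
  refine ⟨A ∪ D, B ∪ D, ?_, ?_, ?_, hU, hV, ?_⟩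
  · intro h
    obtain ⟨a, ha⟩ := hAc.nonempty
    have h1 : a ∈ B ∪ D := h ▸ Or.inl ha
    exact h1.elim (disjoint_left.1 hAB ha) (hAD a ha)
  · rw [← union_union_distrib_right, hun, compl_union_self]
  · rw [← inter_union_distrib_right, hAB.inter_eq, empty_union]
  · intro U' V' _ hU' hV' hUV hUVD
    -- The pair of `D` and the whole of `M` also covers `M` and meets in `D`; the requirement that
    -- both sets be 3-manifolds serves to exclude it.
    refine eq_of_decomposition hAc.isPreconnected hBc.isPreconnected hun hU'.1 hV'.1 hUV hUVD ?_ ?_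
    · rintro rfl
      exact hD.not_nonempty_chartedSpace hU'.2
    · rintro rfl
      exact hD.not_nonempty_chartedSpace hV'.2
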